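/- Fix $\sigma>0$ and an integer $m>3$. Let $\mathbb T=\mathbb R/2\pi\mathbb Z$ and $\Pi=\mathbb T\times[0,1]$, with coordinates $(x,\psi)$; all functions are complex valued. Spaces. $H^{n}[0,1]$ is the Sobolev space with norm $\|F\|^2=\sum_{p\le n}\|D^pF\|^2_{L^2(0,1)}$. For real $s$, $X^s_\sigma$ is the space of functions $a(x)=\sum_{k\in\mathbb Z}\hat a_ke^{ikx}$ on $\mathbb T$ with $$\|a\|_{X_\sigma^s}^2=\sum_{k}(1+k^2)^s e^{2\sigma|k|}|\hat a_k|^2<\infty ,$$ and $Y^m_\sigma$ is the space of functions $a(x,\psi)=\sum_{k\in\mathbb Z}\hat a_k(\psi)e^{ikx}$ on $\Pi$ with $\hat a_k\in H^m[0,1]$ and $$\|a\|_{Y_\sigma^m}^2=\sum_{p+q\le m}\ \sum_{k}k^{2q}e^{2\sigma|k|}\,\|D^p\hat a_k\|_{L^2(0,1)}^2<\infty$$ (with $p,q\ge 0$ and $0^0=1$). Put $\mathcal D=X_\sigma^{m-1/2}\times X_\sigma^{m-1/2}\times H^{m-2}[0,1]$. Equation. For $a\in Y^m_\sigma$ with $a_\psi\neq0$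 on $\mathbb T\times(0,1)$ let $$\Phi(a)=-\frac{1}{a_\psi}a_{xx}+\frac{2a_x}{a_\psi^2}a_{x\psi}-\frac{1+a_x^2}{a_\psi^3}a_{\psi\psi}.$$ Say that $a\in Y_\sigma^m$ solves the boundary value problem with data $(f,g,F)\in\mathcal D$ if $a_\psi\ne0$ and $\Phi(a)(x,\psi)=F(\psi)$ on $\mathbb T\times(0,1)$, and $a(x,0)=f(x)$, $a(x,1)=g(x)$ for $x\in\mathbb T$. Let $\mathcal S\subset Y_\sigma^m$ be the set of stationary flows without stagnation points, represented by their flow lines $y=a(x,\psi)$: all $a\in Y_\sigma^m$ with $a_\psi\neq 0$ and $\Phi(a)=F(\psi)$ on $\mathbb T\times(0,1)$ for some $F\in H^{m-2}[0,1]$. Theorem. There are an open neighbourhood $U$ of $(0,1,0)$ in $\mathcal D$, an open neighbourhood $V$ of the parallel flow $a(x,\psi)=\psi$ in $Y_\sigma^m$, and a map $G:U\to V$ such that: 1. for every $(f,g,F)\in U$, $G(f,g,F)$ is the unique $a\in V$ that solves the boundary value problem with data $(f,g,F)$; in particular $G(0,1,0)=\psi$; 2. $G$ is complex-analytic as a map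 from an open subset of $\mathcal D$ to $Y_\sigma^m$; 3. $\mathcal S\cap V=G(U)$, and $\mathcal S\cap V$ is a complex-analytic Banach submanifold of the Banach space $Y_\sigma^m$ modelled on the Banach space $\mathcal D$ (near each of its points, a biholomorphic change of coordinates of $Y^m_\sigma$ maps it to an open piece of a complemented closed subspace isomorphic to $\mathcal D$). -/

import Mathlib

open MeasureTheory Set
open scoped ContDiff ENNReal

noncomputable section

namespace StationaryFlow

instance factTwoPiPos : Fact (0 < 2 * Real.pi) := ⟨Real.two_pi_pos⟩

/-- The circle `ℝ / 2πℤ`. The functions `fourier k` on it are `x ↦ exp (i k x)`, and `fourierCoeff`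
is taken with respect to the normalized measure `dx / 2π`. -/
abbrev Circ : Type := AddCircle (2 * Real.pi)

/-- The closed interval `[0,1]`. -/
abbrev I : Type := Icc (0 : ℝ) 1

/-- The complex Hilbert space `L²(0,1)`. -/
abbrev L2 : Type := Lp ℂ 2 ((volume : Measure ℝ).restrict (Ioo (0 : ℝ) 1))

/-- The point of `[0,1]` nearest to `t`; this is `t` itself when `t ∈ [0,1]`. -/
abbrev toI (t : ℝ) : I := projIcc (0 : ℝ) 1 zero_le_one t

/-! ### Weak derivatives and the Sobolev spaces `H^n[0,1]` -/

/-- `v ∈ L²(0,1)` is the weak derivative of order `p` of the continuous function `u` on `(0,1)`. -/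
def IsWeakDeriv (p : ℕ) (u : C(I, ℂ)) (v : L2) : Prop :=
  ∀ φ : ℝ → ℝ, ContDiff ℝ ∞ φ → HasCompactSupport φ → tsupport φ ⊆ Ioo 0 1 →
    ∫ t in Ioo (0 : ℝ) 1, iteratedDeriv p φ t • u (toI t) =
      (-1) ^ p * ∫ t in Ioo (0 : ℝ) 1, φ t • v t

theorem integrable_test_smul_continuous {ψ : ℝ → ℝ} (hψ : Continuous ψ) (u : C(I, ℂ)) :
    IntegrableOn (fun t : ℝ => ψ t • u (toI t)) (Ioo (0 : ℝ) 1) := by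
  have hc : Continuous (fun t : ℝ => ψ t • u (toI t)) :=
    hψ.smul (u.continuous.comp continuous_projIcc)
  exact (hc.integrableOn_Icc (a := 0) (b := 1)).mono_set Ioo_subset_Icc_self

theorem integrable_L2 (v : L2) :
    Integrable (fun t : ℝ => v t) ((volume : Measure ℝ).restrict (Ioo (0 : ℝ) 1)) :=
  (Lp.memLp v).integrable (by norm_num)

theorem integrable_test_smul_L2 {φ : ℝ → ℝ} (hφ : Continuous φ) (hc : HasCompactSupport φ)
    (v : L2) : IntegrableOn (fun t : ℝ => φ t • v t) (Ioo (0 : ℝ) 1) := by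
  obtain ⟨C, hC⟩ := hc.exists_bound_of_continuous hφ
  exact (integrable_L2 v).bdd_smul C hφ.aestronglyMeasurable (Filter.Eventually.of_forall hC)

theorem IsWeakDeriv.add {p : ℕ} {u u' : C(I, ℂ)} {v v' : L2} (h : IsWeakDeriv p u v)
    (h' : IsWeakDeriv p u' v') : IsWeakDeriv p (u + u') (v + v') := by
  intro φ hφ hc hs
  have hd : Continuous (iteratedDeriv p φ) := hφ.continuous_iteratedDeriv p (by exact_mod_cast le_top)
  have e1 : ∫ t in Ioo (0 : ℝ) 1, iteratedDeriv p φ t • (u + u') (toI t) =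
      (∫ t in Ioo (0 : ℝ) 1, iteratedDeriv p φ t • u (toI t)) +
        ∫ t in Ioo (0 : ℝ) 1, iteratedDeriv p φ t • u' (toI t) := by
    rw [← integral_add (integrable_test_smul_continuous hd u)
      (integrable_test_smul_continuous hd u')]
    simp only [ContinuousMap.add_apply, smul_add]
  have e2 : ∫ t in Ioo (0 : ℝ) 1, φ t • (v + v') t =
      (∫ t in Ioo (0 : ℝ) 1, φ t • v t) + ∫ t in Ioo (0 : ℝ) 1, φ t • v' t := by
    rw [← integral_add (integrable_test_smul_L2 hφ.continuous hc v)
      (integrable_test_smul_L2 hφ.continuous hc v')]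
    refine integral_congr_ae ?_
    filter_upwards [Lp.coeFn_add v v'] with t ht
    rw [ht, Pi.add_apply, smul_add]
  rw [e1, e2, h φ hφ hc hs, h' φ hφ hc hs, mul_add]

theorem IsWeakDeriv.smul {p : ℕ} {u : C(I, ℂ)} {v : L2} (c : ℂ) (h : IsWeakDeriv p u v) :
    IsWeakDeriv p (c • u) (c • v) := by
  intro φ hφ hc hs
  have e1 : ∫ t in Ioo (0 : ℝ) 1, iteratedDeriv p φ t • (c • u) (toI t) =
      c * ∫ t in Ioo (0 : ℝ) 1, iteratedDeriv p φ t • u (toI t) := by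
    rw [← integral_const_mul]
    refine integral_congr_ae (Filter.Eventually.of_forall fun t => ?_)
    simp only [ContinuousMap.smul_apply, Complex.real_smul, smul_eq_mul]
    ring
  have e2 : ∫ t in Ioo (0 : ℝ) 1, φ t • (c • v) t = c * ∫ t in Ioo (0 : ℝ) 1, φ t • v t := by
    rw [← integral_const_mul]
    refine integral_congr_ae ?_
    filter_upwards [Lp.coeFn_smul c v] with t ht
    rw [ht]
    simp only [Pi.smul_apply, Complex.real_smul, smul_eq_mul]
    ring
  rw [e1, e2, h φ hφ hc hs]
  ring

theorem IsWeakDeriv.zero (p : ℕ) : IsWeakDeriv p 0 0 := by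
  intro φ hφ hc hs
  have e2 : ∫ t in Ioo (0 : ℝ) 1, φ t • (0 : L2) t = 0 := by
    rw [← integral_zero ℝ ℂ (μ := (volume : Measure ℝ).restrict (Ioo (0 : ℝ) 1))]
    refine integral_congr_ae ?_
    filter_upwards [Lp.coeFn_zero ℂ 2 ((volume : Measure ℝ).restrict (Ioo (0 : ℝ) 1))] with t ht
    rw [ht]; simp
  rw [e2]; simp

theorem IsWeakDeriv.eq_zero {p : ℕ} {w : L2} (h : IsWeakDeriv p 0 w) : w = 0 := by
  have key : ∀ᵐ t ∂(volume : Measure ℝ), t ∈ Ioo (0 : ℝ) 1 → w t = 0 := by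
    refine isOpen_Ioo.ae_eq_zero_of_integral_contDiff_smul_eq_zero ?_ ?_
    · exact IntegrableOn.locallyIntegrableOn (integrable_L2 w)
    · intro φ hφ hc hs
      have h1 := h φ hφ hc hs
      simp only [ContinuousMap.zero_apply, smul_zero, integral_zero] at h1
      have h2 : ∫ t in Ioo (0 : ℝ) 1, φ t • w t = 0 := by
        rcases mul_eq_zero.mp h1.symm with h3 | h3
        · exact absurd h3 (pow_ne_zero p (by norm_num))
        · exact h3
      rw [← h2]
      refine (setIntegral_eq_integral_of_forall_compl_eq_zero fun t ht => ?_).symm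
      rw [image_eq_zero_of_notMem_tsupport (fun h' => ht (hs h')), zero_smul]
  refine (Lp.eq_zero_iff_ae_eq_zero).mpr ?_
  exact (ae_restrict_iff' measurableSet_Ioo).mpr key

theorem IsWeakDeriv.unique {p : ℕ} {u : C(I, ℂ)} {v v' : L2} (h : IsWeakDeriv p u v)
    (h' : IsWeakDeriv p u v') : v = v' := by
  have h0 := h.add (h'.smul (-1))
  rw [neg_one_smul ℂ u, neg_one_smul ℂ v', add_neg_cancel, ← sub_eq_add_neg] at h0
  exact sub_eq_zero.mp h0.eq_zero

/-- `u` belongs to `H^n(0,1)`: all weak derivatives of order at most `n` exist and are in `L²`. -/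
def IsSobolev (n : ℕ) (u : C(I, ℂ)) : Prop := ∀ p ≤ n, ∃ v : L2, IsWeakDeriv p u v

open Classical in
/-- The weak derivative `D^p u` in `L²(0,1)` (zero if it does not exist). -/
def weakDeriv (p : ℕ) (u : C(I, ℂ)) : L2 :=
  if h : ∃ v : L2, IsWeakDeriv p u v then h.choose else 0

theorem weakDeriv_eq {p : ℕ} {u : C(I, ℂ)} {v : L2} (h : IsWeakDeriv p u v) :
    weakDeriv p u = v := by
  have hex : ∃ v : L2, IsWeakDeriv p u v := ⟨v, h⟩
  rw [weakDeriv, dif_pos hex]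
  exact hex.choose_spec.unique h

theorem IsSobolev.isWeakDeriv {n p : ℕ} {u : C(I, ℂ)} (h : IsSobolev n u) (hp : p ≤ n) :
    IsWeakDeriv p u (weakDeriv p u) := by
  obtain ⟨v, hv⟩ := h p hp
  rwa [weakDeriv_eq hv]

theorem IsSobolev.add {n : ℕ} {u v : C(I, ℂ)} (hu : IsSobolev n u) (hv : IsSobolev n v) :
    IsSobolev n (u + v) := fun _ hp =>
  ⟨_, (hu.isWeakDeriv hp).add (hv.isWeakDeriv hp)⟩

theorem IsSobolev.smul {n : ℕ} {u : C(I, ℂ)} (c : ℂ) (hu : IsSobolev n u) :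
    IsSobolev n (c • u) := fun _ hp => ⟨_, (hu.isWeakDeriv hp).smul c⟩

theorem IsSobolev.zero (n : ℕ) : IsSobolev n 0 := fun p _ => ⟨0, IsWeakDeriv.zero p⟩

theorem weakDeriv_add {n p : ℕ} {u v : C(I, ℂ)} (hu : IsSobolev n u) (hv : IsSobolev n v)
    (hp : p ≤ n) : weakDeriv p (u + v) = weakDeriv p u + weakDeriv p v :=
  weakDeriv_eq ((hu.isWeakDeriv hp).add (hv.isWeakDeriv hp))

theorem weakDeriv_smul {n p : ℕ} {u : C(I, ℂ)} (c : ℂ) (hu : IsSobolev n u) (hp : p ≤ n) :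
    weakDeriv p (c • u) = c • weakDeriv p u :=
  weakDeriv_eq ((hu.isWeakDeriv hp).smul c)

theorem memLp_continuous (u : C(I, ℂ)) :
    MemLp (fun t : ℝ => u (toI t)) 2 ((volume : Measure ℝ).restrict (Ioo (0 : ℝ) 1)) := by
  refine MemLp.of_bound (u.continuous.comp continuous_projIcc).aestronglyMeasurable ‖u‖
    (Filter.Eventually.of_forall fun t => u.norm_coe_le_norm _)

theorem isWeakDeriv_self (u : C(I, ℂ)) : IsWeakDeriv 0 u (memLp_continuous u).toLp := by
  intro φ _ _ _
  rw [pow_zero, one_mul, iteratedDeriv_zero]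
  refine integral_congr_ae ?_
  filter_upwards [(memLp_continuous u).coeFn_toLp] with t ht
  rw [ht]

theorem eq_zero_of_weakDeriv_zero {u : C(I, ℂ)} (h : weakDeriv 0 u = 0) : u = 0 := by
  rw [weakDeriv_eq (isWeakDeriv_self u), Lp.eq_zero_iff_ae_eq_zero] at h
  have h2 : (fun t : ℝ => u (toI t)) =ᵐ[volume.restrict (Ioo (0 : ℝ) 1)] fun _ => 0 :=
    ((memLp_continuous u).coeFn_toLp).symm.trans h
  have hc : Continuous (fun t : ℝ => u (toI t)) := u.continuous.comp continuous_projIcc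
  have h3 : EqOn (fun t : ℝ => u (toI t)) (fun _ => 0) (Ioo 0 1) :=
    Measure.eqOn_open_of_ae_eq h2 isOpen_Ioo hc.continuousOn continuousOn_const
  have h4 : EqOn (fun t : ℝ => u (toI t)) (fun _ => 0) (closure (Ioo 0 1)) :=
    h3.closure hc continuous_const
  rw [closure_Ioo zero_ne_one] at h4
  ext t
  have := h4 t.2
  simpa [toI, projIcc_val] using this

/-- The Sobolev space `H^n[0,1]`, for `n ≥ 1`, where its elements are continuous functions on
`[0,1]`. -/
def sobolevSubmodule (n : ℕ) : Submodule ℂ C(I, ℂ) where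
  carrier := {u | IsSobolev n u}
  add_mem' := IsSobolev.add
  zero_mem' := IsSobolev.zero n
  smul_mem' := fun c _ h => IsSobolev.smul c h

/-- The Sobolev space `H^n[0,1]` with its own norm (not the supremum norm). -/
def HSpace (n : ℕ) : Type := sobolevSubmodule n

instance (n : ℕ) : AddCommGroup (HSpace n) := inferInstanceAs (AddCommGroup (sobolevSubmodule n))

instance (n : ℕ) : Module ℂ (HSpace n) := inferInstanceAs (Module ℂ (sobolevSubmodule n))

/-- The function on `[0,1]` underlying an element of `H^n[0,1]`. -/
def HSpace.toFun {n : ℕ} (F : HSpace n) : C(I, ℂ) := F.1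

/-- `F ↦ (D^p F)_{p ≤ n}`. -/
def HSpace.jet (n : ℕ) : HSpace n →ₗ[ℂ] PiLp 2 (fun _ : Fin (n + 1) => L2) where
  toFun F := WithLp.toLp 2 fun p => weakDeriv p F.1
  map_add' F G := by
    ext1 p
    exact weakDeriv_add F.2 G.2 (Nat.lt_succ_iff.mp p.2)
  map_smul' c F := by
    ext1 p
    exact weakDeriv_smul c F.2 (Nat.lt_succ_iff.mp p.2)

theorem HSpace.jet_injective (n : ℕ) : Function.Injective (HSpace.jet n) := by
  refine (injective_iff_map_eq_zero _).mpr fun F hF => ?_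
  have h0 : weakDeriv 0 F.1 = 0 := congrArg (fun z => z.ofLp 0) hF
  exact Subtype.ext (eq_zero_of_weakDeriv_zero h0)

instance (n : ℕ) : NormedAddCommGroup (HSpace n) :=
  NormedAddCommGroup.induced _ _ (HSpace.jet n) (HSpace.jet_injective n)

instance (n : ℕ) : NormedSpace ℂ (HSpace n) := NormedSpace.induced ℂ _ _ (HSpace.jet n)

theorem HSpace.norm_sq (n : ℕ) (F : HSpace n) :
    ‖F‖ ^ 2 = ∑ p ∈ Finset.range (n + 1), ‖weakDeriv p F.toFun‖ ^ 2 := by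
  change ‖HSpace.jet n F‖ ^ 2 = _
  rw [PiLp.norm_sq_eq_of_L2, Finset.sum_range]
  rfl

/-! ### The spaces `X_σ^s` of analytic functions on the circle -/

/-- The weight `(1 + k²)^{s/2} e^{σ|k|}`. -/
def xWeight (σ s : ℝ) (k : ℤ) : ℝ := (1 + (k : ℝ) ^ 2) ^ (s / 2) * Real.exp (σ * |(k : ℝ)|)

theorem xWeight_pos (σ s : ℝ) (k : ℤ) : 0 < xWeight σ s k := by
  unfold xWeight; positivity

theorem fourierCoeff_add_continuous (f g : C(Circ, ℂ)) (k : ℤ) :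
    fourierCoeff (⇑(f + g)) k = fourierCoeff (⇑f) k + fourierCoeff (⇑g) k := by
  rw [ContinuousMap.coe_add, fourierCoeff.add]
  · rfl
  · exact f.continuous.integrable_of_hasCompactSupport (HasCompactSupport.of_compactSpace _)
  · exact g.continuous.integrable_of_hasCompactSupport (HasCompactSupport.of_compactSpace _)

theorem fourierCoeff_smul_continuous (c : ℂ) (f : C(Circ, ℂ)) (k : ℤ) :
    fourierCoeff (⇑(c • f)) k = c • fourierCoeff (⇑f) k := by
  rw [ContinuousMap.coe_smul, fourierCoeff.const_smul]

theorem eq_zero_of_fourierCoeff {f : C(Circ, ℂ)} (h : ∀ k, fourierCoeff (⇑f) k = 0) : f = 0 := by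
  have h0 : fourierCoeff (⇑f) = 0 := funext h
  have hs : Summable (fourierCoeff (⇑f)) := by rw [h0]; exact summable_zero
  have := hasSum_fourier_series_of_summable hs
  simp only [h, zero_smul] at this
  exact this.unique hasSum_zero

/-- The weighted sequence of Fourier coefficients of `a`. -/
def xSeq (σ s : ℝ) (a : C(Circ, ℂ)) (k : ℤ) : ℂ := (xWeight σ s k : ℂ) * fourierCoeff (⇑a) k

theorem xSeq_add (σ s : ℝ) (a b : C(Circ, ℂ)) : xSeq σ s (a + b) = xSeq σ s a + xSeq σ s b := by
  funext k
  simp only [xSeq, Pi.add_apply, fourierCoeff_add_continuous, mul_add]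

theorem xSeq_smul (σ s : ℝ) (c : ℂ) (a : C(Circ, ℂ)) : xSeq σ s (c • a) = c • xSeq σ s a := by
  funext k
  simp only [xSeq, Pi.smul_apply, fourierCoeff_smul_continuous, smul_eq_mul]
  ring

theorem xSeq_zero (σ s : ℝ) : xSeq σ s 0 = 0 := by
  have := xSeq_smul σ s 0 0
  rwa [zero_smul, zero_smul] at this

/-- The functions on the circle with `∑ (1+k²)^s e^{2σ|k|} |â_k|² < ∞`. As `σ > 0`, every such
function is continuous. -/
def xSubmodule (σ s : ℝ) : Submodule ℂ C(Circ, ℂ) where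
  carrier := {a | Memℓp (xSeq σ s a) 2}
  add_mem' := fun {a b} ha hb => by
    change Memℓp (xSeq σ s (a + b)) 2
    rw [xSeq_add]; exact Memℓp.add ha hb
  zero_mem' := by
    change Memℓp (xSeq σ s 0) 2
    rw [xSeq_zero]; exact zero_memℓp
  smul_mem' := fun c a ha => by
    change Memℓp (xSeq σ s (c • a)) 2
    rw [xSeq_smul]; exact Memℓp.const_smul ha c

/-- The space `X_σ^s` with its own norm. -/
def XSpace (σ s : ℝ) : Type := xSubmodule σ s

instance (σ s : ℝ) : AddCommGroup (XSpace σ s) := inferInstanceAs (AddCommGroup (xSubmodule σ s))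

instance (σ s : ℝ) : Module ℂ (XSpace σ s) := inferInstanceAs (Module ℂ (xSubmodule σ s))

/-- The function on the circle underlying an element of `X_σ^s`. -/
def XSpace.toFun {σ s : ℝ} (a : XSpace σ s) : C(Circ, ℂ) := a.1

/-- `a ↦ ((1+k²)^{s/2} e^{σ|k|} â_k)_k` as a map to `ℓ²`. -/
def XSpace.toSeq (σ s : ℝ) : XSpace σ s →ₗ[ℂ] lp (fun _ : ℤ => ℂ) 2 where
  toFun a := ⟨xSeq σ s a.1, a.2⟩
  map_add' a b := Subtype.ext (xSeq_add σ s a.1 b.1)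
  map_smul' c a := Subtype.ext (xSeq_smul σ s c a.1)

theorem XSpace.toSeq_injective (σ s : ℝ) : Function.Injective (XSpace.toSeq σ s) := by
  refine (injective_iff_map_eq_zero _).mpr fun a ha => ?_
  have h0 : xSeq σ s a.1 = 0 := congrArg Subtype.val ha
  refine Subtype.ext (eq_zero_of_fourierCoeff fun k => ?_)
  rcases mul_eq_zero.mp (congrFun h0 k) with h | h
  · exact absurd (Complex.ofReal_eq_zero.mp h) (xWeight_pos σ s k).ne'
  · exact h

instance (σ s : ℝ) : NormedAddCommGroup (XSpace σ s) :=
  NormedAddCommGroup.induced _ _ (XSpace.toSeq σ s) (XSpace.toSeq_injective σ s)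

instance (σ s : ℝ) : NormedSpace ℂ (XSpace σ s) := NormedSpace.induced ℂ _ _ (XSpace.toSeq σ s)

theorem XSpace.norm_sq (σ s : ℝ) (a : XSpace σ s) :
    ‖a‖ ^ 2 = ∑' k : ℤ, (1 + (k : ℝ) ^ 2) ^ s * Real.exp (2 * σ * |(k : ℝ)|) *
      ‖fourierCoeff (⇑a.toFun) k‖ ^ 2 := by
  have h := lp.norm_rpow_eq_tsum (p := 2) (by norm_num) (XSpace.toSeq σ s a)
  have h2 : ‖a‖ = ‖XSpace.toSeq σ s a‖ := rfl
  simp only [ENNReal.toReal_ofNat, Real.rpow_ofNat] at h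
  rw [h2, h]
  refine tsum_congr fun k => ?_
  change ‖xSeq σ s a.1 k‖ ^ 2 = _
  have h1 : (0 : ℝ) ≤ 1 + (k : ℝ) ^ 2 := by positivity
  rw [xSeq, norm_mul, mul_pow, Complex.norm_real, Real.norm_eq_abs, sq_abs, xWeight, mul_pow,
    ← Real.rpow_natCast, ← Real.rpow_mul h1, ← Real.exp_nat_mul]
  congr 3
  · push_cast; ring
  · push_cast; ring

/-! ### The spaces `Y_σ^m` of partially analytic functions on the periodic strip -/

/-- The periodic strip `Π = 𝕋 × [0,1]`. -/
abbrev Strip : Type := Circ × I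

/-- The restriction of `a` to the flow line with parameter `ψ`. -/
def slice (a : C(Strip, ℂ)) (ψ : I) : C(Circ, ℂ) := ⟨fun x => a (x, ψ), by fun_prop⟩

/-- The partial Fourier coefficient `â_k(ψ) = (1/2π) ∫ a(x,ψ) e^{-ikx} dx`, a continuous function
of `ψ`. -/
def partialCoeff (a : C(Strip, ℂ)) (k : ℤ) : C(I, ℂ) where
  toFun ψ := fourierCoeff (⇑(slice a ψ)) k
  continuous_toFun := by
    have hc : Continuous (fun q : I × Circ => fourier (-k) q.2 • a (q.2, q.1)) := by fun_prop
    have := continuous_parametric_integral_of_continuous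
      (μ := (AddCircle.haarAddCircle : Measure Circ))
      (f := fun (ψ : I) (x : Circ) => fourier (-k) x • a (x, ψ)) hc isCompact_univ
    rw [Measure.restrict_univ] at this
    exact this

theorem partialCoeff_add (a b : C(Strip, ℂ)) (k : ℤ) :
    partialCoeff (a + b) k = partialCoeff a k + partialCoeff b k :=
  ContinuousMap.ext fun ψ => fourierCoeff_add_continuous (slice a ψ) (slice b ψ) k

theorem partialCoeff_smul (c : ℂ) (a : C(Strip, ℂ)) (k : ℤ) :
    partialCoeff (c • a) k = c • partialCoeff a k :=
  ContinuousMap.ext fun ψ => fourierCoeff_smul_continuous c (slice a ψ) k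

theorem partialCoeff_zero (k : ℤ) : partialCoeff 0 k = 0 := by
  have h := partialCoeff_add 0 0 k
  rwa [add_zero, left_eq_add] at h

/-- The index set `{((p, q), k) : p, q ≥ 0, p + q ≤ m, k ∈ ℤ}`. -/
abbrev YIndex (m : ℕ) : Type := {pq : ℕ × ℕ // pq.1 + pq.2 ≤ m} × ℤ

/-- The family `k^q e^{σ|k|} D^p â_k` in `L²(0,1)`. -/
def ySeq (σ : ℝ) (m : ℕ) (a : C(Strip, ℂ)) (i : YIndex m) : L2 :=
  (((i.2 : ℝ) ^ i.1.1.2 * Real.exp (σ * |(i.2 : ℝ)|) : ℝ) : ℂ) •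
    weakDeriv i.1.1.1 (partialCoeff a i.2)

/-- Membership in `Y_σ^m`: all partial Fourier coefficients are in `H^m[0,1]` and
`∑_{p+q ≤ m} ∑_k k^{2q} e^{2σ|k|} ‖D^p â_k‖² < ∞`. -/
def IsPartiallyAnalytic (σ : ℝ) (m : ℕ) (a : C(Strip, ℂ)) : Prop :=
  (∀ k, IsSobolev m (partialCoeff a k)) ∧ Memℓp (ySeq σ m a) 2

theorem YIndex.fst_le {m : ℕ} (i : YIndex m) : i.1.1.1 ≤ m :=
  le_trans (Nat.le_add_right _ _) i.1.2

theorem ySeq_add {σ : ℝ} {m : ℕ} {a b : C(Strip, ℂ)} (ha : ∀ k, IsSobolev m (partialCoeff a k))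
    (hb : ∀ k, IsSobolev m (partialCoeff b k)) :
    ySeq σ m (a + b) = ySeq σ m a + ySeq σ m b := by
  funext i
  rw [Pi.add_apply, ySeq, ySeq, ySeq, partialCoeff_add, weakDeriv_add (ha _) (hb _) i.fst_le,
    smul_add]

theorem ySeq_smul {σ : ℝ} {m : ℕ} (c : ℂ) {a : C(Strip, ℂ)}
    (ha : ∀ k, IsSobolev m (partialCoeff a k)) :
    ySeq σ m (c • a) = c • ySeq σ m a := by
  funext i
  rw [Pi.smul_apply, ySeq, ySeq, partialCoeff_smul, weakDeriv_smul c (ha _) i.fst_le, smul_comm]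

theorem isPartiallyAnalytic_zero (σ : ℝ) (m : ℕ) : IsPartiallyAnalytic σ m 0 := by
  have h : ∀ k, IsSobolev m (partialCoeff 0 k) := fun k => by
    rw [partialCoeff_zero]; exact IsSobolev.zero m
  refine ⟨h, ?_⟩
  have h2 := ySeq_add (σ := σ) h h
  rw [add_zero, left_eq_add] at h2
  rw [h2]; exact zero_memℓp

/-- The partially analytic functions, for `m ≥ 1` and `σ > 0`, where all of them are continuous on
the closed strip. -/
def ySubmodule (σ : ℝ) (m : ℕ) : Submodule ℂ C(Strip, ℂ) where
  carrier := {a | IsPartiallyAnalytic σ m a}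
  add_mem' := fun {a b} ha hb => by
    refine ⟨fun k => ?_, ?_⟩
    · rw [partialCoeff_add]; exact (ha.1 k).add (hb.1 k)
    · rw [ySeq_add ha.1 hb.1]; exact ha.2.add hb.2
  zero_mem' := isPartiallyAnalytic_zero σ m
  smul_mem' := fun c a ha => by
    refine ⟨fun k => ?_, ?_⟩
    · rw [partialCoeff_smul]; exact (ha.1 k).smul c
    · rw [ySeq_smul c ha.1]; exact ha.2.const_smul c

/-- The space `Y_σ^m` with its own norm. -/
def YSpace (σ : ℝ) (m : ℕ) : Type := ySubmodule σ m

instance (σ : ℝ) (m : ℕ) : AddCommGroup (YSpace σ m) :=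
  inferInstanceAs (AddCommGroup (ySubmodule σ m))

instance (σ : ℝ) (m : ℕ) : Module ℂ (YSpace σ m) := inferInstanceAs (Module ℂ (ySubmodule σ m))

/-- The function on the periodic strip underlying an element of `Y_σ^m`. -/
def YSpace.toFun {σ : ℝ} {m : ℕ} (a : YSpace σ m) : C(Strip, ℂ) := a.1

/-- `a ↦ (k^q e^{σ|k|} D^p â_k)_{p,q,k}` as a map to `ℓ²(L²(0,1))`. -/
def YSpace.toSeq (σ : ℝ) (m : ℕ) : YSpace σ m →ₗ[ℂ] lp (fun _ : YIndex m => L2) 2 where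
  toFun a := ⟨ySeq σ m a.1, a.2.2⟩
  map_add' a b := Subtype.ext (ySeq_add a.2.1 b.2.1)
  map_smul' c a := Subtype.ext (ySeq_smul c a.2.1)

theorem YSpace.toSeq_injective (σ : ℝ) (m : ℕ) : Function.Injective (YSpace.toSeq σ m) := by
  refine (injective_iff_map_eq_zero _).mpr fun a ha => ?_
  have h0 : ySeq σ m a.1 = 0 := congrArg Subtype.val ha
  have h1 : ∀ k, partialCoeff a.1 k = 0 := fun k => by
    have h2 := congrFun h0 (⟨(0, 0), Nat.zero_le m⟩, k)
    rw [ySeq] at h2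
    rcases smul_eq_zero.mp h2 with h | h
    · exact absurd (Complex.ofReal_eq_zero.mp h) (by positivity)
    · exact eq_zero_of_weakDeriv_zero h
  refine Subtype.ext (ContinuousMap.ext fun z => ?_)
  have h3 : slice a.1 z.2 = 0 :=
    eq_zero_of_fourierCoeff fun k => congrArg (fun u : C(I, ℂ) => u z.2) (h1 k)
  exact congrArg (fun u : C(Circ, ℂ) => u z.1) h3

instance (σ : ℝ) (m : ℕ) : NormedAddCommGroup (YSpace σ m) :=
  NormedAddCommGroup.induced _ _ (YSpace.toSeq σ m) (YSpace.toSeq_injective σ m)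

instance (σ : ℝ) (m : ℕ) : NormedSpace ℂ (YSpace σ m) :=
  NormedSpace.induced ℂ _ _ (YSpace.toSeq σ m)

theorem YSpace.norm_sq (σ : ℝ) (m : ℕ) (a : YSpace σ m) :
    ‖a‖ ^ 2 = ∑' i : YIndex m, (i.2 : ℝ) ^ (2 * i.1.1.2) * Real.exp (2 * σ * |(i.2 : ℝ)|) *
      ‖weakDeriv i.1.1.1 (partialCoeff a.toFun i.2)‖ ^ 2 := by
  have h := lp.norm_rpow_eq_tsum (p := 2) (by norm_num) (YSpace.toSeq σ m a)
  have h2 : ‖a‖ = ‖YSpace.toSeq σ m a‖ := rfl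
  simp only [ENNReal.toReal_ofNat, Real.rpow_ofNat] at h
  rw [h2, h]
  refine tsum_congr fun i => ?_
  change ‖ySeq σ m a.1 i‖ ^ 2 = _
  rw [ySeq, norm_smul, mul_pow, Complex.norm_real, Real.norm_eq_abs, sq_abs, mul_pow, ← pow_mul,
    ← Real.exp_nat_mul, mul_comm i.1.1.2 2]
  congr 3
  push_cast; ring

/-! ### The parallel flow -/

theorem fourierCoeff_const (c : ℂ) (k : ℤ) :
    fourierCoeff (fun _ : Circ => c) k = if k = 0 then c else 0 := by
  have h := @fourierCoeff_fourier (2 * Real.pi) _ 0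
  have h1 : fourierCoeff (c • (fun _ : Circ => (1 : ℂ))) k =
      c • fourierCoeff (fun _ : Circ => (1 : ℂ)) k := by
    rw [fourierCoeff.const_smul]
  have h2 : (c • (fun _ : Circ => (1 : ℂ))) = fun _ : Circ => c := by
    funext x; simp
  have h3 : (⇑(fourier 0 : C(Circ, ℂ)) : Circ → ℂ) = fun _ => 1 := by
    funext x; simp
  rw [h3] at h
  rw [← h2, h1, h]
  by_cases hk : k = 0 <;> simp [hk]

theorem support_iteratedDeriv {φ : ℝ → ℝ} (p : ℕ) :
    tsupport (iteratedDeriv p φ) ⊆ tsupport φ := by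
  induction p with
  | zero => rw [iteratedDeriv_zero]
  | succ p ih =>
    rw [iteratedDeriv_succ]
    exact tsupport_deriv_subset.trans ih

theorem test_integral {φ : ℝ → ℝ} (hφ : ContDiff ℝ ∞ φ) (hc : HasCompactSupport φ)
    (hs : tsupport φ ⊆ Ioo 0 1) (p : ℕ) :
    ∫ t in Ioo (0 : ℝ) 1, t * iteratedDeriv (p + 1) φ t =
      - ∫ t in Ioo (0 : ℝ) 1, iteratedDeriv p φ t := by
  have hcont : ∀ q, Continuous (iteratedDeriv q φ) := fun q =>
    hφ.continuous_iteratedDeriv q (by exact_mod_cast le_top)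
  have hcomp : ∀ q, HasCompactSupport (iteratedDeriv q φ) := fun q =>
    IsCompact.of_isClosed_subset hc (isClosed_tsupport _) (support_iteratedDeriv q)
  have hz : ∀ q t, t ∉ Ioo (0 : ℝ) 1 → iteratedDeriv q φ t = 0 := fun q t ht =>
    image_eq_zero_of_notMem_tsupport fun h => ht (hs (support_iteratedDeriv q h))
  rw [setIntegral_eq_integral_of_forall_compl_eq_zero fun t ht => by rw [hz _ t ht, mul_zero],
    setIntegral_eq_integral_of_forall_compl_eq_zero fun t ht => hz _ t ht]
  have hd : ∀ t, HasDerivAt (iteratedDeriv p φ) (iteratedDeriv (p + 1) φ t) t := fun t => by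
    rw [iteratedDeriv_succ]
    exact ((hφ.differentiable_iteratedDeriv p
      (by exact_mod_cast WithTop.coe_lt_top _)) t).hasDerivAt
  have h := integral_mul_deriv_eq_deriv_mul_of_integrable (u := fun t : ℝ => t)
    (u' := fun _ => 1) (fun t _ => hasDerivAt_id t) (fun t _ => hd t)
    ((continuous_id.mul (hcont (p + 1))).integrable_of_hasCompactSupport (hcomp (p + 1)).mul_left)
    ((continuous_const.mul (hcont p)).integrable_of_hasCompactSupport (hcomp p).mul_left)
    ((continuous_id.mul (hcont p)).integrable_of_hasCompactSupport (hcomp p).mul_left)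
  simpa using h

theorem test_integral_deriv {φ : ℝ → ℝ} (hφ : ContDiff ℝ ∞ φ) (hc : HasCompactSupport φ)
    (hs : tsupport φ ⊆ Ioo 0 1) (p : ℕ) :
    ∫ t in Ioo (0 : ℝ) 1, iteratedDeriv (p + 1) φ t = 0 := by
  have hcont : ∀ q, Continuous (iteratedDeriv q φ) := fun q =>
    hφ.continuous_iteratedDeriv q (by exact_mod_cast le_top)
  have hcomp : ∀ q, HasCompactSupport (iteratedDeriv q φ) := fun q =>
    IsCompact.of_isClosed_subset hc (isClosed_tsupport _) (support_iteratedDeriv q)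
  have hz : ∀ q t, t ∉ Ioo (0 : ℝ) 1 → iteratedDeriv q φ t = 0 := fun q t ht =>
    image_eq_zero_of_notMem_tsupport fun h => ht (hs (support_iteratedDeriv q h))
  rw [setIntegral_eq_integral_of_forall_compl_eq_zero fun t ht => hz _ t ht]
  refine integral_eq_zero_of_hasDerivAt_of_integrable (f := iteratedDeriv p φ) (fun t => ?_)
    ((hcont _).integrable_of_hasCompactSupport (hcomp _))
    ((hcont _).integrable_of_hasCompactSupport (hcomp _))
  rw [iteratedDeriv_succ]
  exact ((hφ.differentiable_iteratedDeriv p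
    (by exact_mod_cast WithTop.coe_lt_top _)) t).hasDerivAt

/-- The function `ψ ↦ ψ` on `[0,1]`. -/
def coordFun : C(I, ℂ) := ⟨fun t => ((t : ℝ) : ℂ), by fun_prop⟩

theorem test_coordFun (φ : ℝ → ℝ) :
    ∫ t in Ioo (0 : ℝ) 1, φ t • coordFun (toI t) =
      ((∫ t in Ioo (0 : ℝ) 1, t * φ t : ℝ) : ℂ) := by
  rw [← integral_complex_ofReal]
  refine setIntegral_congr_fun measurableSet_Ioo fun t ht => ?_
  have h : toI t = ⟨t, Ioo_subset_Icc_self ht⟩ := projIcc_of_mem _ _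
  change φ t • coordFun (toI t) = ((t * φ t : ℝ) : ℂ)
  rw [h]
  change φ t • ((t : ℝ) : ℂ) = _
  rw [Complex.real_smul]
  push_cast
  ring

theorem isSobolev_coordFun (n : ℕ) : IsSobolev n coordFun := by
  intro p _
  rcases p with _ | _ | p
  · exact ⟨_, isWeakDeriv_self _⟩
  · refine ⟨(memLp_continuous (ContinuousMap.const I 1)).toLp, fun φ hφ hc hs => ?_⟩
    have e2 : ∫ t in Ioo (0 : ℝ) 1,
        φ t • (memLp_continuous (ContinuousMap.const I 1)).toLp _ t =
          ((∫ t in Ioo (0 : ℝ) 1, φ t : ℝ) : ℂ) := by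
      rw [← integral_complex_ofReal]
      refine integral_congr_ae ?_
      filter_upwards [(memLp_continuous (ContinuousMap.const I 1)).coeFn_toLp] with t ht
      rw [ht]
      simp
    rw [e2, test_coordFun, test_integral hφ hc hs 0]
    simp
  · refine ⟨0, fun φ hφ hc hs => ?_⟩
    have h := IsWeakDeriv.zero (p + 1 + 1) φ hφ hc hs
    rw [← h, test_coordFun, test_integral hφ hc hs (p + 1), test_integral_deriv hφ hc hs p]
    simp

theorem partialCoeff_of_const {a : C(Strip, ℂ)} {u : C(I, ℂ)} (h : ∀ z, a z = u z.2) (k : ℤ) :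
    partialCoeff a k = if k = 0 then u else 0 := by
  ext ψ
  have h1 : (⇑(slice a ψ) : Circ → ℂ) = fun _ => u ψ := funext fun x => h (x, ψ)
  change fourierCoeff (⇑(slice a ψ)) k = _
  rw [h1, fourierCoeff_const]
  split_ifs <;> rfl

/-- The constant function `1` as an element of `X_σ^s`. -/
def upperWall (σ s : ℝ) : XSpace σ s :=
  ⟨ContinuousMap.const Circ 1, by
    change Memℓp (xSeq σ s (ContinuousMap.const Circ 1)) 2
    refine (memℓp_zero ?_).of_exponent_ge (zero_le)
    refine (finite_singleton (0 : ℤ)).subset fun k hk => ?_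
    by_contra h
    refine hk ?_
    have h1 : ¬ k = 0 := h
    have h2 := fourierCoeff_const 1 k
    rw [if_neg h1] at h2
    have h3 : fourierCoeff (⇑(ContinuousMap.const Circ (1 : ℂ))) k = 0 := h2
    rw [xSeq, h3, mul_zero]⟩

/-- The constant parallel flow `a(x,ψ) = ψ` as an element of `Y_σ^m`. -/
def parallelFlow (σ : ℝ) (m : ℕ) : YSpace σ m :=
  ⟨coordFun.comp ⟨Prod.snd, continuous_snd⟩, by
    have hk := partialCoeff_of_const (a := coordFun.comp ⟨Prod.snd, continuous_snd⟩)
      (u := coordFun) fun _ => rfl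
    refine ⟨fun k => ?_, ?_⟩
    · rw [hk]
      split_ifs
      · exact isSobolev_coordFun m
      · exact IsSobolev.zero m
    · refine (memℓp_zero ?_).of_exponent_ge (zero_le)
      have hfin : ({pq : ℕ × ℕ | pq.1 + pq.2 ≤ m}).Finite :=
        ((finite_Iic m).prod (finite_Iic m)).subset fun pq h =>
          ⟨le_trans (Nat.le_add_right _ _) h, le_trans (Nat.le_add_left _ _) h⟩
      have : Finite {pq : ℕ × ℕ // pq.1 + pq.2 ≤ m} := hfin
      refine ((finite_univ (α := {pq : ℕ × ℕ // pq.1 + pq.2 ≤ m})).prod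
        (finite_singleton (0 : ℤ))).subset fun i hi => ⟨mem_univ _, ?_⟩
      by_contra h
      refine hi ?_
      have h1 : ¬ i.2 = 0 := h
      rw [ySeq, hk, if_neg h1, weakDeriv_eq (IsWeakDeriv.zero _), smul_zero]⟩

/-! ### The boundary value problem -/

/-- A function on the strip as a function of `x ∈ ℝ` (with period `2π`) and `ψ ∈ [0,1]`. -/
def onPlane (a : C(Strip, ℂ)) (x ψ : ℝ) : ℂ := a ((x : Circ), toI ψ)

/-- The partial derivative `∂A/∂x`. -/
def dx (A : ℝ → ℝ → ℂ) (x ψ : ℝ) : ℂ := deriv (fun s => A s ψ) x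

/-- The partial derivative `∂A/∂ψ`. -/
def dpsi (A : ℝ → ℝ → ℂ) (x ψ : ℝ) : ℂ := deriv (fun t => A x t) ψ

/-- The quasilinear operator
`Φ(A) = -A_xx / A_ψ + 2 A_x A_xψ / A_ψ² - (1 + A_x²) A_ψψ / A_ψ³`. -/
def Phi (A : ℝ → ℝ → ℂ) (x ψ : ℝ) : ℂ :=
  -1 / dpsi A x ψ * dx (dx A) x ψ
    + 2 * dx A x ψ / dpsi A x ψ ^ 2 * dx (dpsi A) x ψ
    - (1 + dx A x ψ ^ 2) / dpsi A x ψ ^ 3 * dpsi (dpsi A) x ψ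

/-- The equation `Φ(a) = F(ψ)` on the strip, with nowhere vanishing denominators. The elements of
`Y_σ^m` with `m > 3` are of class `C²` in the open strip, so that the derivatives are classical. -/
def SolvesEquation {σ : ℝ} {m n : ℕ} (F : HSpace n) (a : YSpace σ m) : Prop :=
  ∀ x : ℝ, ∀ ψ ∈ Ioo (0 : ℝ) 1,
    dpsi (onPlane a.toFun) x ψ ≠ 0 ∧ Phi (onPlane a.toFun) x ψ = F.toFun (toI ψ)

/-- The boundary value problem `Φ(a) = F(ψ)`, `a(x,0) = f(x)`, `a(x,1) = g(x)`, for the data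
`d = (f, g, F)`. -/
def SolvesBVP {σ s : ℝ} {m n : ℕ} (d : XSpace σ s × XSpace σ s × HSpace n) (a : YSpace σ m) :
    Prop :=
  SolvesEquation d.2.2 a ∧
    (∀ x : Circ, a.toFun (x, 0) = d.1.toFun x) ∧ (∀ x : Circ, a.toFun (x, 1) = d.2.1.toFun x)

/-- The stationary flows without stagnation points, each represented by its family of flow lines
`y = a(x,ψ)` in `Y_σ^m`: the solutions of `Φ(a) = F(ψ)` for some vorticity function
`F ∈ H^{m-2}[0,1]`. -/
def stationaryFlows (σ : ℝ) (m : ℕ) : Set (YSpace σ m) :=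
  {a | ∃ F : HSpace (m - 2), SolvesEquation F a}

/-- `S` is a complex-analytic Banach submanifold of the complex Banach space `Y`, modelled on the
complex Banach space `E`: near each of its points, a biholomorphic change of coordinates of `Y`
maps `S` to a complemented closed subspace of `Y` that is isomorphic to `E`. -/
def IsAnalyticBanachSubmanifold (E : Type*) [NormedAddCommGroup E] [NormedSpace ℂ E]
    {Y : Type*} [NormedAddCommGroup Y] [NormedSpace ℂ Y] (S : Set Y) : Prop :=
  CompleteSpace E ∧ CompleteSpace Y ∧
    ∀ a ∈ S, ∃ (M : Submodule ℂ Y) (φ : OpenPartialHomeomorph Y Y),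
      M.ClosedComplemented ∧ Nonempty (M ≃L[ℂ] E) ∧ a ∈ φ.source ∧
      AnalyticOnNhd ℂ φ φ.source ∧ AnalyticOnNhd ℂ φ.symm φ.target ∧
      φ '' (S ∩ φ.source) = (M : Set Y) ∩ φ.target

end StationaryFlow

end

noncomputable section

namespace StationaryFlow

/-! The boundary value problem is solved by the analytic inverse function theorem, applied to a map
whose vorticity is not yet required to depend on `ψ` alone. The map `a ↦ (a(·,0), a(·,1), Φ(a))`
goes from `Y_σ^m` to `X_σ^{m-1/2} × X_σ^{m-1/2} × Y_σ^{m-2}`. Since `m - 2 ≥ 2`, the space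
`Y_σ^{m-2}` is closed under products (`convMem_self`, `exists_mul`), so `Φ` is a polynomial in
derivatives of `a` divided by `a_ψ³`, and it is analytic wherever multiplication by `a_ψ` is
invertible, in particular near `a = ψ`.

At `a = ψ` the derivative is `b ↦ (b(·,0), b(·,1), -b_xx - b_ψψ)` (`hasFDerivAt_flowMap`). It is an
isomorphism because the Dirichlet problem for the Laplacian on the periodic strip splits into the
equations `-u'' + k² u = h_k` on `[0,1]`, which are solved explicitly (`dirichlet_exists`) and
bounded uniformly in `k` (`dirichlet_estimate`, `dirichlet_smem`). The boundary data lose exactly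
half a derivative, as `summable_trace` shows in one direction and the power `κ^{3/2}` in the
estimate in the other.

Data with vorticity `F(ψ)` form a complemented closed subspace of the target: averaging over `x` is
a left inverse of the inclusion. Near the parallel flow the stationary flows are the preimage of
this subspace under a biholomorphism. This gives at once the unique solution, its analytic
dependence on the data and the manifold structure (`exists_solution_map`).

Functions in `Y_σ^n` are handled through their Fourier coefficients in `L²(0,1)`, with membership
expressed by `SMem`. Boundedness of operators is mostly deduced from the closed graph theorem, so
only membership has to be proved and not norm inequalities. -/

/-! ### Continuous functions and weak derivatives in `L²(0,1)` -/

/-- Lebesgue measure on `(0,1)`. -/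
abbrev μI : Measure ℝ := (volume : Measure ℝ).restrict (Ioo (0 : ℝ) 1)

instance : IsProbabilityMeasure μI := ⟨by simp [μI]⟩

theorem coe_toI {t : ℝ} (ht : t ∈ Icc (0 : ℝ) 1) : toI t = ⟨t, ht⟩ := projIcc_of_mem _ _

theorem toI_coe (t : I) : toI t = t := projIcc_val _ t

theorem continuous_toI : Continuous toI := continuous_projIcc

theorem norm_toLp_continuous_le (u : C(I, ℂ)) : ‖(memLp_continuous u).toLp‖ ≤ ‖u‖ := by
  have h := Lp.norm_le_of_ae_bound (p := 2) (μ := μI)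
    (f := (memLp_continuous u).toLp) (norm_nonneg u) (by
      filter_upwards [(memLp_continuous u).coeFn_toLp] with t ht
      rw [ht]
      exact u.norm_coe_le_norm _)
  have h1 : measureUnivNNReal μI = 1 := by simp [measureUnivNNReal]
  rwa [h1, NNReal.coe_one, Real.one_rpow, one_mul] at h

/-- The class in `L²(0,1)` of a continuous function. -/
def toL2 : C(I, ℂ) →L[ℂ] L2 :=
  LinearMap.mkContinuous
    { toFun := fun u => (memLp_continuous u).toLp
      map_add' := fun _ _ => rfl
      map_smul' := fun _ _ => rfl } 1 fun u => by
    rw [one_mul]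
    exact norm_toLp_continuous_le u

theorem coeFn_toL2 (u : C(I, ℂ)) : ⇑(toL2 u) =ᵐ[μI] fun t => u (toI t) :=
  (memLp_continuous u).coeFn_toLp

theorem isWeakDeriv_zero_iff {u : C(I, ℂ)} {v : L2} : IsWeakDeriv 0 u v ↔ v = toL2 u :=
  ⟨fun h => h.unique (isWeakDeriv_self u), fun h => h ▸ isWeakDeriv_self u⟩

theorem weakDeriv_zero (u : C(I, ℂ)) : weakDeriv 0 u = toL2 u := weakDeriv_eq (isWeakDeriv_self u)

theorem toL2_injective : Function.Injective toL2 := by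
  refine (injective_iff_map_eq_zero _).mpr fun u hu => eq_zero_of_weakDeriv_zero ?_
  rw [weakDeriv_zero, hu]

theorem memLp_mul (u : C(I, ℂ)) (v : L2) : MemLp (fun t : ℝ => u (toI t) * v t) 2 μI :=
  MemLp.of_le_mul (c := ‖u‖) (Lp.memLp v)
    ((u.continuous.comp continuous_toI).aestronglyMeasurable.mul (Lp.aestronglyMeasurable v))
    (Filter.Eventually.of_forall fun t => by
      rw [norm_mul]; exact mul_le_mul_of_nonneg_right (u.norm_coe_le_norm _) (norm_nonneg _))

/-- Multiplication of a continuous function and an element of `L²(0,1)`. -/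
def mulL2 : C(I, ℂ) →L[ℂ] L2 →L[ℂ] L2 :=
  LinearMap.mkContinuous₂
    (LinearMap.mk₂ ℂ (fun u v => (memLp_mul u v).toLp)
      (fun u u' v => by
        rw [← MemLp.toLp_add]
        exact MemLp.toLp_congr _ _ (Filter.Eventually.of_forall fun t => by
          simp [add_mul]))
      (fun c u v => by
        rw [← MemLp.toLp_const_smul]
        exact MemLp.toLp_congr _ _ (Filter.Eventually.of_forall fun t => by
          simp [mul_assoc]))
      (fun u v v' => by
        rw [← MemLp.toLp_add]
        refine MemLp.toLp_congr _ _ ?_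
        filter_upwards [Lp.coeFn_add v v'] with t ht
        change _ * (v + v') t = _
        rw [ht, Pi.add_apply, mul_add]; rfl)
      (fun c u v => by
        rw [← MemLp.toLp_const_smul]
        refine MemLp.toLp_congr _ _ ?_
        filter_upwards [Lp.coeFn_smul c v] with t ht
        simp [ht, mul_left_comm])) 1 fun u v => by
    rw [one_mul]
    refine Lp.norm_le_mul_norm_of_ae_le_mul ?_
    filter_upwards [(memLp_mul u v).coeFn_toLp] with t ht
    change ‖(memLp_mul u v).toLp _ t‖ ≤ _
    rw [ht, norm_mul]
    exact mul_le_mul_of_nonneg_right (u.norm_coe_le_norm _) (norm_nonneg _)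

theorem coeFn_mulL2 (u : C(I, ℂ)) (v : L2) : ⇑(mulL2 u v) =ᵐ[μI] fun t => u (toI t) * v t :=
  (memLp_mul u v).coeFn_toLp

theorem norm_mulL2_le (u : C(I, ℂ)) (v : L2) : ‖mulL2 u v‖ ≤ ‖u‖ * ‖v‖ := by
  refine Lp.norm_le_mul_norm_of_ae_le_mul ?_
  filter_upwards [coeFn_mulL2 u v] with t ht
  rw [ht, norm_mul]
  exact mul_le_mul_of_nonneg_right (u.norm_coe_le_norm _) (norm_nonneg _)

theorem mulL2_toL2 (u v : C(I, ℂ)) : mulL2 u (toL2 v) = toL2 (u * v) := by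
  refine Lp.ext ?_
  filter_upwards [coeFn_mulL2 u (toL2 v), coeFn_toL2 v, coeFn_toL2 (u * v)] with t h1 h2 h3
  rw [h1, h2, h3]; rfl

theorem inner_toL2 (u : C(I, ℂ)) (f : L2) :
    inner ℂ (toL2 u) f = ∫ t in Ioo (0 : ℝ) 1, f t * starRingEnd ℂ (u (toI t)) := by
  rw [L2.inner_def]
  refine integral_congr_ae ?_
  filter_upwards [coeFn_toL2 u] with t ht
  rw [ht]; rfl

/-! ### Test functions and first-order weak derivatives as a closed relation on `L²(0,1)`. -/

/-- Smooth real functions with compact support in `(0,1)`. -/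
structure IsTest (φ : ℝ → ℝ) : Prop where
  contDiff : ContDiff ℝ ∞ φ
  compact : HasCompactSupport φ
  support : tsupport φ ⊆ Ioo 0 1

theorem IsTest.deriv {φ : ℝ → ℝ} (h : IsTest φ) : IsTest (deriv φ) :=
  ⟨(contDiff_infty_iff_deriv.mp h.contDiff).2, h.compact.deriv,
    tsupport_deriv_subset.trans h.support⟩

theorem IsTest.eq_zero {φ : ℝ → ℝ} (h : IsTest φ) {t : ℝ} (ht : t ∉ Ioo (0 : ℝ) 1) : φ t = 0 :=
  image_eq_zero_of_notMem_tsupport fun h' => ht (h.support h')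

theorem IsTest.hasDerivAt {φ : ℝ → ℝ} (h : IsTest φ) (t : ℝ) : HasDerivAt φ (_root_.deriv φ t) t :=
  (h.contDiff.differentiable (by simp) t).hasDerivAt

/-- The restriction to `[0,1]` of a continuous real function. -/
def restr (φ : ℝ → ℝ) (h : Continuous φ) : C(I, ℂ) := ⟨fun t => (φ t : ℂ), by fun_prop⟩

theorem inner_restr {φ : ℝ → ℝ} (h : Continuous φ) (f : L2) :
    inner ℂ (toL2 (restr φ h)) f = ∫ t in Ioo (0 : ℝ) 1, φ t • f t := by
  rw [inner_toL2]
  refine setIntegral_congr_fun measurableSet_Ioo fun t ht => ?_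
  have : toI t = ⟨t, Ioo_subset_Icc_self ht⟩ := coe_toI _
  change f t * starRingEnd ℂ (restr φ h (toI t)) = φ t • f t
  rw [this]
  change f t * starRingEnd ℂ (φ t : ℂ) = _
  rw [Complex.conj_ofReal, Complex.real_smul, mul_comm]

theorem eq_zero_of_test {w : L2}
    (h : ∀ φ, IsTest φ → ∫ t in Ioo (0 : ℝ) 1, φ t • w t = 0) : w = 0 := by
  refine IsWeakDeriv.eq_zero (p := 0) fun φ h1 h2 h3 => ?_
  rw [h φ ⟨h1, h2, h3⟩]; simp

/-- Test functions are continuous, so a vector orthogonal to all continuous functions vanishes by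
the fundamental lemma of the calculus of variations. -/
theorem denseRange_toL2 : DenseRange toL2 := by
  have h : (LinearMap.range (toL2 : C(I, ℂ) →ₗ[ℂ] L2))ᗮ = ⊥ := by
    refine (Submodule.eq_bot_iff _).mpr fun w hw => eq_zero_of_test fun φ hφ => ?_
    rw [← inner_restr hφ.contDiff.continuous]
    exact (Submodule.mem_orthogonal _ _).mp hw _ ⟨_, rfl⟩
  have h2 := Submodule.topologicalClosure_eq_top_iff.mpr h
  exact Submodule.dense_iff_topologicalClosure_eq_top.mpr h2

/-- `g` is the weak derivative of `f` on `(0,1)`. -/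
def WD (f g : L2) : Prop :=
  ∀ φ, IsTest φ → ∫ t in Ioo (0 : ℝ) 1, deriv φ t • f t = -∫ t in Ioo (0 : ℝ) 1, φ t • g t

/-- Test functions are real, so the conjugation in the inner product is harmless. Written with inner
products, the relation is visibly linear and closed. -/
theorem wd_iff {f g : L2} : WD f g ↔ ∀ φ (h : IsTest φ),
    inner ℂ (toL2 (restr _ h.deriv.contDiff.continuous)) f +
      inner ℂ (toL2 (restr φ h.contDiff.continuous)) g = 0 := by
  refine forall_congr' fun φ => forall_congr' fun h => ?_
  rw [inner_restr, inner_restr, ← eq_neg_iff_add_eq_zero]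

/-- Closedness is what later yields completeness of the Sobolev spaces, termwise differentiation of
series, and the product rule by density. -/
theorem isClosed_wd : IsClosed {p : L2 × L2 | WD p.1 p.2} := by
  simp only [wd_iff, ofPred_forall]
  refine isClosed_iInter fun φ => isClosed_iInter fun h => isClosed_eq ?_ continuous_const
  fun_prop

theorem WD.add {f g f' g' : L2} (h : WD f g) (h' : WD f' g') : WD (f + f') (g + g') := by
  rw [wd_iff] at *
  intro φ hφ
  rw [inner_add_right, inner_add_right, add_add_add_comm, h φ hφ, h' φ hφ, add_zero]

theorem WD.smul {f g : L2} (c : ℂ) (h : WD f g) : WD (c • f) (c • g) := by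
  rw [wd_iff] at *
  intro φ hφ
  rw [inner_smul_right, inner_smul_right, ← mul_add, h φ hφ, mul_zero]

theorem WD.zero : WD 0 0 := wd_iff.mpr fun φ hφ => by rw [inner_zero_right, inner_zero_right, add_zero]

theorem WD.neg {f g : L2} (h : WD f g) : WD (-f) (-g) := by
  simpa using h.smul (-1)

theorem WD.sub {f g f' g' : L2} (h : WD f g) (h' : WD f' g') : WD (f - f') (g - g') := by
  simpa [sub_eq_add_neg] using h.add h'.neg

theorem WD.unique {f g g' : L2} (h : WD f g) (h' : WD f g') : g = g' := by
  refine sub_eq_zero.mp (eq_zero_of_test fun φ hφ => ?_)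
  have h0 := wd_iff.mp (h.sub h') φ hφ
  rwa [sub_self, inner_zero_right, zero_add, inner_restr] at h0

theorem WD.tsum {ι : Type*} {f g : ι → L2} (h : ∀ i, WD (f i) (g i)) (hf : Summable f)
    (hg : Summable g) : WD (∑' i, f i) (∑' i, g i) := by
  have h1 := (hf.hasSum.prodMk hg.hasSum)
  refine isClosed_wd.mem_of_tendsto h1 (Filter.Eventually.of_forall fun s => ?_)
  classical
  induction s using Finset.induction_on with
  | empty => exact WD.zero
  | insert i s hi ih =>
    rw [Finset.sum_insert hi]
    exact (h i).add ih

/-- Testing with `φ'` instead of `φ` peels off one order. Higher weak derivatives thus become chains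
of first-order relations `WD`, the only form used below. -/
theorem isWeakDeriv_succ {p : ℕ} {u : C(I, ℂ)} {v w : L2} (h : IsWeakDeriv p u v) :
    IsWeakDeriv (p + 1) u w ↔ WD v w := by
  have key : ∀ φ, IsTest φ → ∫ t in Ioo (0 : ℝ) 1, iteratedDeriv (p + 1) φ t • u (toI t) =
      (-1) ^ p * ∫ t in Ioo (0 : ℝ) 1, deriv φ t • v t := fun φ hφ => by
    rw [iteratedDeriv_succ']
    exact h _ hφ.deriv.contDiff hφ.deriv.compact hφ.deriv.support
  have h1 : ((-1 : ℂ) ^ p) ≠ 0 := pow_ne_zero _ (by norm_num)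
  constructor
  · intro hw φ hφ
    have := (key φ hφ).symm.trans (hw φ hφ.contDiff hφ.compact hφ.support)
    rw [pow_succ, mul_assoc] at this
    rw [mul_left_cancel₀ h1 this, neg_one_mul]
  · intro hw φ a b c
    rw [key φ ⟨a, b, c⟩, hw φ ⟨a, b, c⟩, pow_succ, mul_assoc, neg_one_mul]

/-! ### Primitives -/

theorem norm_sq_L2 (g : L2) : ‖g‖ ^ 2 = ∫ t in Ioo (0 : ℝ) 1, ‖g t‖ ^ 2 := by
  have h : ((‖g‖ ^ 2 : ℝ) : ℂ) = ((∫ t in Ioo (0 : ℝ) 1, ‖g t‖ ^ 2 : ℝ) : ℂ) := by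
    have h1 := inner_self_eq_norm_sq_to_K (𝕜 := ℂ) g
    rw [L2.inner_def] at h1
    rw [← integral_complex_ofReal]
    push_cast
    refine h1.symm.trans (integral_congr_ae (Filter.Eventually.of_forall fun t => ?_))
    exact inner_self_eq_norm_sq_to_K (𝕜 := ℂ) (g t)
  exact_mod_cast h

theorem integrable_norm_sq_L2 (g : L2) : IntegrableOn (fun t => ‖g t‖ ^ 2) (Ioo (0 : ℝ) 1) :=
  (Lp.memLp g).integrable_norm_pow (by norm_num)

theorem uIoc_subset {a b : ℝ} (ha : a ∈ Icc (0 : ℝ) 1) (hb : b ∈ Icc (0 : ℝ) 1) :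
    uIoc a b ⊆ Ioc 0 1 := fun _ hx =>
  ⟨lt_of_le_of_lt (le_min ha.1 hb.1) hx.1, hx.2.trans (max_le ha.2 hb.2)⟩

theorem intervalIntegrable_L2 (g : L2) {a b : ℝ} (ha : a ∈ Icc (0 : ℝ) 1)
    (hb : b ∈ Icc (0 : ℝ) 1) : IntervalIntegrable g volume a b := by
  rw [intervalIntegrable_iff]
  refine IntegrableOn.mono_set ?_ (uIoc_subset ha hb)
  exact (integrableOn_Ioc_iff_integrableOn_Ioo (f := g) (by simp)).mpr (integrable_L2 g)

theorem intervalIntegral_congr_L2 {f g : ℝ → ℂ} (h : f =ᵐ[μI] g) {a b : ℝ}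
    (ha : a ∈ Icc (0 : ℝ) 1) (hb : b ∈ Icc (0 : ℝ) 1) :
    ∫ t in a..b, f t = ∫ t in a..b, g t := by
  refine intervalIntegral.integral_congr_ae ?_
  have h1 := (ae_restrict_iff' measurableSet_Ioo).mp h
  have h2 : ∀ᵐ x ∂(volume : Measure ℝ), x ≠ 1 := by
    simp [ae_iff, measure_singleton]
  filter_upwards [h1, h2] with x hx hx1 hxm
  have := uIoc_subset ha hb hxm
  exact hx ⟨this.1, lt_of_le_of_ne this.2 hx1⟩

/-- Cauchy–Schwarz against the constant function `1` on `(a,b)`. -/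
theorem integral_norm_le {g : L2} {a b : ℝ} (ha : a ∈ Icc (0 : ℝ) 1) (hb : b ∈ Icc (0 : ℝ) 1)
    (hab : a ≤ b) : ∫ t in a..b, ‖g t‖ ≤ Real.sqrt (b - a) * ‖g‖ := by
  have hsub : Ioo a b ⊆ Ioo 0 1 := Ioo_subset_Ioo ha.1 hb.2
  have hm : MemLp g 2 (volume.restrict (Ioo a b)) :=
    (Lp.memLp g).mono_measure (Measure.restrict_mono hsub le_rfl)
  have h := integral_mul_le_Lp_mul_Lq_of_nonneg (μ := volume.restrict (Ioo a b))
    (p := 2) (q := 2) (f := fun _ => (1 : ℝ)) (g := fun t => ‖g t‖) Real.HolderConjugate.two_two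
    (Filter.Eventually.of_forall fun _ => zero_le_one)
    (Filter.Eventually.of_forall fun _ => norm_nonneg _) (memLp_const 1)
    (by simpa using hm.norm)
  rw [intervalIntegral.integral_of_le hab, integral_Ioc_eq_integral_Ioo]
  simp only [one_mul] at h
  refine h.trans ?_
  have e1 : (∫ _ in Ioo a b, (1 : ℝ) ^ (2 : ℝ)) = b - a := by
    simp [hab]
  rw [e1, ← Real.sqrt_eq_rpow, ← Real.sqrt_eq_rpow]
  refine mul_le_mul_of_nonneg_left ?_ (Real.sqrt_nonneg _)
  rw [Real.sqrt_le_left (norm_nonneg _), norm_sq_L2]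
  simp only [Real.rpow_ofNat]
  exact setIntegral_mono_set (integrable_norm_sq_L2 g)
    (Filter.Eventually.of_forall fun _ => by positivity) hsub.eventuallyLE

theorem norm_integral_le {g : L2} {a b : ℝ} (ha : a ∈ Icc (0 : ℝ) 1) (hb : b ∈ Icc (0 : ℝ) 1) :
    ‖∫ t in a..b, g t‖ ≤ Real.sqrt |b - a| * ‖g‖ := by
  rcases le_total a b with h | h
  · rw [abs_of_nonneg (sub_nonneg.mpr h)]
    exact (intervalIntegral.norm_integral_le_integral_norm h).trans (integral_norm_le ha hb h)
  · rw [intervalIntegral.integral_symm, norm_neg, abs_sub_comm, abs_of_nonneg (sub_nonneg.mpr h)]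
    exact (intervalIntegral.norm_integral_le_integral_norm h).trans (integral_norm_le hb ha h)

theorem zero_mem_I : (0 : ℝ) ∈ Icc (0 : ℝ) 1 := ⟨le_rfl, zero_le_one⟩

theorem one_mem_I : (1 : ℝ) ∈ Icc (0 : ℝ) 1 := ⟨zero_le_one, le_rfl⟩

/-- The primitive `t ↦ ∫₀ᵗ g` of `g ∈ L²(0,1)`. -/
def prim : L2 →L[ℂ] C(I, ℂ) :=
  LinearMap.mkContinuous
    { toFun := fun g => ⟨fun t => ∫ s in (0 : ℝ)..t, g s, by
        have h := intervalIntegral.continuousOn_primitive_interval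
          (μ := volume) (f := g) (a := 0) (b := 1) (by
            rw [uIcc_of_le zero_le_one]
            exact (integrableOn_Icc_iff_integrableOn_Ioo (f := g) (by simp) (by simp)).mpr (integrable_L2 g))
        rw [uIcc_of_le zero_le_one] at h
        exact continuousOn_iff_continuous_domRestrict.mp h⟩
      map_add' := fun f g => by
        ext t
        change ∫ s in (0 : ℝ)..t, (f + g) s = (∫ s in (0 : ℝ)..t, f s) + ∫ s in (0 : ℝ)..t, g s
        rw [intervalIntegral_congr_L2 (Lp.coeFn_add f g) zero_mem_I t.2]
        exact intervalIntegral.integral_add (intervalIntegrable_L2 f zero_mem_I t.2)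
          (intervalIntegrable_L2 g zero_mem_I t.2)
      map_smul' := fun c g => by
        ext t
        change ∫ s in (0 : ℝ)..t, (c • g) s = c • (∫ s in (0 : ℝ)..t, g s)
        rw [intervalIntegral_congr_L2 (Lp.coeFn_smul c g) zero_mem_I t.2]
        exact intervalIntegral.integral_smul c _ } 1 fun g => by
    rw [one_mul]
    refine (ContinuousMap.norm_le _ (norm_nonneg _)).mpr fun t => ?_
    refine (norm_integral_le zero_mem_I t.2).trans (mul_le_of_le_one_left (norm_nonneg _) ?_)
    rw [sub_zero, abs_of_nonneg t.2.1]
    exact Real.sqrt_le_one.mpr t.2.2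

theorem prim_apply (g : L2) (t : I) : prim g t = ∫ s in (0 : ℝ)..t, g s := rfl

/-- The absolutely continuous function `t ↦ c + ∫₀ᵗ g`. -/
def ac (c : ℂ) (g : L2) : C(I, ℂ) := c • (1 : C(I, ℂ)) + prim g

theorem ac_apply (c : ℂ) (g : L2) (t : I) : ac c g t = c + ∫ s in (0 : ℝ)..t, g s := by
  simp [ac, prim_apply]

theorem ac_sub (c : ℂ) (g : L2) (s t : I) : ac c g t - ac c g s = ∫ r in (s : ℝ)..t, g r := by
  rw [ac_apply, ac_apply, add_sub_add_left_eq_sub]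
  exact intervalIntegral.integral_interval_sub_left (intervalIntegrable_L2 g zero_mem_I t.2)
    (intervalIntegrable_L2 g zero_mem_I s.2)

theorem ac_toL2 (c : ℂ) (U : C(I, ℂ)) (t : I) :
    ac c (toL2 U) t = c + ∫ s in (0 : ℝ)..t, U (toI s) := by
  rw [ac_apply, intervalIntegral_congr_L2 (coeFn_toL2 U) zero_mem_I t.2]

theorem hasDerivAt_primitive (c : ℂ) (U : C(I, ℂ)) (t : ℝ) :
    HasDerivAt (fun t : ℝ => c + ∫ s in (0 : ℝ)..t, U (toI s)) (U (toI t)) t :=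
  ((U.continuous.comp continuous_toI).integral_hasStrictDerivAt 0 t).hasDerivAt.const_add c

theorem integral_deriv_smul {w w' : ℝ → ℂ} (hw : ∀ t, HasDerivAt w (w' t) t) (hw' : Continuous w')
    {φ : ℝ → ℝ} (hφ : IsTest φ) :
    ∫ t in Ioo (0 : ℝ) 1, deriv φ t • w t = -∫ t in Ioo (0 : ℝ) 1, φ t • w' t := by
  have h0 : φ 0 = 0 := hφ.eq_zero (by simp)
  have h1 : φ 1 = 0 := hφ.eq_zero (by simp)
  have hwc : Continuous w := continuous_iff_continuousAt.mpr fun t => (hw t).continuousAt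
  have hd : ∀ t, HasDerivAt (fun t => φ t • w t) (φ t • w' t + deriv φ t • w t) t := fun t =>
    (hφ.hasDerivAt t).smul (hw t)
  have hc1 : Continuous fun t => φ t • w' t := hφ.contDiff.continuous.smul hw'
  have hc2 : Continuous fun t => deriv φ t • w t := hφ.deriv.contDiff.continuous.smul hwc
  have h := intervalIntegral.integral_eq_sub_of_hasDerivAt (a := 0) (b := 1) (fun t _ => hd t)
    ((hc1.add hc2).intervalIntegrable 0 1)
  rw [intervalIntegral.integral_add (hc1.intervalIntegrable 0 1) (hc2.intervalIntegrable 0 1),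
    h0, h1, zero_smul, zero_smul, sub_zero] at h
  rw [← integral_Ioc_eq_integral_Ioo, ← integral_Ioc_eq_integral_Ioo,
    ← intervalIntegral.integral_of_le zero_le_one, ← intervalIntegral.integral_of_le zero_le_one]
  exact eq_neg_of_add_eq_zero_right h

theorem wd_of_hasDerivAt {u v : C(I, ℂ)} {w w' : ℝ → ℂ} (hw : ∀ t, HasDerivAt w (w' t) t)
    (hw' : Continuous w') (hu : ∀ t : I, u t = w t) (hv : ∀ t : I, v t = w' t) :
    WD (toL2 u) (toL2 v) := by
  intro φ hφ
  have key : ∀ (x : C(I, ℂ)) (y : ℝ → ℂ) (χ : ℝ → ℝ), (∀ t : I, x t = y t) →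
      ∫ t in Ioo (0 : ℝ) 1, χ t • toL2 x t = ∫ t in Ioo (0 : ℝ) 1, χ t • y t := fun x y χ h => by
    refine integral_congr_ae ?_
    filter_upwards [coeFn_toL2 x, ae_restrict_mem measurableSet_Ioo] with t h1 ht
    rw [h1, h, coe_toI (Ioo_subset_Icc_self ht)]
  rw [key u w _ hu, key v w' _ hv, integral_deriv_smul hw hw' hφ]

/-- Both members of the pair depend continuously on `(g, h)` and `WD` is closed. By density `g` and
`h` may be taken continuous, where this is the classical product rule. -/
theorem wd_mul (c d : ℂ) (g h : L2) :
    WD (toL2 (ac c g * ac d h)) (mulL2 (ac c g) h + mulL2 (ac d h) g) := by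
  refine denseRange_toL2.induction_on₂
    (p := fun g h => WD (toL2 (ac c g * ac d h)) (mulL2 (ac c g) h + mulL2 (ac d h) g))
    ?_ (fun U V => ?_) g h
  · have hc : Continuous fun q : L2 × L2 => (toL2 (ac c q.1 * ac d q.2),
        mulL2 (ac c q.1) q.2 + mulL2 (ac d q.2) q.1) := by
      unfold ac
      fun_prop
    exact isClosed_wd.preimage hc
  · rw [mulL2_toL2, mulL2_toL2, ← map_add]
    refine wd_of_hasDerivAt
      (w := fun t => (c + ∫ s in (0 : ℝ)..t, U (toI s)) * (d + ∫ s in (0 : ℝ)..t, V (toI s)))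
      (fun t => (hasDerivAt_primitive c U t).mul (hasDerivAt_primitive d V t)) ?_ ?_ ?_
    · have h1 : Continuous fun t : ℝ => c + ∫ s in (0 : ℝ)..t, U (toI s) :=
        continuous_iff_continuousAt.mpr fun t => (hasDerivAt_primitive c U t).continuousAt
      have h2 : Continuous fun t : ℝ => d + ∫ s in (0 : ℝ)..t, V (toI s) :=
        continuous_iff_continuousAt.mpr fun t => (hasDerivAt_primitive d V t).continuousAt
      have h3 := U.continuous.comp continuous_toI
      have h4 := V.continuous.comp continuous_toI
      exact (h3.mul h2).add (h1.mul h4)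
    · intro t
      rw [ContinuousMap.mul_apply, ac_toL2, ac_toL2]
    · intro t
      simp only [ContinuousMap.add_apply, ContinuousMap.mul_apply, ac_toL2, toI_coe]
      ring

theorem mulL2_one (g : L2) : mulL2 1 g = g := by
  refine Lp.ext ?_
  filter_upwards [coeFn_mulL2 1 g] with t h1
  rw [h1]; simp

theorem wd_ac (c : ℂ) (g : L2) : WD (toL2 (ac c g)) g := by
  have h := wd_mul c 1 g 0
  have h1 : ac 1 0 = 1 := by ext t; simp [ac]
  rwa [h1, mul_one, mulL2_one, map_zero, zero_add] at h

/-! ### The fundamental theorem for weak derivatives -/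

/-- The support of `χ` keeps a distance `δ` from both endpoints. The primitive vanishes to the left
of it trivially, and to the right of it because the mean of `χ` is zero. -/
theorem IsTest.primitive {χ : ℝ → ℝ} (h : IsTest χ) (h0 : ∫ t in (0 : ℝ)..1, χ t = 0) :
    IsTest (fun t => ∫ s in (0 : ℝ)..t, χ s) := by
  have hc := h.contDiff.continuous
  have hd : ∀ t, HasDerivAt (fun t => ∫ s in (0 : ℝ)..t, χ s) (χ t) t := fun t =>
    (hc.integral_hasStrictDerivAt 0 t).hasDerivAt
  have hder : _root_.deriv (fun t => ∫ s in (0 : ℝ)..t, χ s) = χ := funext fun t => (hd t).deriv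
  obtain ⟨δ, hδ, hs⟩ := IsCompact.exists_cthickening_subset_open h.compact isOpen_Ioo h.support
  have hz : ∀ t ∉ Icc δ (1 - δ), χ t = 0 := fun t ht => by
    refine image_eq_zero_of_notMem_tsupport fun hm => ht ?_
    have h1 : t - δ ∈ Ioo (0 : ℝ) 1 := hs (Metric.mem_cthickening_of_dist_le _ t δ _ hm (by
      rw [Real.dist_eq]; simp [abs_of_pos hδ]))
    have h2 : t + δ ∈ Ioo (0 : ℝ) 1 := hs (Metric.mem_cthickening_of_dist_le _ t δ _ hm (by
      rw [Real.dist_eq]; simp [abs_of_pos hδ]))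
    exact ⟨by linarith [h1.1], by linarith [h2.2]⟩
  have hsupp : Function.support (fun t => ∫ s in (0 : ℝ)..t, χ s) ⊆ Icc δ (1 - δ) := by
    intro t ht
    by_contra hcon
    refine ht ?_
    rw [mem_Icc, not_and_or, not_le, not_le] at hcon
    rcases hcon with hlt | hgt
    · refine (intervalIntegral.integral_congr (g := fun _ => 0) fun s hs => hz s fun hm => ?_).trans
        (by simp)
      have h3 : s < δ := lt_of_le_of_lt hs.2 (max_lt hδ hlt)
      exact absurd hm.1 (not_le.mpr h3)
    · have h1 := intervalIntegral.integral_add_adjacent_intervals (μ := volume) (a := 0) (b := 1) (c := t)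
        (hc.intervalIntegrable 0 1) (hc.intervalIntegrable 1 t)
      change ∫ s in (0 : ℝ)..t, χ s = 0
      rw [← h1, h0, zero_add]
      refine (intervalIntegral.integral_congr (g := fun _ => 0) fun s hs => hz s fun hm => ?_).trans
        (by simp)
      have h3 : 1 - δ < s := lt_of_lt_of_le (lt_min (by linarith) hgt) hs.1
      exact absurd hm.2 (not_le.mpr h3)
  have hts : tsupport (fun t => ∫ s in (0 : ℝ)..t, χ s) ⊆ Icc δ (1 - δ) :=
    closure_minimal hsupp isClosed_Icc
  refine ⟨?_, ?_, fun t ht => ?_⟩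
  · rw [contDiff_infty_iff_deriv, hder]
    exact ⟨fun t => (hd t).differentiableAt, h.contDiff⟩
  · exact IsCompact.of_isClosed_subset isCompact_Icc (isClosed_tsupport _) hts
  · have := hts ht
    exact ⟨by linarith [this.1], by linarith [this.2]⟩

theorem exists_isTest : ∃ χ : ℝ → ℝ, IsTest χ ∧ ∫ t in (0 : ℝ)..1, χ t = 1 := by
  let f : ContDiffBump (1 / 2 : ℝ) := ⟨1 / 8, 1 / 4, by norm_num, by norm_num⟩
  have hs : tsupport (f.normed volume) ⊆ Ioo 0 1 := by
    rw [f.tsupport_normed_eq]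
    intro t ht
    rw [Metric.mem_closedBall, Real.dist_eq] at ht
    have ht' : |t - 1 / 2| ≤ 1 / 4 := ht
    rw [abs_le] at ht'
    exact ⟨by linarith [ht'.1], by linarith [ht'.2]⟩
  have ht : IsTest (f.normed volume) := ⟨f.contDiff_normed, f.hasCompactSupport_normed, hs⟩
  refine ⟨_, ht, ?_⟩
  rw [intervalIntegral.integral_of_le zero_le_one, integral_Ioc_eq_integral_Ioo,
    setIntegral_eq_integral_of_forall_compl_eq_zero fun t h => ht.eq_zero h]
  exact f.integral_normed (μ := volume)

theorem IsTest.combine {φ χ : ℝ → ℝ} (hφ : IsTest φ) (hχ : IsTest χ) (m : ℝ) :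
    IsTest (fun t => φ t - m * χ t) := by
  have h : tsupport (fun t => φ t - m * χ t) ⊆ tsupport φ ∪ tsupport χ := by
    refine closure_minimal (fun t ht => ?_) ((isClosed_tsupport _).union (isClosed_tsupport _))
    by_contra hcon
    rw [mem_union, not_or] at hcon
    refine ht ?_
    change φ t - m * χ t = 0
    rw [image_eq_zero_of_notMem_tsupport hcon.1, image_eq_zero_of_notMem_tsupport hcon.2]
    ring
  exact ⟨hφ.contDiff.sub (contDiff_const.mul hχ.contDiff),
    IsCompact.of_isClosed_subset (IsCompact.union hφ.compact hχ.compact) (isClosed_tsupport _) h,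
    h.trans (union_subset hφ.support hχ.support)⟩

/-- Du Bois-Reymond: subtracting from `φ` the multiple of a fixed bump `χ` with the same mean leaves
the derivative of a test function, against which `f` integrates to zero. Hence `f` acts on `φ` as
the constant `c = ∫ χ f`. -/
theorem eq_const_of_wd_zero {f : L2} (h : WD f 0) : ∃ c : ℂ, f = toL2 (c • 1) := by
  obtain ⟨χ, hχ, hχ1⟩ := exists_isTest
  set c : ℂ := ∫ t in Ioo (0 : ℝ) 1, χ t • f t with hc
  refine ⟨c, sub_eq_zero.mp (eq_zero_of_test fun φ hφ => ?_)⟩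
  set m : ℝ := ∫ t in (0 : ℝ)..1, φ t with hm
  have hint : ∀ {φ : ℝ → ℝ}, IsTest φ → IntegrableOn (fun t => φ t • f t) (Ioo 0 1) := fun h =>
    integrable_test_smul_L2 h.contDiff.continuous h.compact f
  have hp := (hφ.combine hχ m).primitive (by
    rw [intervalIntegral.integral_sub (hφ.contDiff.continuous.intervalIntegrable _ _)
      ((hχ.contDiff.continuous.const_mul m).intervalIntegrable _ _),
      intervalIntegral.integral_const_mul, hχ1, mul_one, sub_self])
  have hder : deriv (fun t => ∫ s in (0 : ℝ)..t, (φ s - m * χ s)) = fun t => φ t - m * χ t :=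
    funext fun t =>
      ((hφ.combine hχ m).contDiff.continuous.integral_hasStrictDerivAt 0 t).hasDerivAt.deriv
  have h1 := wd_iff.mp h _ hp
  rw [inner_zero_right, add_zero, inner_restr, hder] at h1
  have h2 : ∫ t in Ioo (0 : ℝ) 1, (φ t - m * χ t) • f t =
      (∫ t in Ioo (0 : ℝ) 1, φ t • f t) - m • c := by
    rw [hc, ← integral_smul]
    refine Eq.trans ?_ (integral_sub (hint hφ) ((hint hχ).smul m))
    simp only [sub_smul, mul_smul]
  have h3 : ∫ t in Ioo (0 : ℝ) 1, φ t • (f - toL2 (c • 1)) t =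
      (∫ t in Ioo (0 : ℝ) 1, φ t • f t) - m • c := by
    have e1 : ∫ t in Ioo (0 : ℝ) 1, φ t • (f - toL2 (c • 1)) t =
        ∫ t in Ioo (0 : ℝ) 1, (φ t • f t - φ t • c) := by
      refine integral_congr_ae ?_
      filter_upwards [Lp.coeFn_sub f (toL2 (c • 1)), coeFn_toL2 (c • 1)] with t h1 h2
      rw [h1, Pi.sub_apply, h2, smul_sub]
      simp
    rw [e1, integral_sub (hint hφ), integral_smul_const, hm,
      intervalIntegral.integral_of_le zero_le_one, integral_Ioc_eq_integral_Ioo]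
    exact Integrable.smul_const (hφ.contDiff.continuous.integrableOn_Icc.mono_set
      Ioo_subset_Icc_self) c
  rw [h3, ← h2, h1]

theorem WD.exists_ac {f g : L2} (h : WD f g) : ∃ c : ℂ, f = toL2 (ac c g) := by
  have h1 := h.sub (wd_ac 0 g)
  rw [sub_self] at h1
  obtain ⟨c, hc⟩ := eq_const_of_wd_zero h1
  refine ⟨c, ?_⟩
  rw [sub_eq_iff_eq_add] at hc
  rw [hc, ← map_add]
  simp [ac]

theorem WD.eq_ac {u : C(I, ℂ)} {g : L2} (h : WD (toL2 u) g) : u = ac (u 0) g := by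
  obtain ⟨c, hc⟩ := h.exists_ac
  have hu := toL2_injective hc
  have h0 : u 0 = c := by
    rw [hu, ac_apply]
    simp
  rw [h0]; exact hu

/-- Average `‖u t‖ ≤ ‖u s‖ + √δ ‖g‖` over `s` in an interval of length `δ` containing `t`. The free
scale `δ` matters: choosing it of size `1/|k|` for the `k`-th Fourier mode produces the half
derivative in the trace theorem and in the Dirichlet estimate. -/
theorem WD.norm_apply_le {u : C(I, ℂ)} {g : L2} (h : WD (toL2 u) g) (t : I) {δ : ℝ} (hδ : 0 < δ)
    (hδ1 : δ ≤ 1) : ‖u t‖ ≤ (Real.sqrt δ)⁻¹ * ‖toL2 u‖ + Real.sqrt δ * ‖g‖ := by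
  -- The interval `[α, α+δ]` starts at `t`, unless this would leave `[0,1]`; then it is the last
  -- one, `[1-δ, 1]`.
  obtain ⟨α, hα, hα1, hαt, htα⟩ : ∃ α : ℝ, 0 ≤ α ∧ α + δ ≤ 1 ∧ α ≤ t ∧ t ≤ α + δ := by
    rcases le_total (t : ℝ) (1 - δ) with h1 | h1
    · exact ⟨t, t.2.1, by linarith, le_rfl, by linarith⟩
    · exact ⟨1 - δ, by linarith, by linarith, h1, by linarith [t.2.2]⟩
  have ha : α ∈ Icc (0 : ℝ) 1 := ⟨hα, by linarith⟩
  have hb : α + δ ∈ Icc (0 : ℝ) 1 := ⟨by linarith, hα1⟩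
  have hpt : ∀ s ∈ Icc α (α + δ), ‖u t‖ ≤ ‖u (toI s)‖ + Real.sqrt δ * ‖g‖ := fun s hs => by
    have hsI : s ∈ Icc (0 : ℝ) 1 := ⟨hα.trans hs.1, hs.2.trans hα1⟩
    have e : u t - u (toI s) = ∫ r in s..t, g r := by
      rw [h.eq_ac, ac_sub, coe_toI hsI]
    have h2 : ‖u t - u (toI s)‖ ≤ Real.sqrt δ * ‖g‖ := by
      rw [e]
      refine (norm_integral_le hsI t.2).trans
        (mul_le_mul_of_nonneg_right (Real.sqrt_le_sqrt ?_) (norm_nonneg _))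
      rw [abs_le]
      exact ⟨by linarith [hs.2], by linarith [hs.1]⟩
    have h3 := norm_le_norm_add_norm_sub' (u t) (u (toI s))
    linarith
  have hc : Continuous fun s : ℝ => ‖u (toI s)‖ := (u.continuous.comp continuous_toI).norm
  have h1 := intervalIntegral.integral_mono_on (a := α) (b := α + δ)
    (g := fun s => ‖u (toI s)‖ + Real.sqrt δ * ‖g‖) (by linarith)
    (continuous_const.intervalIntegrable (μ := volume) _ _)
    ((hc.add continuous_const).intervalIntegrable (μ := volume) _ _) hpt
  have h2 : ∫ s in α..α + δ, ‖u (toI s)‖ ≤ Real.sqrt δ * ‖toL2 u‖ := by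
    have h3 := integral_norm_le (g := toL2 u) ha hb (by linarith)
    rw [add_sub_cancel_left] at h3
    refine le_trans (le_of_eq ?_) h3
    refine intervalIntegral.integral_congr_ae ?_
    have h4 := (ae_restrict_iff' measurableSet_Ioo).mp (coeFn_toL2 u)
    have h5 : ∀ᵐ x ∂(volume : Measure ℝ), x ≠ 1 := by
      simp [ae_iff, measure_singleton]
    filter_upwards [h4, h5] with x hx hx1 hxm
    have := uIoc_subset ha hb hxm
    rw [hx ⟨this.1, lt_of_le_of_ne this.2 hx1⟩]
  rw [intervalIntegral.integral_const, add_sub_cancel_left, smul_eq_mul,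
    intervalIntegral.integral_add (hc.intervalIntegrable _ _)
      (continuous_const.intervalIntegrable _ _),
    intervalIntegral.integral_const, add_sub_cancel_left, smul_eq_mul] at h1
  have hs : 0 < Real.sqrt δ := Real.sqrt_pos.mpr hδ
  have hss : Real.sqrt δ * Real.sqrt δ = δ := Real.mul_self_sqrt hδ.le
  have h6 : δ * ‖u t‖ ≤ δ * ((Real.sqrt δ)⁻¹ * ‖toL2 u‖ + Real.sqrt δ * ‖g‖) := by
    have : δ * ((Real.sqrt δ)⁻¹ * ‖toL2 u‖) = Real.sqrt δ * ‖toL2 u‖ := by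
      nth_rewrite 1 [← hss]
      field_simp
    rw [mul_add, this]
    linarith
  exact le_of_mul_le_mul_left h6 hδ

theorem WD.norm_le {u : C(I, ℂ)} {g : L2} (h : WD (toL2 u) g) : ‖u‖ ≤ ‖toL2 u‖ + ‖g‖ :=
  (ContinuousMap.norm_le _ (by positivity)).mpr fun t => by
    simpa using h.norm_apply_le t one_pos le_rfl

/-! ### Chains of weak derivatives and completeness of `H^n[0,1]` -/

theorem IsSobolev.wd {n p : ℕ} {u : C(I, ℂ)} (h : IsSobolev n u) (hp : p < n) :
    WD (weakDeriv p u) (weakDeriv (p + 1) u) :=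
  (isWeakDeriv_succ (h.isWeakDeriv hp.le)).mp (h.isWeakDeriv hp)

theorem isWeakDeriv_of_chain {n : ℕ} {u : C(I, ℂ)} {J : ℕ → L2} (h0 : J 0 = toL2 u)
    (hJ : ∀ p < n, WD (J p) (J (p + 1))) : ∀ p ≤ n, IsWeakDeriv p u (J p) := by
  intro p
  induction p with
  | zero => exact fun _ => isWeakDeriv_zero_iff.mpr h0
  | succ p ih => exact fun hp => (isWeakDeriv_succ (ih (Nat.le_of_succ_le hp))).mpr (hJ p hp)

theorem WD.exists_continuous {f g : L2} (h : WD f g) : ∃ u : C(I, ℂ), toL2 u = f := by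
  obtain ⟨c, hc⟩ := h.exists_ac
  exact ⟨_, hc.symm⟩

theorem completeSpace_of_isClosed_range {E F : Type*} [NormedAddCommGroup E] [NormedSpace ℂ E]
    [NormedAddCommGroup F] [NormedSpace ℂ F] [CompleteSpace F] (T : E →ₗ[ℂ] F)
    (hT : ∀ x, ‖T x‖ = ‖x‖) (h : IsClosed (range T)) : CompleteSpace E := by
  have hi : Isometry T := AddMonoidHomClass.isometry_of_norm T hT
  exact (completeSpace_iff_isComplete_range hi.isUniformInducing).mpr h.isComplete

/-- The jets of Sobolev functions are exactly the tuples whose consecutive entries satisfy `WD`, a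
closed condition. The first link supplies the continuous representative, hence `n ≥ 1`; for `n = 0`
continuous functions are not closed in `L²`. -/
theorem completeSpace_HSpace {n : ℕ} (hn : 1 ≤ n) : CompleteSpace (HSpace n) := by
  refine completeSpace_of_isClosed_range (HSpace.jet n) (fun _ => rfl) ?_
  have : range (HSpace.jet n) = {v | ∀ p : Fin n, WD (v p.castSucc) (v p.succ)} := by
    ext v
    constructor
    · rintro ⟨F, rfl⟩ p
      exact F.2.wd p.2
    · intro hv
      let J : ℕ → L2 := fun p => if h : p < n + 1 then v ⟨p, h⟩ else 0
      have hJ : ∀ p < n, WD (J p) (J (p + 1)) := fun p hp => by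
        have h1 : J p = v (Fin.castSucc ⟨p, hp⟩) := dif_pos (Nat.lt_succ_of_lt hp)
        have h2 : J (p + 1) = v (Fin.succ ⟨p, hp⟩) := dif_pos (Nat.succ_lt_succ hp)
        rw [h1, h2]
        exact hv ⟨p, hp⟩
      obtain ⟨u, hu⟩ := (hJ 0 hn).exists_continuous
      have hd := isWeakDeriv_of_chain hu.symm hJ
      refine ⟨⟨u, fun p hp => ⟨_, hd p hp⟩⟩, ?_⟩
      ext1 p
      change weakDeriv p u = v p
      rw [weakDeriv_eq (hd p (Nat.lt_succ_iff.mp p.2))]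
      exact dif_pos p.2
  rw [this, ofPred_forall]
  refine isClosed_iInter fun p => ?_
  exact isClosed_wd.preimage (f := fun v : PiLp 2 (fun _ : Fin (n + 1) => L2) =>
    (v p.castSucc, v p.succ)) (by fun_prop)

/-! ### Weighted sequences in `L²(0,1)` -/

/-- The weight `e^{σ|k|}`. -/
def ew (σ : ℝ) (k : ℤ) : ℝ := Real.exp (σ * |(k : ℝ)|)

theorem ew_pos (σ : ℝ) (k : ℤ) : 0 < ew σ k := Real.exp_pos _

/-- The sequences `(A_k)` in `L²(0,1)` of the partial Fourier coefficients of the elements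
of `Y_σ^n`. -/
def SMem (σ : ℝ) : ℕ → (ℤ → L2) → Prop
  | 0, A => Summable fun k => (ew σ k * ‖A k‖) ^ 2
  | n + 1, A => SMem σ n A ∧ SMem σ n (fun k => (k : ℂ) • A k) ∧
      ∃ A' : ℤ → L2, (∀ k, WD (A k) (A' k)) ∧ SMem σ n A'

theorem SMem.of_succ {σ : ℝ} {n : ℕ} {A : ℤ → L2} (h : SMem σ (n + 1) A) : SMem σ n A := h.1

theorem SMem.mono {σ : ℝ} {n m : ℕ} (hnm : n ≤ m) {A : ℤ → L2} (h : SMem σ m A) :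
    SMem σ n A := by
  induction m, hnm using Nat.le_induction with
  | base => exact h
  | succ m _ ih => exact ih h.1

theorem summable_sq_add {ι : Type*} {f g : ι → ℝ} (hf : Summable fun i => f i ^ 2)
    (hg : Summable fun i => g i ^ 2) : Summable fun i => (f i + g i) ^ 2 := by
  refine Summable.of_nonneg_of_le (fun i => sq_nonneg _) (fun i => ?_) ((hf.add hg).mul_left 2)
  nlinarith [sq_nonneg (f i - g i)]

theorem summable_sq_of_le {ι : Type*} {f g : ι → ℝ} (hf : Summable fun i => f i ^ 2) {C : ℝ}
    (h0 : ∀ i, 0 ≤ g i) (h : ∀ i, g i ≤ C * f i) : Summable fun i => g i ^ 2 := by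
  refine Summable.of_nonneg_of_le (fun i => sq_nonneg _) (fun i => ?_) (hf.mul_left (C ^ 2))
  rw [← mul_pow]
  exact pow_le_pow_left₀ (h0 i) (h i) 2

theorem SMem.add {σ : ℝ} {n : ℕ} {A B : ℤ → L2} (hA : SMem σ n A) (hB : SMem σ n B) :
    SMem σ n (A + B) := by
  induction n generalizing A B with
  | zero =>
    refine summable_sq_of_le (C := 1) (summable_sq_add hA hB)
      (fun k => mul_nonneg (ew_pos σ k).le (norm_nonneg _)) fun k => ?_
    rw [one_mul, ← mul_add]
    exact mul_le_mul_of_nonneg_left (norm_add_le _ _) (ew_pos σ k).le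
  | succ n ih =>
    obtain ⟨h1, h2, A', h3, h4⟩ := hA
    obtain ⟨g1, g2, B', g3, g4⟩ := hB
    refine ⟨ih h1 g1, ?_, A' + B', fun k => (h3 k).add (g3 k), ih h4 g4⟩
    have := ih h2 g2
    convert this using 1
    funext k
    simp [smul_add]

theorem SMem.smul {σ : ℝ} {n : ℕ} {A : ℤ → L2} (c : ℂ) (hA : SMem σ n A) :
    SMem σ n (fun k => c • A k) := by
  induction n generalizing A with
  | zero =>
    refine summable_sq_of_le (C := ‖c‖) hA
      (fun k => mul_nonneg (ew_pos σ k).le (norm_nonneg _)) fun k => ?_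
    rw [norm_smul, mul_left_comm]
  | succ n ih =>
    obtain ⟨h1, h2, A', h3, h4⟩ := hA
    refine ⟨ih h1, ?_, fun k => c • A' k, fun k => (h3 k).smul c, ih h4⟩
    convert ih h2 using 1
    funext k
    rw [smul_comm]

/-- The recursive form of `SMem` suits inductions by the Leibniz rule; the form with all `k^q D^p`
at once is the one in the norm of `Y_σ^n`. -/
theorem smem_iff_exists_jet {σ : ℝ} {n : ℕ} {A : ℤ → L2} :
    SMem σ n A ↔ ∃ J : ℕ → ℤ → L2, J 0 = A ∧ (∀ p < n, ∀ k, WD (J p k) (J (p + 1) k)) ∧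
      ∀ p q, p + q ≤ n → Summable fun k : ℤ => (|(k : ℝ)| ^ q * (ew σ k * ‖J p k‖)) ^ 2 := by
  constructor
  · induction n generalizing A with
    | zero =>
      intro h
      refine ⟨fun _ => A, rfl, fun p hp => absurd hp (Nat.not_lt_zero p), fun p q hpq => ?_⟩
      have : q = 0 := by omega
      subst this
      simp only [pow_zero, one_mul]
      exact h
    | succ n ih =>
      rintro ⟨h1, h2, A', h3, h4⟩
      obtain ⟨J1, e1, -, s1⟩ := ih h1
      obtain ⟨J2, e2, -, s2⟩ := ih h2
      obtain ⟨J3, e3, w3, s3⟩ := ih h4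
      -- Positive orders come from the jet of the derivative `A'`, shifted by one. For order zero,
      -- powers `q ≥ 1` come from the jet of `k A_k`.
      refine ⟨fun p => p.casesOn A J3, rfl, fun p hp k => ?_, fun p q hpq => ?_⟩
      · rcases p with _ | p
        · change WD (A k) (J3 0 k)
          rw [e3]; exact h3 k
        · exact w3 p (by omega) k
      · rcases p with _ | p
        · rcases q with _ | q
          · have := s1 0 0 (Nat.zero_le _)
            rwa [e1] at this
          · have := s2 0 q (by omega)
            rw [e2] at this
            refine this.congr fun k => ?_
            change _ = (|(k : ℝ)| ^ (q + 1) * (ew σ k * ‖A k‖)) ^ 2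
            simp only [norm_smul, Complex.norm_intCast]
            ring
        · exact s3 p q (by omega)
  · induction n generalizing A with
    | zero =>
      rintro ⟨J, rfl, -, s⟩
      have := s 0 0 le_rfl
      simp only [pow_zero, one_mul] at this
      exact this
    | succ n ih =>
      rintro ⟨J, rfl, w, s⟩
      refine ⟨ih ⟨J, rfl, fun p hp => w p (by omega), fun p q h => s p q (by omega)⟩,
        ih ⟨fun p k => (k : ℂ) • J p k, rfl, fun p hp k => (w p (by omega) k).smul _,
          fun p q h => ?_⟩,
        J 1, fun k => w 0 (by omega) k,
        ih ⟨fun p => J (p + 1), rfl, fun p hp => w (p + 1) (by omega),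
          fun p q h => s (p + 1) q (by omega)⟩⟩
      refine (s p (q + 1) (by omega)).congr fun k => ?_
      rw [norm_smul, Complex.norm_intCast]
      ring

theorem memℓp_two_iff {ι : Type*} {F : ι → Type*} [∀ i, NormedAddCommGroup (F i)]
    {f : ∀ i, F i} : Memℓp f 2 ↔ Summable fun i => ‖f i‖ ^ 2 := by
  rw [memℓp_gen_iff (by norm_num)]
  simp

instance finite_derivative_orders (m : ℕ) : Finite {pq : ℕ × ℕ // pq.1 + pq.2 ≤ m} :=
  (((finite_Iic m).prod (finite_Iic m)).subset fun _ h =>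
    ⟨le_trans (Nat.le_add_right _ _) h, le_trans (Nat.le_add_left _ _) h⟩ :
      ({pq : ℕ × ℕ | pq.1 + pq.2 ≤ m}).Finite)

theorem memℓp_yIndex_iff {m : ℕ} {f : YIndex m → L2} :
    Memℓp f 2 ↔ ∀ pq, Summable fun k => ‖f (pq, k)‖ ^ 2 := by
  rw [memℓp_two_iff, summable_prod_of_nonneg (fun i => sq_nonneg _)]
  exact ⟨fun h => h.1, fun h => ⟨h, Summable.of_finite⟩⟩

theorem norm_ySeq (σ : ℝ) (m : ℕ) (a : C(Strip, ℂ)) (i : YIndex m) :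
    ‖ySeq σ m a i‖ = |(i.2 : ℝ)| ^ i.1.1.2 *
      (ew σ i.2 * ‖weakDeriv i.1.1.1 (partialCoeff a i.2)‖) := by
  rw [ySeq, norm_smul, Complex.norm_real, norm_mul, norm_pow, Real.norm_eq_abs, Real.norm_eq_abs,
    Real.abs_exp, mul_assoc]
  rfl

theorem IsPartiallyAnalytic.smem {σ : ℝ} {n : ℕ} {a : C(Strip, ℂ)}
    (h : IsPartiallyAnalytic σ n a) : SMem σ n (fun k => toL2 (partialCoeff a k)) := by
  refine smem_iff_exists_jet.mpr ⟨fun p k => weakDeriv p (partialCoeff a k), ?_,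
    fun p hp k => (h.1 k).wd hp, fun p q hpq => ?_⟩
  · funext k
    exact weakDeriv_zero _
  · refine (memℓp_yIndex_iff.mp h.2 ⟨(p, q), hpq⟩).congr fun k => ?_
    rw [norm_ySeq]

theorem SMem.isPartiallyAnalytic {σ : ℝ} {n : ℕ} {a : C(Strip, ℂ)}
    (h : SMem σ n (fun k => toL2 (partialCoeff a k))) : IsPartiallyAnalytic σ n a := by
  obtain ⟨J, e, w, s⟩ := smem_iff_exists_jet.mp h
  have hd : ∀ k, ∀ p ≤ n, IsWeakDeriv p (partialCoeff a k) (J p k) := fun k =>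
    isWeakDeriv_of_chain (J := fun p => J p k) (congrFun e k) fun p hp => w p hp k
  refine ⟨fun k p hp => ⟨_, hd k p hp⟩, memℓp_yIndex_iff.mpr fun pq => ?_⟩
  refine (s pq.1.1 pq.1.2 pq.2).congr fun k => ?_
  rw [norm_ySeq, weakDeriv_eq (hd k _ (le_trans (Nat.le_add_right _ _) pq.2))]

/-! ### Fourier synthesis -/

theorem norm_fourier_apply (k : ℤ) (x : Circ) : ‖fourier k x‖ = 1 := by
  rw [fourier_apply]; exact Circle.norm_coe _

theorem norm_fourierCoeff_le (f : C(Circ, ℂ)) (k : ℤ) : ‖fourierCoeff (⇑f) k‖ ≤ ‖f‖ := by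
  refine (norm_integral_le_of_norm_le_const (C := ‖f‖)
    (Filter.Eventually.of_forall fun x => ?_)).trans (by simp)
  rw [norm_smul, norm_fourier_apply, one_mul]
  exact f.norm_coe_le_norm x

theorem norm_slice_le (a : C(Strip, ℂ)) (ψ : I) : ‖slice a ψ‖ ≤ ‖a‖ :=
  (ContinuousMap.norm_le _ (norm_nonneg _)).mpr fun x => a.norm_coe_le_norm (x, ψ)

theorem norm_partialCoeff_le (a : C(Strip, ℂ)) (k : ℤ) : ‖partialCoeff a k‖ ≤ ‖a‖ :=
  (ContinuousMap.norm_le _ (norm_nonneg _)).mpr fun ψ =>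
    (norm_fourierCoeff_le (slice a ψ) k).trans (norm_slice_le a ψ)

/-- The partial Fourier coefficient as a continuous linear map. -/
def partialCoeffL (k : ℤ) : C(Strip, ℂ) →L[ℂ] C(I, ℂ) :=
  LinearMap.mkContinuous
    { toFun := fun a => partialCoeff a k
      map_add' := fun a b => partialCoeff_add a b k
      map_smul' := fun c a => partialCoeff_smul c a k } 1 fun a => by
    rw [one_mul]; exact norm_partialCoeff_le a k

theorem partialCoeffL_apply (k : ℤ) (a : C(Strip, ℂ)) : partialCoeffL k a = partialCoeff a k := rfl

theorem eq_zero_of_partialCoeff {a : C(Strip, ℂ)} (h : ∀ k, partialCoeff a k = 0) : a = 0 := by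
  refine ContinuousMap.ext fun z => ?_
  have h3 : slice a z.2 = 0 :=
    eq_zero_of_fourierCoeff fun k => congrArg (fun u : C(I, ℂ) => u z.2) (h k)
  exact congrArg (fun u : C(Circ, ℂ) => u z.1) h3

theorem eq_of_partialCoeff {a b : C(Strip, ℂ)} (h : ∀ k, partialCoeff a k = partialCoeff b k) :
    a = b := by
  refine sub_eq_zero.mp (eq_zero_of_partialCoeff fun k => ?_)
  rw [← partialCoeffL_apply, map_sub, partialCoeffL_apply, partialCoeffL_apply, h, sub_self]

/-- The function `u(ψ) e^{ikx}`. -/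
def mode (k : ℤ) (u : C(I, ℂ)) : C(Strip, ℂ) := ⟨fun z => fourier k z.1 * u z.2, by fun_prop⟩

theorem norm_mode_le (k : ℤ) (u : C(I, ℂ)) : ‖mode k u‖ ≤ ‖u‖ := by
  refine (ContinuousMap.norm_le _ (norm_nonneg _)).mpr fun z => ?_
  change ‖fourier k z.1 * u z.2‖ ≤ _
  rw [norm_mul, norm_fourier_apply, one_mul]
  exact u.norm_coe_le_norm z.2

/-- Multiplication by `e^{ijx}` shifts frequencies by `j`; summed over `j`, this turns products on
the strip into convolutions. -/
theorem partialCoeff_mode_mul (j k : ℤ) (u : C(I, ℂ)) (b : C(Strip, ℂ)) :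
    partialCoeff (mode j u * b) k = u * partialCoeff b (k - j) := by
  ext ψ
  change ∫ x, fourier (-k) x • (fourier j x * u ψ * b (x, ψ)) ∂AddCircle.haarAddCircle =
    u ψ * ∫ x, fourier (-(k - j)) x • b (x, ψ) ∂AddCircle.haarAddCircle
  rw [← integral_const_mul]
  refine integral_congr_ae (Filter.Eventually.of_forall fun x => ?_)
  have h : (-(k - j) : ℤ) = -k + j := by ring
  simp only [h, fourier_add, smul_eq_mul]
  ring

theorem partialCoeff_mode (j k : ℤ) (u : C(I, ℂ)) :
    partialCoeff (mode j u) k = if k = j then u else 0 := by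
  have h := partialCoeff_mode_mul j k u 1
  rw [mul_one, partialCoeff_of_const (a := 1) (u := 1) (fun _ => rfl)] at h
  rw [h]
  by_cases hk : k = j
  · simp [hk]
  · simp [hk, sub_eq_zero]

theorem exists_of_summable {u : ℤ → C(I, ℂ)} (h : Summable fun k => ‖u k‖) :
    ∃ a : C(Strip, ℂ), HasSum (fun k => mode k (u k)) a ∧ ∀ k, partialCoeff a k = u k := by
  have hs : Summable fun k => mode k (u k) :=
    Summable.of_norm_bounded h fun k => norm_mode_le k (u k)
  refine ⟨_, hs.hasSum, fun k => ?_⟩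
  have h1 := (partialCoeffL k).hasSum hs.hasSum
  have h2 := hasSum_ite_eq k (u k)
  refine h1.unique ?_
  convert h2 using 1
  funext j
  rw [partialCoeffL_apply, partialCoeff_mode]
  by_cases hk : k = j
  · simp [hk]
  · simp [hk, Ne.symm hk]

theorem hasSum_mode {a : C(Strip, ℂ)} (h : Summable fun k => ‖partialCoeff a k‖) :
    HasSum (fun k => mode k (partialCoeff a k)) a := by
  obtain ⟨b, hb, he⟩ := exists_of_summable h
  rwa [eq_of_partialCoeff he] at hb

theorem summable_ew_neg {σ : ℝ} (hσ : 0 < σ) : Summable fun k : ℤ => (ew (-σ) k) ^ 2 := by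
  have h1 : Summable fun k : ℕ => (Real.exp (-(2 * σ))) ^ k :=
    summable_geometric_of_lt_one (Real.exp_pos _).le (Real.exp_lt_one_iff.mpr (by linarith))
  have h2 : ∀ k : ℤ, ew (-σ) k ^ 2 = Real.exp (-(2 * σ)) ^ k.natAbs := fun k => by
    rw [ew, ← Real.exp_nat_mul, ← Real.exp_nat_mul, Nat.cast_natAbs, Int.cast_abs]
    congr 1
    push_cast
    ring
  simp only [h2]
  refine Summable.of_nat_of_neg ?_ ?_
  · simpa using h1
  · simpa using h1

theorem summable_mul_of_sq {ι : Type*} {f g : ι → ℝ} (hf : Summable fun i => f i ^ 2)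
    (hg : Summable fun i => g i ^ 2) (hf0 : ∀ i, 0 ≤ f i) (hg0 : ∀ i, 0 ≤ g i) :
    Summable fun i => f i * g i := by
  refine Summable.of_nonneg_of_le (fun i => mul_nonneg (hf0 i) (hg0 i)) (fun i => ?_) (hf.add hg)
  nlinarith [sq_nonneg (f i - g i), sq_nonneg (f i + g i)]

/-- Cauchy–Schwarz against `e^{-σ|k|}`, which is square summable because `σ > 0`. -/
theorem summable_of_sq_ew {σ : ℝ} (hσ : 0 < σ) {f : ℤ → ℝ} (hf0 : ∀ k, 0 ≤ f k)
    (hf : Summable fun k => (ew σ k * f k) ^ 2) : Summable f := by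
  have h := summable_mul_of_sq (summable_ew_neg hσ) hf (fun k => (ew_pos _ k).le)
    (fun k => mul_nonneg (ew_pos _ k).le (hf0 k))
  refine h.congr fun k => ?_
  rw [← mul_assoc, ew, ew, ← Real.exp_add]
  simp

/-- One `ψ`-derivative in `L²` controls the sup norm of each coefficient, at the cost of one order.
-/
theorem SMem.exists_continuous {σ : ℝ} {n : ℕ} (hn : 1 ≤ n) {A : ℤ → L2} (h : SMem σ n A) :
    ∃ u : ℤ → C(I, ℂ), (∀ k, toL2 (u k) = A k) ∧ Summable fun k => (ew σ k * ‖u k‖) ^ 2 := by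
  obtain ⟨h0, -, A', h1, h2⟩ := h.mono hn
  choose u hu using fun k => (h1 k).exists_continuous
  refine ⟨u, hu, summable_sq_of_le (C := 1) (summable_sq_add h0 h2)
      (fun k => mul_nonneg (ew_pos σ k).le (norm_nonneg _)) fun k => ?_⟩
  rw [one_mul, ← mul_add]
  refine mul_le_mul_of_nonneg_left ?_ (ew_pos σ k).le
  have := h1 k
  rw [← hu k] at this ⊢
  exact this.norm_le

theorem SMem.exists_partialCoeff {σ : ℝ} (hσ : 0 < σ) {n : ℕ} (hn : 1 ≤ n) {A : ℤ → L2}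
    (h : SMem σ n A) : ∃ a : YSpace σ n, ∀ k, toL2 (partialCoeff a.toFun k) = A k := by
  obtain ⟨u, hu, hs⟩ := h.exists_continuous hn
  obtain ⟨a, -, ha⟩ := exists_of_summable (summable_of_sq_ew hσ (fun k => norm_nonneg (u k)) hs)
  have h1 : ∀ k, toL2 (partialCoeff a k) = A k := fun k => by rw [ha, hu]
  have h2 : SMem σ n (fun k => toL2 (partialCoeff a k)) := by simpa only [h1] using h
  exact ⟨⟨a, h2.isPartiallyAnalytic⟩, h1⟩

theorem YSpace.smem {σ : ℝ} {n : ℕ} (a : YSpace σ n) :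
    SMem σ n (fun k => toL2 (partialCoeff a.toFun k)) := a.2.smem

theorem YSpace.summable {σ : ℝ} (hσ : 0 < σ) {n : ℕ} (hn : 1 ≤ n) (a : YSpace σ n) :
    Summable fun k => ‖partialCoeff a.toFun k‖ := by
  obtain ⟨u, hu, hs⟩ := a.smem.exists_continuous hn
  have : u = fun k => partialCoeff a.toFun k := funext fun k => toL2_injective (hu k)
  subst this
  exact summable_of_sq_ew hσ (fun k => norm_nonneg _) hs

/-! ### Completeness of `Y_σ^n` and `X_σ^s` -/

/-- The range of `YSpace.toSeq` is cut out by closed conditions: entries with `q > 0` are `k^q`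
times those with `q = 0`, and the latter are linked by `WD`. Any family in `ℓ²` with these
properties is synthesized into a function. -/
theorem completeSpace_YSpace {σ : ℝ} (hσ : 0 < σ) {n : ℕ} (hn : 1 ≤ n) :
    CompleteSpace (YSpace σ n) := by
  refine completeSpace_of_isClosed_range (YSpace.toSeq σ n) (fun _ => rfl) ?_
  have : range (YSpace.toSeq σ n) =
      {v | ∀ (pq : {pq : ℕ × ℕ // pq.1 + pq.2 ≤ n}) (k : ℤ), v (pq, k) =
        ((k : ℂ) ^ pq.1.2) • v (⟨(pq.1.1, 0), (Nat.le_add_right _ _).trans pq.2⟩, k)} ∩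
      {v | ∀ (p : ℕ) (hp : p + 1 ≤ n) (k : ℤ), WD (v (⟨(p, 0), (Nat.le_succ p).trans hp⟩, k))
        (v (⟨(p + 1, 0), hp⟩, k))} := by
    ext v
    constructor
    · rintro ⟨a, rfl⟩
      refine ⟨fun pq k => ?_, fun p hp k => ?_⟩
      · change ySeq σ n a.1 _ = _ • ySeq σ n a.1 _
        rw [ySeq, ySeq, smul_smul]
        congr 1
        push_cast
        ring
      · change WD (ySeq σ n a.1 _) (ySeq σ n a.1 _)
        rw [ySeq, ySeq]
        exact ((a.2.1 k).wd hp).smul _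
    · rintro ⟨h1, h2⟩
      -- Dividing out the weight `e^{σ|k|}` leaves the bare derivatives. The value `0` for `p > n`
      -- is never reached.
      let J : ℕ → ℤ → L2 := fun p k =>
        if h : p ≤ n then ((ew σ k : ℂ)⁻¹) • v (⟨(p, 0), h⟩, k) else 0
      have hJ : ∀ p (h : p ≤ n) k, J p k = ((ew σ k : ℂ)⁻¹) • v (⟨(p, 0), h⟩, k) :=
        fun p h k => dif_pos h
      have hw : ∀ p < n, ∀ k, WD (J p k) (J (p + 1) k) := fun p hp k => by
        rw [hJ p hp.le, hJ (p + 1) hp]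
        exact (h2 p hp k).smul _
      have hv := memℓp_yIndex_iff.mp (lp.memℓp v)
      have hne : ∀ k, (ew σ k : ℂ) ≠ 0 := fun k => Complex.ofReal_ne_zero.mpr (ew_pos σ k).ne'
      have hS : SMem σ n (J 0) := by
        refine smem_iff_exists_jet.mpr ⟨J, rfl, hw, fun p q hpq => ?_⟩
        refine (hv ⟨(p, q), hpq⟩).congr fun k => ?_
        rw [h1, hJ p (by omega), norm_smul, norm_smul, norm_inv, norm_pow, Complex.norm_real,
          Complex.norm_intCast, Real.norm_of_nonneg (ew_pos σ k).le]
        rw [mul_inv_cancel_left₀ (ew_pos σ k).ne']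
      obtain ⟨a, ha⟩ := hS.exists_partialCoeff hσ hn
      refine ⟨a, lp.ext (funext fun i => ?_)⟩
      have hd := isWeakDeriv_of_chain (J := fun p => J p i.2) (ha i.2).symm fun p hp => hw p hp i.2
      change ySeq σ n a.1 i = v i
      have h3 : weakDeriv i.1.1.1 (partialCoeff a.1 i.2) = J i.1.1.1 i.2 :=
        weakDeriv_eq (hd _ i.fst_le)
      have hi : v i = _ := h1 i.1 i.2
      rw [ySeq, h3, hJ _ i.fst_le, smul_smul, hi]
      congr 1
      push_cast
      change (i.2 : ℂ) ^ i.1.1.2 * Complex.exp (σ * |(i.2 : ℝ)|) * _ = _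
      have he : (ew σ i.2 : ℂ) = Complex.exp (σ * |(i.2 : ℝ)|) := by
        rw [ew]; push_cast; rfl
      rw [← he, mul_inv_cancel_right₀ (hne i.2)]
  rw [this]
  have hc : ∀ i : YIndex n, Continuous fun v : lp (fun _ : YIndex n => L2) 2 => v i := fun i =>
    (continuous_apply i).comp lp.uniformContinuous_coe.continuous
  have hc' : ∀ (i : YIndex n) (c : ℂ),
      Continuous fun v : lp (fun _ : YIndex n => L2) 2 => c • v i := fun i c =>
    (continuous_const_smul (T := L2) c).comp (hc i)
  refine IsClosed.inter ?_ ?_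
  · simp only [ofPred_forall]
    exact isClosed_iInter fun pq => isClosed_iInter fun k => isClosed_eq (hc _) (hc' _ _)
  · simp only [ofPred_forall]
    exact isClosed_iInter fun p => isClosed_iInter fun hp => isClosed_iInter fun k =>
      isClosed_wd.preimage ((hc _).prodMk (hc _))

theorem xWeight_ge {σ s : ℝ} (hs : 0 ≤ s) (k : ℤ) : ew σ k ≤ xWeight σ s k := by
  refine le_mul_of_one_le_left (ew_pos σ k).le (Real.one_le_rpow ?_ (by linarith))
  nlinarith [sq_nonneg (k : ℝ)]

/-- The synthesis on the strip is reused with coefficients constant in `ψ`, and the sum is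
restricted to `ψ = 0`. -/
theorem exists_of_memℓp_xWeight {σ s : ℝ} (hσ : 0 < σ) (hs : 0 ≤ s) {c : ℤ → ℂ}
    (h : Summable fun k => (xWeight σ s k * ‖c k‖) ^ 2) :
    ∃ a : XSpace σ s, ∀ k, fourierCoeff (⇑a.toFun) k = c k := by
  have h1 : Summable fun k => ‖c k • (1 : C(I, ℂ))‖ := by
    refine Summable.of_nonneg_of_le (fun _ => norm_nonneg _) (fun k => ?_)
      (summable_of_sq_ew hσ (fun k => norm_nonneg (c k)) (summable_sq_of_le (C := 1) h
        (fun k => mul_nonneg (ew_pos σ k).le (norm_nonneg _)) fun k => ?_))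
    · rw [norm_smul, norm_one, mul_one]
    · rw [one_mul]
      exact mul_le_mul_of_nonneg_right (xWeight_ge hs k) (norm_nonneg _)
  obtain ⟨a, -, ha⟩ := exists_of_summable h1
  have h2 : ∀ k, fourierCoeff (⇑(slice a 0)) k = c k := fun k => by
    have := congrArg (fun u : C(I, ℂ) => u 0) (ha k)
    change fourierCoeff (⇑(slice a 0)) k = _ at this
    rw [this]; simp
  refine ⟨⟨slice a 0, memℓp_two_iff.mpr (h.congr fun k => ?_)⟩, h2⟩
  rw [xSeq, h2, norm_mul, Complex.norm_real, Real.norm_of_nonneg (xWeight_pos σ s k).le]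

theorem XSpace.summable {σ s : ℝ} (a : XSpace σ s) :
    Summable fun k => (xWeight σ s k * ‖fourierCoeff (⇑a.toFun) k‖) ^ 2 := by
  refine (memℓp_two_iff.mp a.2).congr fun k => ?_
  rw [xSeq, norm_mul, Complex.norm_real, Real.norm_of_nonneg (xWeight_pos σ s k).le]
  rfl

theorem completeSpace_XSpace {σ s : ℝ} (hσ : 0 < σ) (hs : 0 ≤ s) : CompleteSpace (XSpace σ s) := by
  refine completeSpace_of_isClosed_range (XSpace.toSeq σ s) (fun _ => rfl) ?_
  have : range (XSpace.toSeq σ s) = univ := by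
    refine eq_univ_of_forall fun v => ?_
    have hp := xWeight_pos σ s
    obtain ⟨a, ha⟩ := exists_of_memℓp_xWeight (c := fun k => (xWeight σ s k : ℂ)⁻¹ * v k) hσ hs (by
      refine (memℓp_two_iff.mp (lp.memℓp v)).congr fun k => ?_
      rw [norm_mul, norm_inv, Complex.norm_real, Real.norm_of_nonneg (hp k).le,
        mul_inv_cancel_left₀ (hp k).ne'])
    refine ⟨a, lp.ext (funext fun k => ?_)⟩
    change xSeq σ s a.1 k = v k
    have h1 : fourierCoeff (⇑a.1) k = _ := ha k
    rw [xSeq, h1, mul_inv_cancel_left₀ (Complex.ofReal_ne_zero.mpr (hp k).ne')]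
  rw [this]
  exact isClosed_univ

/-! ### Continuous linear maps by the closed graph theorem -/

/-- Closed graph theorem: continuity of `T` may be checked in any coarser Hausdorff topology, since
equality after a continuous injection is a closed condition. -/
theorem continuous_of_injective_comp {E F G : Type*} [NormedAddCommGroup E] [NormedSpace ℂ E]
    [CompleteSpace E] [NormedAddCommGroup F] [NormedSpace ℂ F] [CompleteSpace F]
    [TopologicalSpace G] [T2Space G] (T : E →ₗ[ℂ] F) {j : F → G} (hj : Continuous j)
    (hinj : Function.Injective j) (h : Continuous fun x => j (T x)) : Continuous T := by
  refine T.continuous_of_isClosed_graph ?_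
  have : (T.graph : Set (E × F)) = {q | j q.2 = j (T q.1)} := by
    ext q
    simp [LinearMap.mem_graph_iff, hinj.eq_iff]
  rw [this]
  exact isClosed_eq (hj.comp continuous_snd) (h.comp continuous_fst)

/-- The partial Fourier coefficients of an element of `Y_σ^n`, in `L²(0,1)`. -/
def YSpace.coeff {σ : ℝ} {n : ℕ} (a : YSpace σ n) (k : ℤ) : L2 := toL2 (partialCoeff a.toFun k)

theorem YSpace.coeff_add {σ : ℝ} {n : ℕ} (a b : YSpace σ n) (k : ℤ) :
    (a + b).coeff k = a.coeff k + b.coeff k := by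
  change toL2 (partialCoeff (a.toFun + b.toFun) k) = _
  rw [partialCoeff_add, map_add]; rfl

theorem YSpace.coeff_smul {σ : ℝ} {n : ℕ} (c : ℂ) (a : YSpace σ n) (k : ℤ) :
    (c • a).coeff k = c • a.coeff k := by
  change toL2 (partialCoeff (c • a.toFun) k) = _
  rw [partialCoeff_smul, map_smul]; rfl

theorem YSpace.norm_weakDeriv_le {σ : ℝ} (hσ : 0 < σ) {n p : ℕ} (hp : p ≤ n) (a : YSpace σ n)
    (k : ℤ) : ‖weakDeriv p (partialCoeff a.toFun k)‖ ≤ ‖a‖ := by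
  have h := lp.norm_apply_le_norm (by norm_num) (YSpace.toSeq σ n a) (⟨(p, 0), hp⟩, k)
  refine le_trans ?_ h
  change _ ≤ ‖ySeq σ n a.1 _‖
  rw [norm_ySeq]
  simp only [pow_zero, one_mul]
  refine le_mul_of_one_le_left (norm_nonneg _) (Real.one_le_exp (by positivity))

theorem YSpace.continuous_weakDeriv {σ : ℝ} (hσ : 0 < σ) {n p : ℕ} (hp : p ≤ n) (k : ℤ) :
    Continuous fun a : YSpace σ n => weakDeriv p (partialCoeff a.toFun k) := by
  let T : YSpace σ n →ₗ[ℂ] L2 :=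
    { toFun := fun a => weakDeriv p (partialCoeff a.toFun k)
      map_add' := fun a b => by
        change weakDeriv p (partialCoeff (a.1 + b.1) k) = _
        rw [partialCoeff_add, weakDeriv_add (a.2.1 k) (b.2.1 k) hp]; rfl
      map_smul' := fun c a => by
        change weakDeriv p (partialCoeff (c • a.1) k) = _
        rw [partialCoeff_smul, weakDeriv_smul c (a.2.1 k) hp]; rfl }
  exact (T.mkContinuous 1 fun a => by
    rw [one_mul]; exact YSpace.norm_weakDeriv_le hσ hp a k).continuous

theorem YSpace.continuous_coeff {σ : ℝ} (hσ : 0 < σ) {n : ℕ} (k : ℤ) :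
    Continuous fun a : YSpace σ n => a.coeff k := by
  have h := YSpace.continuous_weakDeriv (n := n) hσ (Nat.zero_le n) k
  simp only [weakDeriv_zero] at h
  exact h

theorem YSpace.ext_coeff {σ σ' : ℝ} {n n' : ℕ} {a : YSpace σ n} {b : YSpace σ' n'}
    (h : ∀ k, a.coeff k = b.coeff k) : a.toFun = b.toFun :=
  eq_of_partialCoeff fun k => toL2_injective (h k)

theorem YSpace.toFun_injective {σ : ℝ} {n : ℕ} :
    Function.Injective (YSpace.toFun : YSpace σ n → C(Strip, ℂ)) := Subtype.val_injective

theorem YSpace.coeff_injective {σ : ℝ} {n : ℕ} :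
    Function.Injective (YSpace.coeff : YSpace σ n → ℤ → L2) := fun _ _ h =>
  YSpace.toFun_injective (YSpace.ext_coeff fun k => congrFun h k)

/-- The inclusion of `Y_σ^n` in the continuous functions. -/
theorem YSpace.continuous_toFun {σ : ℝ} (hσ : 0 < σ) {n : ℕ} (hn : 1 ≤ n) :
    Continuous (YSpace.toFun : YSpace σ n → C(Strip, ℂ)) := by
  have := completeSpace_YSpace hσ hn
  let T : YSpace σ n →ₗ[ℂ] C(Strip, ℂ) :=
    { toFun := YSpace.toFun, map_add' := fun _ _ => rfl, map_smul' := fun _ _ => rfl }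
  refine continuous_of_injective_comp T (j := fun a k => toL2 (partialCoeff a k)) ?_ ?_ ?_
  · exact continuous_pi fun k => toL2.continuous.comp (partialCoeffL k).continuous
  · exact fun a b h => eq_of_partialCoeff fun k => toL2_injective (congrFun h k)
  · exact continuous_pi fun k => YSpace.continuous_coeff hσ k

/-- The tool for building operators into `Y_σ^n`: prescribe the coefficients linearly and
continuously one at a time and check membership; boundedness is automatic. -/
theorem exists_clm_YSpace {σ : ℝ} (hσ : 0 < σ) {n : ℕ} (hn : 1 ≤ n) {E : Type*}
    [NormedAddCommGroup E] [NormedSpace ℂ E] [CompleteSpace E] (T : E → ℤ → L2)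
    (hadd : ∀ x y k, T (x + y) k = T x k + T y k) (hsmul : ∀ (c : ℂ) x k, T (c • x) k = c • T x k)
    (hT : ∀ k, Continuous fun e => T e k) (h : ∀ e, SMem σ n (T e)) :
    ∃ L : E →L[ℂ] YSpace σ n, ∀ e k, (L e).coeff k = T e k := by
  have := completeSpace_YSpace hσ hn
  choose L hL using fun e => (h e).exists_partialCoeff hσ hn
  have hL' : ∀ e k, (L e).coeff k = T e k := hL
  let L' : E →ₗ[ℂ] YSpace σ n :=
    { toFun := L
      map_add' := fun x y => YSpace.coeff_injective (funext fun k => by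
        rw [YSpace.coeff_add, hL', hL', hL', hadd])
      map_smul' := fun c x => YSpace.coeff_injective (funext fun k => by
        rw [RingHom.id_apply, YSpace.coeff_smul, hL', hL', hsmul]) }
  refine ⟨⟨L', continuous_of_injective_comp L' (j := YSpace.coeff) ?_ YSpace.coeff_injective ?_⟩,
    hL'⟩
  · exact continuous_pi fun k => YSpace.continuous_coeff hσ k
  · refine continuous_pi fun k => ?_
    change Continuous fun x => (L x).coeff k
    simpa only [hL'] using hT k

/-! ### Convolutions -/

/-- Young's inequality `ℓ¹ * ℓ² ⊆ ℓ²`: each shifted sequence `W j` is an element of `ℓ²` with norm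
at most `f j ‖g‖`, so the series over `j` converges absolutely in `ℓ²`. -/
theorem summable_sq_tsum {W : ℤ → ℤ → L2} {f g : ℤ → ℝ} (hf0 : ∀ j, 0 ≤ f j)
    (hf : Summable f) (hg : Summable fun k => g k ^ 2) (h : ∀ j k, ‖W j k‖ ≤ f j * g (k - j)) :
    (∀ k, Summable fun j => W j k) ∧ Summable fun k => ‖∑' j, W j k‖ ^ 2 := by
  have hgj : ∀ j, HasSum (fun k => g (k - j) ^ 2) (∑' k, g k ^ 2) := fun j =>
    ((Equiv.subRight j).hasSum_iff (f := fun k => g k ^ 2)).mpr hg.hasSum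
  have hle : ∀ j k, ‖W j k‖ ^ 2 ≤ f j ^ 2 * g (k - j) ^ 2 := fun j k => by
    rw [← mul_pow]
    exact pow_le_pow_left₀ (norm_nonneg _) (h j k) 2
  have hW : ∀ j, Summable fun k => ‖W j k‖ ^ 2 := fun j =>
    Summable.of_nonneg_of_le (fun k => sq_nonneg _) (hle j) ((hgj j).summable.mul_left _)
  let F : ℤ → lp (fun _ : ℤ => L2) 2 := fun j => ⟨W j, memℓp_two_iff.mpr (hW j)⟩
  have hF : ∀ j, ‖F j‖ ≤ f j * Real.sqrt (∑' k, g k ^ 2) := fun j => by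
    have h1 := lp.norm_rpow_eq_tsum (p := 2) (by norm_num) (F j)
    simp only [ENNReal.toReal_ofNat, Real.rpow_ofNat] at h1
    rw [← abs_of_nonneg (norm_nonneg (F j)), ← abs_of_nonneg (mul_nonneg (hf0 j)
      (Real.sqrt_nonneg _)), ← sq_le_sq, h1, mul_pow,
      Real.sq_sqrt (tsum_nonneg fun k => sq_nonneg _), ← (hgj j).tsum_eq, ← tsum_mul_left]
    exact Summable.tsum_le_tsum (hle j) (hW j) ((hgj j).summable.mul_left _)
  have hs : Summable F := Summable.of_norm_bounded (hf.mul_right _) hF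
  have he : ∀ k, HasSum (fun j => W j k) ((∑' j, F j : lp (fun _ : ℤ => L2) 2) k) := fun k =>
    hs.hasSum.map (AddMonoidHom.mk' (fun v : lp (fun _ : ℤ => L2) 2 => v k) fun _ _ => rfl)
      ((continuous_apply k).comp lp.uniformContinuous_coe.continuous)
  refine ⟨fun k => (he k).summable, ?_⟩
  refine (memℓp_two_iff.mp (lp.memℓp (∑' j, F j))).congr fun k => ?_
  rw [(he k).tsum_eq]

/-- The triangle inequality `|k| ≤ |j| + |k-j|`. This submultiplicativity lets the analytic weight
pass through convolutions. -/
theorem ew_le {σ : ℝ} (hσ : 0 < σ) (j k : ℤ) : ew σ k ≤ ew σ j * ew σ (k - j) := by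
  rw [ew, ew, ew, ← Real.exp_add, Real.exp_le_exp, ← mul_add]
  refine mul_le_mul_of_nonneg_left ?_ hσ.le
  have := abs_add_le (j : ℝ) ((k - j : ℤ) : ℝ)
  push_cast at this ⊢
  rwa [add_sub_cancel] at this

/-- The convolution of sequences in `C[0,1]` and `L²(0,1)`. -/
def conv (a : ℤ → C(I, ℂ)) (B : ℤ → L2) (k : ℤ) : L2 := ∑' j, mulL2 (a j) (B (k - j))

/-- The convolution converges and belongs to the sequence space of order `n`. -/
def ConvMem (σ : ℝ) (n : ℕ) (a : ℤ → C(I, ℂ)) (B : ℤ → L2) : Prop :=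
  (∀ k, Summable fun j => mulL2 (a j) (B (k - j))) ∧ SMem σ n (conv a B)

theorem convMem_zero_of_weighted {σ : ℝ} {a : ℤ → C(I, ℂ)} {B : ℤ → L2}
    (h : (∀ k, Summable fun j => (ew σ k : ℂ) • mulL2 (a j) (B (k - j))) ∧
      Summable fun k => ‖∑' j, (ew σ k : ℂ) • mulL2 (a j) (B (k - j))‖ ^ 2) :
    ConvMem σ 0 a B := by
  have hne : ∀ k, (ew σ k : ℂ) ≠ 0 := fun k => Complex.ofReal_ne_zero.mpr (ew_pos σ k).ne'
  refine ⟨fun k => ((h.1 k).const_smul ((ew σ k : ℂ)⁻¹)).congr fun j => ?_,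
    h.2.congr fun k => ?_⟩
  · rw [inv_smul_smul₀ (hne k)]
  rw [tsum_const_smul'', norm_smul, Complex.norm_real, Real.norm_of_nonneg (ew_pos σ k).le]
  rfl

/-- Young's inequality with the summable weight on the continuous factor; `convMem_zero_right` puts
it on the `L²` factor. -/
theorem convMem_zero_left {σ : ℝ} (hσ : 0 < σ) {a : ℤ → C(I, ℂ)} {B : ℤ → L2}
    (ha : Summable fun k => ew σ k * ‖a k‖) (hB : SMem σ 0 B) : ConvMem σ 0 a B := by
  refine convMem_zero_of_weighted (summable_sq_tsum
    (W := fun j k => (ew σ k : ℂ) • mulL2 (a j) (B (k - j))) (g := fun k => ew σ k * ‖B k‖)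
    (fun k => mul_nonneg (ew_pos σ k).le (norm_nonneg _)) ha hB fun j k => ?_)
  rw [norm_smul, Complex.norm_real, Real.norm_of_nonneg (ew_pos σ k).le]
  refine (mul_le_mul (ew_le hσ j k) (norm_mulL2_le _ _) (norm_nonneg _)
    (mul_nonneg (ew_pos σ _).le (ew_pos σ _).le)).trans (le_of_eq ?_)
  ring

theorem convMem_zero_right {σ : ℝ} (hσ : 0 < σ) {a : ℤ → C(I, ℂ)} {B : ℤ → L2}
    (ha : Summable fun k => (ew σ k * ‖a k‖) ^ 2) (hB : Summable fun k => ew σ k * ‖B k‖) :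
    ConvMem σ 0 a B := by
  obtain ⟨h1, h2⟩ := summable_sq_tsum
    (W := fun j k => (ew σ k : ℂ) • mulL2 (a (k - j)) (B j)) (g := fun k => ew σ k * ‖a k‖)
    (fun k => mul_nonneg (ew_pos σ k).le (norm_nonneg _)) hB ha fun j k => by
      rw [norm_smul, Complex.norm_real, Real.norm_of_nonneg (ew_pos σ k).le]
      refine (mul_le_mul (ew_le hσ j k) (norm_mulL2_le _ _) (norm_nonneg _)
        (mul_nonneg (ew_pos σ _).le (ew_pos σ _).le)).trans (le_of_eq ?_)
      ring
  have e : ∀ k, (fun j => (ew σ k : ℂ) • mulL2 (a (k - j)) (B j)) ∘ (Equiv.subLeft k) =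
      fun j => (ew σ k : ℂ) • mulL2 (a j) (B (k - j)) := fun k => by
    funext j
    simp
  refine convMem_zero_of_weighted ⟨fun k => ?_, h2.congr fun k => ?_⟩
  · rw [← e]
    exact ((Equiv.subLeft k).summable_iff).mpr (h1 k)
  · rw [← e]
    exact congrArg (fun x => ‖x‖ ^ 2) ((Equiv.subLeft k).tsum_eq
      (fun j => (ew σ k : ℂ) • mulL2 (a (k - j)) (B j))).symm

theorem ConvMem.comm {σ : ℝ} {n : ℕ} {a b : ℤ → C(I, ℂ)}
    (h : ConvMem σ n a (fun k => toL2 (b k))) : ConvMem σ n b (fun k => toL2 (a k)) := by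
  have e : ∀ k, (fun j => mulL2 (a j) (toL2 (b (k - j)))) ∘ (Equiv.subLeft k) =
      fun j => mulL2 (b j) (toL2 (a (k - j))) := fun k => by
    funext j
    simp [mulL2_toL2, mul_comm]
  refine ⟨fun k => ?_, ?_⟩
  · rw [← e]
    exact ((Equiv.subLeft k).summable_iff).mpr (h.1 k)
  · convert h.2 using 1
    funext k
    unfold conv
    rw [← e]
    exact (Equiv.subLeft k).tsum_eq (fun j => mulL2 (a j) (toL2 (b (k - j))))

theorem wd_mulL2 {a a' : C(I, ℂ)} (ha : WD (toL2 a) (toL2 a')) {f g : L2} (h : WD f g) :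
    WD (mulL2 a f) (mulL2 a' f + mulL2 a g) := by
  obtain ⟨c, hc⟩ := h.exists_ac
  have h1 := wd_mul (a 0) c (toL2 a') g
  rw [← ha.eq_ac] at h1
  rw [hc, mulL2_toL2, mulL2_toL2, add_comm]
  rwa [mulL2_toL2, mul_comm (ac c g)] at h1

/-- The Leibniz rule in both variables: `k = j + (k-j)` distributes the factor `k` over the
convolution, and the `ψ`-derivative is taken termwise, which is legitimate because `WD` is closed.
-/
theorem ConvMem.succ {σ : ℝ} {n : ℕ} {a a' : ℤ → C(I, ℂ)} {B B' : ℤ → L2}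
    (ha : ∀ k, WD (toL2 (a k)) (toL2 (a' k))) (hB : ∀ k, WD (B k) (B' k))
    (h : ConvMem σ n a B) (h1 : ConvMem σ n (fun k => (k : ℂ) • a k) B)
    (h2 : ConvMem σ n a (fun k => (k : ℂ) • B k)) (h3 : ConvMem σ n a' B)
    (h4 : ConvMem σ n a B') : ConvMem σ (n + 1) a B := by
  refine ⟨h.1, h.2, ?_, conv a' B + conv a B', fun k => ?_, h3.2.add h4.2⟩
  · convert h1.2.add h2.2 using 1
    funext k
    rw [Pi.add_apply, conv, conv, conv, ← (h1.1 k).tsum_add (h2.1 k), ← tsum_const_smul'']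
    refine tsum_congr fun j => ?_
    rw [map_smul, map_smul, smul_apply, ← add_smul]
    push_cast
    ring_nf
  · rw [Pi.add_apply, conv, conv, conv, ← (h3.1 k).tsum_add (h4.1 k)]
    exact WD.tsum (fun j => wd_mulL2 (ha j) (hB (k - j))) (h.1 k) ((h3.1 k).add (h4.1 k))

/-- Cauchy–Schwarz against `(1+|k|)⁻¹`: one derivative in `x` improves `ℓ²` to `ℓ¹` without giving
up any of the exponential weight. -/
theorem summable_of_sq_of_mul_sq {f : ℤ → ℝ} (h0 : ∀ k, 0 ≤ f k) (h : Summable fun k => f k ^ 2)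
    (h1 : Summable fun k : ℤ => (|(k : ℝ)| * f k) ^ 2) : Summable f := by
  have h2 := summable_sq_add h h1
  have h3 : Summable fun k : ℤ => ((1 + |(k : ℝ)|)⁻¹) ^ 2 := by
    have hn : Summable fun k : ℕ => ((1 + (k : ℝ))⁻¹) ^ 2 := by
      have := (summable_nat_add_iff 1).mpr (Real.summable_nat_pow_inv.mpr one_lt_two)
      refine this.congr fun k => ?_
      push_cast
      rw [inv_pow, add_comm]
    refine Summable.of_nat_of_neg ?_ ?_ <;> simpa using hn
  refine (summable_mul_of_sq h3 h2 (fun k => by positivity)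
    fun k => add_nonneg (h0 k) (mul_nonneg (abs_nonneg _) (h0 k))).congr fun k => ?_
  have : 0 < 1 + |(k : ℝ)| := by positivity
  field_simp

theorem SMem.summable_sq_norm {σ : ℝ} {a : ℤ → C(I, ℂ)} (h : SMem σ 1 fun k => toL2 (a k)) :
    Summable fun k => (ew σ k * ‖a k‖) ^ 2 := by
  obtain ⟨u, hu, hs⟩ := h.exists_continuous le_rfl
  have : u = a := funext fun k => toL2_injective (hu k)
  rwa [this] at hs

theorem SMem.summable_ew {σ : ℝ} {B : ℤ → L2} (h : SMem σ 1 B) :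
    Summable fun k => ew σ k * ‖B k‖ := by
  refine summable_of_sq_of_mul_sq (fun k => mul_nonneg (ew_pos σ k).le (norm_nonneg _)) h.1 ?_
  have h2 : Summable _ := h.2.1
  refine h2.congr fun k => ?_
  rw [norm_smul, Complex.norm_intCast]
  ring

theorem SMem.smul_toL2 {σ : ℝ} {n : ℕ} {a : ℤ → C(I, ℂ)}
    (h : SMem σ (n + 1) fun k => toL2 (a k)) : SMem σ n fun k => toL2 ((k : ℂ) • a k) := by
  simpa only [map_smul] using h.2.1

/-- Two orders are spent, one in `ψ` for the sup norm and one in `x` for summability in `k`. This is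
the source of the condition `n ≥ 2` for products. -/
theorem SMem.summable_ew_norm {σ : ℝ} {a : ℤ → C(I, ℂ)} (h : SMem σ 2 fun k => toL2 (a k)) :
    Summable fun k => ew σ k * ‖a k‖ := by
  refine summable_of_sq_of_mul_sq (fun k => mul_nonneg (ew_pos σ k).le (norm_nonneg _))
    h.1.summable_sq_norm (h.smul_toL2.summable_sq_norm.congr fun k => ?_)
  rw [norm_smul, Complex.norm_intCast]
  ring

theorem SMem.exists_wd {σ : ℝ} {n : ℕ} (hn : 1 ≤ n) {a : ℤ → C(I, ℂ)}
    (h : SMem σ (n + 1) fun k => toL2 (a k)) : ∃ a' : ℤ → C(I, ℂ),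
      (∀ k, WD (toL2 (a k)) (toL2 (a' k))) ∧ SMem σ n fun k => toL2 (a' k) := by
  obtain ⟨-, -, A', h1, h2⟩ := h
  obtain ⟨a', ha', -⟩ := h2.exists_continuous hn
  exact ⟨a', fun k => by rw [ha']; exact h1 k, by simpa only [ha'] using h2⟩

theorem convMem_two_zero {σ : ℝ} (hσ : 0 < σ) {a : ℤ → C(I, ℂ)} {B : ℤ → L2}
    (ha : SMem σ 2 fun k => toL2 (a k)) (hB : SMem σ 0 B) : ConvMem σ 0 a B :=
  convMem_zero_left hσ ha.summable_ew_norm hB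

theorem convMem_one_one {σ : ℝ} (hσ : 0 < σ) {a : ℤ → C(I, ℂ)} {B : ℤ → L2}
    (ha : SMem σ 1 fun k => toL2 (a k)) (hB : SMem σ 1 B) : ConvMem σ 0 a B :=
  convMem_zero_right hσ ha.summable_sq_norm hB.summable_ew

theorem convMem_two_one {σ : ℝ} (hσ : 0 < σ) {a : ℤ → C(I, ℂ)} {B : ℤ → L2}
    (ha : SMem σ 2 fun k => toL2 (a k)) (hB : SMem σ 1 B) : ConvMem σ 1 a B := by
  obtain ⟨a', ha', h1⟩ := ha.exists_wd le_rfl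
  obtain ⟨B0, kB, B', hB', h2⟩ := id hB
  exact ConvMem.succ ha' hB' (convMem_two_zero hσ ha B0) (convMem_one_one hσ ha.smul_toL2 hB)
    (convMem_two_zero hσ ha kB) (convMem_one_one hσ h1 hB) (convMem_two_zero hσ ha h2)

/-- Induction by the Leibniz rule. For `n = 2` a factor that has lost a derivative still has order
one, and the other keeps order two, so `convMem_two_one` covers every term; commutativity handles
the cases in which the first factor is the differentiated one. -/
theorem convMem_self {σ : ℝ} (hσ : 0 < σ) {n : ℕ} (hn : 2 ≤ n) {a b : ℤ → C(I, ℂ)}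
    (ha : SMem σ n fun k => toL2 (a k)) (hb : SMem σ n fun k => toL2 (b k)) :
    ConvMem σ n a fun k => toL2 (b k) := by
  induction n, hn using Nat.le_induction generalizing a b with
  | base =>
    obtain ⟨a', ha', h1⟩ := ha.exists_wd le_rfl
    obtain ⟨b', hb', h2⟩ := hb.exists_wd le_rfl
    refine ConvMem.succ ha' hb' (convMem_two_one hσ ha hb.1)
      (convMem_two_one hσ hb ha.smul_toL2).comm ?_ (convMem_two_one hσ hb h1).comm
      (convMem_two_one hσ ha h2)
    exact convMem_two_one hσ ha hb.2.1
  | succ n hn ih =>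
    obtain ⟨a', ha', h1⟩ := ha.exists_wd (by omega)
    obtain ⟨b', hb', h2⟩ := hb.exists_wd (by omega)
    refine ConvMem.succ ha' hb' (ih ha.1 hb.1) (ih ha.smul_toL2 hb.1) ?_ (ih h1 hb.1) (ih ha.1 h2)
    simpa only [map_smul] using ih ha.1 hb.smul_toL2

/-! ### The algebra structure of `Y_σ^n` -/

theorem toL2_partialCoeff_mul {a b : C(Strip, ℂ)} (ha : Summable fun k => ‖partialCoeff a k‖)
    (k : ℤ) : toL2 (partialCoeff (a * b) k) =
      conv (partialCoeff a) (fun k => toL2 (partialCoeff b k)) k := by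
  have h := toL2.hasSum ((partialCoeffL k).hasSum ((hasSum_mode ha).mul_right b))
  rw [conv, ← partialCoeffL_apply, ← h.tsum_eq]
  refine tsum_congr fun j => ?_
  rw [partialCoeffL_apply, partialCoeff_mode_mul, mulL2_toL2]

theorem smem_mul {σ : ℝ} (hσ : 0 < σ) {n : ℕ} (hn : 2 ≤ n) (a b : YSpace σ n) :
    SMem σ n fun k => toL2 (partialCoeff (a.toFun * b.toFun) k) := by
  simp only [toL2_partialCoeff_mul (a.summable hσ (by omega))]
  exact (convMem_self hσ hn a.smem b.smem).2

/-- The closed graph theorem is used twice: for `b ↦ ab` with `a` fixed, then for `a ↦ (b ↦ ab)` as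
a map into the bounded operators. -/
theorem exists_mul {σ : ℝ} (hσ : 0 < σ) {n : ℕ} (hn : 2 ≤ n) :
    ∃ M : YSpace σ n →L[ℂ] YSpace σ n →L[ℂ] YSpace σ n,
      ∀ a b, (M a b).toFun = a.toFun * b.toFun := by
  have := completeSpace_YSpace (n := n) hσ (by omega)
  have hc := YSpace.continuous_toFun (n := n) hσ (by omega)
  have h1 : ∀ a : YSpace σ n, ∃ L : YSpace σ n →L[ℂ] YSpace σ n,
      ∀ b, (L b).toFun = a.toFun * b.toFun := fun a => by
    obtain ⟨L, hL⟩ := exists_clm_YSpace hσ (by omega : 1 ≤ n)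
      (fun (b : YSpace σ n) k => toL2 (partialCoeff (a.toFun * b.toFun) k))
      (fun x y k => by
        change toL2 (partialCoeff (a.toFun * (x.toFun + y.toFun)) k) = _
        rw [mul_add, partialCoeff_add, map_add])
      (fun c x k => by
        change toL2 (partialCoeff (a.toFun * (c • x.toFun)) k) = _
        rw [mul_smul_comm, partialCoeff_smul, map_smul])
      (fun k => toL2.continuous.comp ((partialCoeffL k).continuous.comp
        (continuous_const.mul hc)))
      (smem_mul hσ hn a)
    exact ⟨L, fun b => eq_of_partialCoeff fun k => toL2_injective (hL b k)⟩
  choose M hM using h1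
  let M' : YSpace σ n →ₗ[ℂ] YSpace σ n →L[ℂ] YSpace σ n :=
    { toFun := M
      map_add' := fun a b => ContinuousLinearMap.ext fun c => YSpace.toFun_injective (by
        change (M (a + b) c).toFun = (M a c).toFun + (M b c).toFun
        rw [hM, hM, hM]
        exact add_mul a.toFun b.toFun c.toFun)
      map_smul' := fun r a => ContinuousLinearMap.ext fun c => YSpace.toFun_injective (by
        change (M (r • a) c).toFun = r • (M a c).toFun
        rw [hM, hM]
        exact smul_mul_assoc r a.toFun c.toFun) }
  refine ⟨⟨M', continuous_of_injective_comp M' (j := fun L b => (L b).toFun) ?_ ?_ ?_⟩, hM⟩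
  · exact continuous_pi fun b => hc.comp (ContinuousLinearMap.apply ℂ _ b).continuous
  · exact fun L L' h => ContinuousLinearMap.ext fun b => YSpace.toFun_injective (congrFun h b)
  · refine continuous_pi fun b => ?_
    change Continuous fun x => (M x b).toFun
    simp only [hM]
    exact hc.mul continuous_const

/-! ### Partial derivatives -/

theorem exists_dx {σ : ℝ} (hσ : 0 < σ) {n : ℕ} (hn : 1 ≤ n) :
    ∃ L : YSpace σ (n + 1) →L[ℂ] YSpace σ n,
      ∀ a k, (L a).coeff k = (k * Complex.I : ℂ) • a.coeff k := by
  have := completeSpace_YSpace (n := n + 1) hσ (by omega)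
  refine exists_clm_YSpace hσ hn (fun (a : YSpace σ (n + 1)) k => (k * Complex.I : ℂ) • a.coeff k)
    (fun x y k => by rw [YSpace.coeff_add, smul_add])
    (fun c x k => by rw [YSpace.coeff_smul, smul_comm])
    (fun k => (continuous_const_smul _).comp (YSpace.continuous_coeff hσ k)) fun a => ?_
  have h := (a.smem.2.1).smul Complex.I
  convert h using 1
  funext k
  rw [smul_smul, mul_comm]; rfl

theorem YSpace.wd {σ : ℝ} {n p : ℕ} (hp : p < n) (a : YSpace σ n) (k : ℤ) :
    WD (weakDeriv p (partialCoeff a.toFun k)) (weakDeriv (p + 1) (partialCoeff a.toFun k)) :=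
  (a.2.1 k).wd hp

theorem YSpace.wd_coeff {σ : ℝ} {n : ℕ} (a : YSpace σ (n + 1)) (k : ℤ) :
    WD (a.coeff k) (weakDeriv 1 (partialCoeff a.toFun k)) := by
  have := a.wd (Nat.succ_pos n) k
  rwa [weakDeriv_zero] at this

theorem exists_dpsi {σ : ℝ} (hσ : 0 < σ) {n : ℕ} (hn : 1 ≤ n) :
    ∃ L : YSpace σ (n + 1) →L[ℂ] YSpace σ n, ∀ a k, WD (a.coeff k) ((L a).coeff k) := by
  have := completeSpace_YSpace (n := n + 1) hσ (by omega)
  obtain ⟨L, hL⟩ := exists_clm_YSpace hσ hn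
    (fun (a : YSpace σ (n + 1)) k => weakDeriv 1 (partialCoeff a.toFun k))
    (fun x y k => ((x + y).wd_coeff k).unique
      (by rw [YSpace.coeff_add]; exact (x.wd_coeff k).add (y.wd_coeff k)))
    (fun c x k => ((c • x).wd_coeff k).unique
      (by rw [YSpace.coeff_smul]; exact (x.wd_coeff k).smul c))
    (fun k => YSpace.continuous_weakDeriv hσ (by omega) k) fun a => by
      obtain ⟨-, -, A', h1, h2⟩ := a.smem
      convert h2 using 1
      funext k
      exact (a.wd_coeff k).unique (h1 k)
  exact ⟨L, fun a k => by rw [hL]; exact a.wd_coeff k⟩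

/-- The point evaluation of the Fourier series. -/
theorem YSpace.hasSum_apply {σ : ℝ} (hσ : 0 < σ) {n : ℕ} (hn : 1 ≤ n) (a : YSpace σ n)
    (x ψ : ℝ) : HasSum (fun k : ℤ => Complex.exp (k * x * Complex.I) *
      partialCoeff a.toFun k (toI ψ)) (onPlane a.toFun x ψ) := by
  have h : HasSum _ (onPlane a.toFun x ψ) := (hasSum_mode (a.summable hσ hn)).map
    (AddMonoidHom.mk' (fun f : C(Strip, ℂ) => f ((x : Circ), toI ψ)) fun _ _ => rfl)
    (continuous_eval_const _)
  convert h using 1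
  funext k
  change _ = fourier k (x : Circ) * _
  rw [fourier_coe_apply]
  congr 2
  push_cast
  have : (Real.pi : ℂ) ≠ 0 := Complex.ofReal_ne_zero.mpr Real.pi_ne_zero
  field_simp

theorem norm_exp_mul_le (k : ℤ) (x : ℝ) (u : C(I, ℂ)) (t : I) :
    ‖Complex.exp (k * x * Complex.I) * u t‖ ≤ ‖u‖ := by
  have h := Complex.norm_exp_ofReal_mul_I (k * x)
  push_cast at h
  rw [norm_mul, h, one_mul]
  exact u.norm_coe_le_norm t

/-- Termwise differentiation of the Fourier series: the differentiated series is dominated by the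
summable sup norms of the coefficients of `b`. -/
theorem hasDerivAt_onPlane_x {σ : ℝ} (hσ : 0 < σ) {n n' : ℕ} (hn : 1 ≤ n) (hn' : 1 ≤ n')
    {a : YSpace σ n} {b : YSpace σ n'}
    (h : ∀ k, b.coeff k = (k * Complex.I : ℂ) • a.coeff k) (x ψ : ℝ) :
    HasDerivAt (fun s => onPlane a.toFun s ψ) (onPlane b.toFun x ψ) x := by
  have hb : ∀ k, partialCoeff b.toFun k = (k * Complex.I : ℂ) • partialCoeff a.toFun k := fun k =>
    toL2_injective (by rw [map_smul]; exact h k)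
  have hd : ∀ (k : ℤ) (s : ℝ), HasDerivAt
      (fun s : ℝ => Complex.exp (k * s * Complex.I) * partialCoeff a.toFun k (toI ψ))
      (Complex.exp (k * s * Complex.I) * partialCoeff b.toFun k (toI ψ)) s := fun k s => by
    have h1 : HasDerivAt (fun s : ℝ => (k * s * Complex.I : ℂ)) (k * Complex.I) s := by
      have := ((Complex.ofRealCLM.hasDerivAt (x := s)).const_mul (k : ℂ)).mul_const Complex.I
      simpa using this
    have h2 := h1.cexp.mul_const (partialCoeff a.toFun k (toI ψ))
    refine h2.congr_deriv ?_
    rw [hb, ContinuousMap.smul_apply, smul_eq_mul]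
    ring
  have h3 := hasDerivAt_tsum (b.summable hσ hn') (fun k s => hd k s) (fun k s => by
    exact norm_exp_mul_le k s _ _) (y₀ := x)
    (a.hasSum_apply hσ hn x ψ).summable x
  rw [(b.hasSum_apply hσ hn' x ψ).tsum_eq] at h3
  exact h3.congr_of_eventuallyEq
    (Filter.Eventually.of_forall fun s => (a.hasSum_apply hσ hn s ψ).tsum_eq.symm)

theorem WD.hasDerivAt {u v : C(I, ℂ)} (h : WD (toL2 u) (toL2 v)) {t : ℝ} (ht : t ∈ Ioo (0 : ℝ) 1) :
    HasDerivAt (fun s => u (toI s)) (v (toI t)) t := by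
  refine (hasDerivAt_primitive (u 0) v t).congr_of_eventuallyEq ?_
  filter_upwards [isOpen_Ioo.mem_nhds ht] with s hs
  rw [h.eq_ac, ac_toL2, ← h.eq_ac, coe_toI (Ioo_subset_Icc_self hs)]

/-- The same argument, on the open interval only, since `toI` makes `onPlane` constant in `ψ`
outside `[0,1]`. -/
theorem hasDerivAt_onPlane_psi {σ : ℝ} (hσ : 0 < σ) {n n' : ℕ} (hn : 1 ≤ n) (hn' : 1 ≤ n')
    {a : YSpace σ n} {b : YSpace σ n'} (h : ∀ k, WD (a.coeff k) (b.coeff k)) (x : ℝ) {ψ : ℝ}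
    (hψ : ψ ∈ Ioo (0 : ℝ) 1) :
    HasDerivAt (fun t => onPlane a.toFun x t) (onPlane b.toFun x ψ) ψ := by
  have h3 := hasDerivAt_tsum_of_isPreconnected (b.summable hσ hn') isOpen_Ioo
    isPreconnected_Ioo (fun k s hs => ((h k).hasDerivAt hs).const_mul
      (Complex.exp (k * x * Complex.I))) (fun k s _ => norm_exp_mul_le k x _ _) (y₀ := ψ) hψ
    (a.hasSum_apply hσ hn x ψ).summable hψ
  rw [(b.hasSum_apply hσ hn' x ψ).tsum_eq] at h3
  exact h3.congr_of_eventuallyEq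
    (Filter.Eventually.of_forall fun s => (a.hasSum_apply hσ hn x s).tsum_eq.symm)

/-! ### Traces -/

theorem rpow_weight (s : ℝ) (k : ℤ) (σ : ℝ) :
    xWeight σ s k = (1 + (k : ℝ) ^ 2) ^ (s / 2) * ew σ k := rfl

theorem one_add_sq_pow_le (k : ℝ) (n : ℕ) : (1 + k ^ 2) ^ n ≤ 2 ^ n * (1 + (|k| ^ n) ^ 2) := by
  rw [← pow_mul, mul_comm n 2, pow_mul, sq_abs]
  rcases le_total (k ^ 2) 1 with h | h
  · calc (1 + k ^ 2) ^ n ≤ 2 ^ n := pow_le_pow_left₀ (by positivity) (by linarith) n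
      _ ≤ 2 ^ n * (1 + (k ^ 2) ^ n) := le_mul_of_one_le_right (by positivity)
        (le_add_of_nonneg_right (by positivity))
  · calc (1 + k ^ 2) ^ n ≤ (2 * k ^ 2) ^ n := pow_le_pow_left₀ (by positivity) (by linarith) n
      _ = 2 ^ n * (k ^ 2) ^ n := mul_pow _ _ _
      _ ≤ _ := by gcongr; linarith

theorem SMem.summable_rpow {σ : ℝ} {n : ℕ} {A : ℤ → L2} (h : SMem σ n A) :
    Summable fun k : ℤ => ((1 + (k : ℝ) ^ 2) ^ ((n : ℝ) / 2) * (ew σ k * ‖A k‖)) ^ 2 := by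
  obtain ⟨J, rfl, -, s⟩ := smem_iff_exists_jet.mp h
  have h0 := s 0 0 (Nat.zero_le _)
  have hn := s 0 n (by omega)
  refine Summable.of_nonneg_of_le (fun k => sq_nonneg _) (fun k => ?_)
    ((h0.add hn).mul_left (2 ^ n))
  have e : ((1 + (k : ℝ) ^ 2) ^ ((n : ℝ) / 2)) ^ 2 = (1 + (k : ℝ) ^ 2) ^ n := by
    have e1 : (n : ℝ) / 2 * ((2 : ℕ) : ℝ) = n := by push_cast; ring
    rw [← Real.rpow_natCast, ← Real.rpow_mul (by positivity), e1, Real.rpow_natCast]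
  rw [mul_pow, e]
  refine (mul_le_mul_of_nonneg_right (one_add_sq_pow_le k n) (sq_nonneg _)).trans (le_of_eq ?_)
  ring

/-- The trace theorem. In the interpolation bound at a point, the coefficient is controlled with `n`
derivatives and its `ψ`-derivative with `n-1`; the scale chosen for each mode makes both
contributions cost exactly half an order. -/
theorem summable_trace {σ : ℝ} {n : ℕ} (hn : 1 ≤ n) (a : YSpace σ n) (t : I) :
    Summable fun k => (xWeight σ ((n : ℝ) - 1 / 2) k * ‖partialCoeff a.toFun k t‖) ^ 2 := by
  obtain ⟨n, rfl⟩ : ∃ l, n = l + 1 := ⟨n - 1, by omega⟩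
  obtain ⟨-, -, A', hw, hA⟩ := a.smem
  refine summable_sq_of_le (C := 1) (summable_sq_add a.smem.summable_rpow hA.summable_rpow)
    (fun k => mul_nonneg (xWeight_pos _ _ _).le (norm_nonneg _)) fun k => ?_
  have h1 : (1 : ℝ) ≤ 1 + (k : ℝ) ^ 2 := by nlinarith [sq_nonneg (k : ℝ)]
  have h0 : (0 : ℝ) < 1 + (k : ℝ) ^ 2 := by linarith
  -- With `δ = (1+k²)^{-1/2}`, the factors `δ^{∓1/2}` are `(1+k²)^{±1/4}`, which shift the order `n
  -- - 1/2` to `n` and to `n - 1`.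
  have h2 := (hw k).norm_apply_le t (δ := (1 + (k : ℝ) ^ 2) ^ (-(1 / 2) : ℝ))
    (Real.rpow_pos_of_pos h0 _) (Real.rpow_le_one_of_one_le_of_nonpos h1 (by norm_num))
  rw [Real.sqrt_eq_rpow, ← Real.rpow_mul h0.le, ← Real.rpow_neg h0.le] at h2
  rw [one_mul, rpow_weight]
  refine (mul_le_mul_of_nonneg_left h2 (by
    exact mul_nonneg (Real.rpow_nonneg h0.le _) (ew_pos _ _).le)).trans (le_of_eq ?_)
  have e1 : (1 + (k : ℝ) ^ 2) ^ (((n + 1 : ℕ) : ℝ) / 2) =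
      (1 + (k : ℝ) ^ 2) ^ ((((n + 1 : ℕ) : ℝ) - 1 / 2) / 2) *
        (1 + (k : ℝ) ^ 2) ^ (-(-(1 / 2) * (1 / 2)) : ℝ) := by
    rw [← Real.rpow_add h0]; congr 1; ring
  have e2 : (1 + (k : ℝ) ^ 2) ^ ((n : ℝ) / 2) =
      (1 + (k : ℝ) ^ 2) ^ ((((n + 1 : ℕ) : ℝ) - 1 / 2) / 2) *
        (1 + (k : ℝ) ^ 2) ^ (-(1 / 2) * (1 / 2) : ℝ) := by
    rw [← Real.rpow_add h0]; congr 1; push_cast; ring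
  rw [e1, e2]
  ring

theorem eq_of_fourierCoeff {f g : C(Circ, ℂ)} (h : ∀ k, fourierCoeff (⇑f) k = fourierCoeff (⇑g) k) :
    f = g := by
  refine sub_eq_zero.mp (eq_zero_of_fourierCoeff fun k => ?_)
  have h1 := fourierCoeff_add_continuous f ((-1 : ℂ) • g) k
  rw [fourierCoeff_smul_continuous, neg_one_smul, ← sub_eq_add_neg] at h1
  rw [h1, h]; simp

theorem XSpace.toFun_injective {σ s : ℝ} :
    Function.Injective (XSpace.toFun : XSpace σ s → C(Circ, ℂ)) := Subtype.val_injective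

theorem XSpace.continuous_fourierCoeff {σ s : ℝ} (k : ℤ) :
    Continuous fun a : XSpace σ s => fourierCoeff (⇑a.toFun) k := by
  let T : XSpace σ s →ₗ[ℂ] ℂ :=
    { toFun := fun a => fourierCoeff (⇑a.toFun) k
      map_add' := fun a b => fourierCoeff_add_continuous a.1 b.1 k
      map_smul' := fun c a => fourierCoeff_smul_continuous c a.1 k }
  refine (T.mkContinuous (xWeight σ s k)⁻¹ fun a => ?_).continuous
  have h : ‖xSeq σ s a.1 k‖ ≤ ‖a‖ :=
    lp.norm_apply_le_norm (by norm_num) (XSpace.toSeq σ s a) k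
  rw [xSeq, norm_mul, Complex.norm_real, Real.norm_of_nonneg (xWeight_pos σ s k).le] at h
  rw [inv_mul_eq_div, le_div_iff₀' (xWeight_pos σ s k)]
  exact h

theorem exists_trace {σ : ℝ} (hσ : 0 < σ) {n : ℕ} (hn : 1 ≤ n) (t : I) :
    ∃ L : YSpace σ n →L[ℂ] XSpace σ ((n : ℝ) - 1 / 2),
      ∀ a x, (L a).toFun x = a.toFun (x, t) := by
  have := completeSpace_YSpace hσ hn
  have hs : (0 : ℝ) ≤ (n : ℝ) - 1 / 2 := by
    have : (1 : ℝ) ≤ n := by exact_mod_cast hn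
    linarith
  have := completeSpace_XSpace hσ hs
  choose L hL using fun a : YSpace σ n => exists_of_memℓp_xWeight hσ hs (summable_trace hn a t)
  have hL' : ∀ a, (L a).toFun = slice a.toFun t := fun a => eq_of_fourierCoeff (hL a)
  let L' : YSpace σ n →ₗ[ℂ] XSpace σ ((n : ℝ) - 1 / 2) :=
    { toFun := L
      map_add' := fun a b => XSpace.toFun_injective (by
        change (L (a + b)).toFun = (L a).toFun + (L b).toFun
        rw [hL', hL', hL']; rfl)
      map_smul' := fun c a => XSpace.toFun_injective (by
        change (L (c • a)).toFun = c • (L a).toFun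
        rw [hL', hL']; rfl) }
  refine ⟨⟨L', continuous_of_injective_comp L' (j := fun f k => fourierCoeff (⇑f.toFun) k)
    (continuous_pi fun k => XSpace.continuous_fourierCoeff k)
    (fun f g h => XSpace.toFun_injective (eq_of_fourierCoeff (congrFun h)))
    (continuous_pi fun k => ?_)⟩, fun a x => by
      change (L a).toFun x = _
      rw [hL']; rfl⟩
  change Continuous fun a => fourierCoeff (⇑(L a).toFun) k
  simp only [hL]
  exact (continuous_eval_const t).comp
    ((partialCoeffL k).continuous.comp (YSpace.continuous_toFun hσ hn))

/-! ### Functions that do not depend on `x` -/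

theorem HSpace.norm_weakDeriv_le {n p : ℕ} (hp : p ≤ n) (F : HSpace n) :
    ‖weakDeriv p F.toFun‖ ≤ ‖F‖ :=
  PiLp.norm_apply_le (HSpace.jet n F) ⟨p, Nat.lt_succ_iff.mpr hp⟩

theorem HSpace.continuous_toL2 {n : ℕ} : Continuous fun F : HSpace n => toL2 F.toFun := by
  let T : HSpace n →ₗ[ℂ] L2 :=
    { toFun := fun F => toL2 F.toFun
      map_add' := fun F G => map_add toL2 F.1 G.1
      map_smul' := fun c F => map_smul toL2 c F.1 }
  refine (T.mkContinuous 1 fun F => ?_).continuous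
  rw [one_mul]
  have := HSpace.norm_weakDeriv_le (Nat.zero_le n) F
  rwa [weakDeriv_zero] at this

theorem exists_lift {σ : ℝ} (hσ : 0 < σ) {n : ℕ} (hn : 1 ≤ n) :
    ∃ L : HSpace n →L[ℂ] YSpace σ n, ∀ F k, (L F).coeff k = if k = 0 then toL2 F.toFun else 0 := by
  have := completeSpace_HSpace hn
  refine exists_clm_YSpace hσ hn (fun (F : HSpace n) (k : ℤ) => if k = 0 then toL2 F.toFun else 0)
    (fun F G k => ?_) (fun c F k => ?_) (fun k => ?_) fun F => ?_
  · split_ifs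
    · exact map_add toL2 F.1 G.1
    · rw [add_zero]
  · split_ifs
    · exact map_smul toL2 c F.1
    · rw [smul_zero]
  · split_ifs
    · exact HSpace.continuous_toL2
    · exact continuous_const
  · refine smem_iff_exists_jet.mpr
      ⟨fun p k => if k = 0 then weakDeriv p F.toFun else 0, ?_, fun p hp k => ?_, fun p q _ => ?_⟩
    · simp only [weakDeriv_zero]
    · by_cases hk : k = 0
      · simpa only [if_pos hk, HSpace.toFun] using F.2.wd hp
      · simpa only [if_neg hk] using WD.zero
    · refine summable_of_ne_finset_zero (s := {0}) fun k hk => ?_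
      rw [Finset.mem_singleton] at hk
      simp [hk]

theorem toFun_of_coeff_zero {σ : ℝ} {n : ℕ} {a : YSpace σ n} {u : C(I, ℂ)}
    (h : ∀ k, a.coeff k = if k = 0 then toL2 u else 0) (z : Strip) : a.toFun z = u z.2 := by
  have h1 : a.toFun = mode 0 u := eq_of_partialCoeff fun k => toL2_injective (by
    rw [partialCoeff_mode]
    refine (h k).trans ?_
    split_ifs <;> simp)
  rw [h1]
  change fourier 0 z.1 * u z.2 = _
  simp

/-- The `x`-average is a left inverse of the operator of `exists_lift`; it makes the data with
vorticity depending on `ψ` only a complemented subspace. -/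
theorem exists_mean {σ : ℝ} (hσ : 0 < σ) {n : ℕ} (hn : 1 ≤ n) :
    ∃ L : YSpace σ n →L[ℂ] HSpace n, ∀ a, (L a).toFun = partialCoeff a.toFun 0 := by
  have := completeSpace_HSpace hn
  have := completeSpace_YSpace hσ hn
  let L : YSpace σ n →ₗ[ℂ] HSpace n :=
    { toFun := fun a => ⟨partialCoeff a.toFun 0, a.2.1 0⟩
      map_add' := fun a b => Subtype.ext (partialCoeff_add a.1 b.1 0)
      map_smul' := fun c a => Subtype.ext (partialCoeff_smul c a.1 0) }
  refine ⟨⟨L, continuous_of_injective_comp L (j := fun F : HSpace n => toL2 F.toFun)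
    HSpace.continuous_toL2 (fun F G h => Subtype.ext (toL2_injective h))
    (YSpace.continuous_coeff hσ 0)⟩, fun a => rfl⟩

/-! ### The Dirichlet problem for `-u'' + κ² u = h` on `[0,1]` -/

theorem inner_toL2_toL2 (u v : C(I, ℂ)) :
    inner ℂ (toL2 u) (toL2 v) = ∫ t in (0 : ℝ)..1, v (toI t) * starRingEnd ℂ (u (toI t)) := by
  rw [inner_toL2, intervalIntegral.integral_of_le zero_le_one, integral_Ioc_eq_integral_Ioo]
  refine integral_congr_ae ?_
  filter_upwards [coeFn_toL2 v] with t ht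
  rw [ht]

/-- Integration by parts with boundary terms, from the fundamental theorem of calculus for `v ū`. -/
theorem inner_add_inner {u u' v v' : C(I, ℂ)} (hu : WD (toL2 u) (toL2 u'))
    (hv : WD (toL2 v) (toL2 v')) : inner ℂ (toL2 u) (toL2 v') + inner ℂ (toL2 u') (toL2 v) =
      v 1 * starRingEnd ℂ (u 1) - v 0 * starRingEnd ℂ (u 0) := by
  have hc : ∀ x : C(I, ℂ), Continuous fun t : ℝ => x (toI t) := fun x =>
    x.continuous.comp continuous_toI
  have h := intervalIntegral.integral_eq_sub_of_hasDerivAt_of_le (a := 0) (b := 1)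
    (f := fun t => v (toI t) * starRingEnd ℂ (u (toI t)))
    (f' := fun t => v' (toI t) * starRingEnd ℂ (u (toI t)) +
      v (toI t) * starRingEnd ℂ (u' (toI t))) zero_le_one
    ((hc v).mul (Complex.continuous_conj.comp (hc u))).continuousOn (fun t ht => by
      exact (hv.hasDerivAt ht).mul (hu.hasDerivAt ht).star)
    ((((hc v').mul (Complex.continuous_conj.comp (hc u))).add
      ((hc v).mul (Complex.continuous_conj.comp (hc u')))).intervalIntegrable _ _)
  have i1 : IntervalIntegrable (fun t => v' (toI t) * starRingEnd ℂ (u (toI t))) volume 0 1 :=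
    ((hc v').mul (Complex.continuous_conj.comp (hc u))).intervalIntegrable _ _
  have i2 : IntervalIntegrable (fun t => v (toI t) * starRingEnd ℂ (u' (toI t))) volume 0 1 :=
    ((hc v).mul (Complex.continuous_conj.comp (hc u'))).intervalIntegrable _ _
  rw [intervalIntegral.integral_add i1 i2] at h
  rw [inner_toL2_toL2, inner_toL2_toL2, h, coe_toI zero_mem_I, coe_toI one_mem_I]
  rfl

/-- Energy identity: `κ² ‖u‖² + ‖u'‖² = 0`. Only `u' = 0` and `u 0 = 0` are used, so the mode `κ =
0` is included. -/
theorem dirichlet_unique {u u' : C(I, ℂ)} {κ : ℝ} (h1 : WD (toL2 u) (toL2 u'))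
    (h2 : WD (toL2 u') ((κ ^ 2 : ℂ) • toL2 u)) (h0 : u 0 = 0) (h3 : u 1 = 0) : u = 0 := by
  rw [← map_smul] at h2
  have h := inner_add_inner h1 h2
  rw [h0, h3, map_zero, mul_zero, mul_zero, sub_zero, map_smul, inner_smul_right,
    inner_self_eq_norm_sq_to_K, inner_self_eq_norm_sq_to_K] at h
  have hr : κ ^ 2 * ‖toL2 u‖ ^ 2 + ‖toL2 u'‖ ^ 2 = 0 := by
    have h' : ((κ ^ 2 * ‖toL2 u‖ ^ 2 + ‖toL2 u'‖ ^ 2 : ℝ) : ℂ) = 0 := by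
      push_cast
      exact h
    exact_mod_cast h'
  have h4 : ‖toL2 u'‖ ^ 2 = 0 := by nlinarith [sq_nonneg (κ * ‖toL2 u‖), sq_nonneg ‖toL2 u'‖]
  have h5 : toL2 u' = 0 := norm_eq_zero.mp (pow_eq_zero_iff two_ne_zero |>.mp h4)
  rw [h1.eq_ac, h5, h0]
  ext t
  simp [ac]

/-- Expand `‖κ² u - u''‖²`. The cross term is `2κ² ‖u'‖²` up to boundary terms, and these contain
`u'` at the endpoints, which is bounded by `‖u'‖` and `‖u''‖` and then absorbed. The power `κ^{3/2}`
on the boundary values is the one that matches the order `m - 1/2` of the data. -/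
theorem dirichlet_estimate {u u' u'' : C(I, ℂ)} {κ : ℝ} (hκ : 1 ≤ κ)
    (h1 : WD (toL2 u) (toL2 u')) (h2 : WD (toL2 u') (toL2 u'')) :
    (κ * ‖toL2 u'‖) ^ 2 + (κ ^ 2 * ‖toL2 u‖) ^ 2 ≤ ‖(κ ^ 2 : ℂ) • toL2 u - toL2 u''‖ ^ 2 +
      3 * (κ * Real.sqrt κ * (‖u 0‖ + ‖u 1‖)) ^ 2 := by
  have hκ0 : 0 < κ := by linarith
  have hs : 0 < Real.sqrt κ := Real.sqrt_pos.mpr hκ0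
  have hss : Real.sqrt κ * Real.sqrt κ = κ := Real.mul_self_sqrt hκ0.le
  -- The interpolation scale is `δ = 1/κ`, admissible because `κ ≥ 1`.
  have hb : ∀ t, ‖u' t‖ ≤ Real.sqrt κ * ‖toL2 u'‖ + (Real.sqrt κ)⁻¹ * ‖toL2 u''‖ := fun t => by
    have := h2.norm_apply_le t (δ := κ⁻¹) (inv_pos.mpr hκ0) (inv_le_one_of_one_le₀ hκ)
    rwa [Real.sqrt_inv, inv_inv] at this
  have hI := inner_add_inner h1 h2
  set N0 := ‖toL2 u‖
  set N1 := ‖toL2 u'‖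
  set N2 := ‖toL2 u''‖
  set S := ‖u 0‖ + ‖u 1‖ with hS
  have hre : |(inner ℂ (toL2 u) (toL2 u'')).re + N1 ^ 2| ≤
      (Real.sqrt κ * N1 + (Real.sqrt κ)⁻¹ * N2) * S := by
    rw [inner_self_eq_norm_sq_to_K] at hI
    have e : (inner ℂ (toL2 u) (toL2 u'')).re + N1 ^ 2 =
        (u' 1 * starRingEnd ℂ (u 1) - u' 0 * starRingEnd ℂ (u 0)).re := by
      rw [← hI, Complex.add_re]
      congr 1
      norm_cast
    rw [e]
    refine (Complex.abs_re_le_norm _).trans ((norm_sub_le _ _).trans ?_)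
    rw [norm_mul, norm_mul, RCLike.norm_conj, RCLike.norm_conj, hS, mul_add, add_comm]
    exact add_le_add (mul_le_mul_of_nonneg_right (hb 0) (norm_nonneg _))
      (mul_le_mul_of_nonneg_right (hb 1) (norm_nonneg _))
  have hn := norm_sub_sq (𝕜 := ℂ) ((κ ^ 2 : ℂ) • toL2 u) (toL2 u'')
  have hin : (inner ℂ ((κ ^ 2 : ℂ) • toL2 u) (toL2 u'')).re =
      κ ^ 2 * (inner ℂ (toL2 u) (toL2 u'')).re := by
    rw [inner_smul_left, map_pow, Complex.conj_ofReal, ← Complex.ofReal_pow, Complex.re_ofReal_mul]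
  have hns : ‖(κ ^ 2 : ℂ) • toL2 u‖ = κ ^ 2 * N0 := by
    rw [norm_smul, norm_pow, Complex.norm_real, Real.norm_of_nonneg hκ0.le]
  have hn' : ‖(κ ^ 2 : ℂ) • toL2 u - toL2 u''‖ ^ 2 = (κ ^ 2 * N0) ^ 2 -
      2 * (κ ^ 2 * (inner ℂ (toL2 u) (toL2 u'')).re) + N2 ^ 2 := by
    rw [hn, hns]
    congr 2
    rw [← hin]; rfl
  rw [hn']
  have h5 := (abs_le.mp hre).2
  have h6 : κ ^ 2 * ((Real.sqrt κ * N1 + (Real.sqrt κ)⁻¹ * N2) * S) =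
      (κ * N1 + N2) * (κ * Real.sqrt κ * S) := by
    have : κ ^ 2 * (Real.sqrt κ)⁻¹ = κ * Real.sqrt κ := by
      nth_rewrite 1 [← hss]
      field_simp
      nth_rewrite 2 [← hss]
      ring
    calc _ = (κ * N1 * (κ * Real.sqrt κ) + N2 * (κ ^ 2 * (Real.sqrt κ)⁻¹)) * S := by ring
      _ = _ := by rw [this]; ring
  have h7 := mul_le_mul_of_nonneg_left h5 (sq_nonneg κ)
  rw [h6] at h7
  -- With `B = κ^{3/2} S`: `2κN1·B ≤ (κN1)² + B²` and `2N2·B ≤ N2²/2 + 2B²`, whence the constant `3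
  -- = 1 + 2`.
  nlinarith [sq_nonneg (κ * N1 - κ * Real.sqrt κ * S),
    sq_nonneg (N2 - 2 * (κ * Real.sqrt κ * S)), sq_nonneg N2]

/-- The operator factors as `(D - κ)(D + κ) u = -h`. Two first-order equations are solved by
integrating factors, `v' = κv - h` with `v 0 = c` and `w' = -κw + v` with `w 0 = f`, and `c` is
found by shooting. This also works for `κ = 0`. -/
theorem dirichlet_exists (κ : ℝ) (h : C(I, ℂ)) (f g : ℂ) : ∃ u u' u'' : C(I, ℂ),
    WD (toL2 u) (toL2 u') ∧ WD (toL2 u') (toL2 u'') ∧ u'' = (κ ^ 2 : ℂ) • u - h ∧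
      u 0 = f ∧ u 1 = g := by
  let e : ℝ → ℂ := fun t => Complex.exp ((κ * t : ℝ) : ℂ)
  let e' : ℝ → ℂ := fun t => Complex.exp ((-(κ * t) : ℝ) : ℂ)
  have hee : ∀ t, e' t * e t = 1 := fun t => by
    simp only [e, e']
    rw [← Complex.exp_add, ← Complex.ofReal_add]
    simp
  have hmul : ∀ t : ℝ, HasDerivAt (fun t : ℝ => ((κ * t : ℝ) : ℂ)) κ t := fun t => by
    have := ((hasDerivAt_id t).const_mul κ).ofReal_comp
    simpa using this
  have hde : ∀ t, HasDerivAt e (κ * e t) t := fun t => by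
    have := (hmul t).cexp
    rwa [mul_comm] at this
  have hde' : ∀ t, HasDerivAt e' (-κ * e' t) t := fun t => by
    have h1 : HasDerivAt (fun t : ℝ => ((-(κ * t) : ℝ) : ℂ)) (-κ) t := by
      simp only [Complex.ofReal_neg]
      exact (hmul t).neg
    have := h1.cexp
    rwa [mul_comm] at this
  have hce : Continuous e := continuous_iff_continuousAt.mpr fun t => (hde t).continuousAt
  have hce' : Continuous e' := continuous_iff_continuousAt.mpr fun t => (hde' t).continuousAt
  have hch : Continuous fun t : ℝ => h (toI t) := h.continuous.comp continuous_toI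
  have hprim : ∀ {q : ℝ → ℂ}, Continuous q → ∀ t,
      HasDerivAt (fun t => ∫ s in (0 : ℝ)..t, q s) (q t) t := fun hq t =>
    (hq.integral_hasStrictDerivAt 0 t).hasDerivAt
  let v : ℂ → ℝ → ℂ := fun c t => e t * (c - ∫ s in (0 : ℝ)..t, e' s * h (toI s))
  have hdv : ∀ c t, HasDerivAt (v c) (κ * v c t - h (toI t)) t := fun c t => by
    refine ((hde t).mul ((hprim (hce'.mul hch) t).const_sub c)).congr_deriv ?_
    have := hee t
    simp only [v, Pi.mul_apply]
    linear_combination (-h (toI t)) * this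
  have hcv : ∀ c, Continuous (v c) := fun c =>
    continuous_iff_continuousAt.mpr fun t => (hdv c t).continuousAt
  let w : ℂ → ℝ → ℂ := fun c t => e' t * (f + ∫ s in (0 : ℝ)..t, e s * v c s)
  have hdw : ∀ c t, HasDerivAt (w c) (-κ * w c t + v c t) t := fun c t => by
    refine ((hde' t).mul ((hprim (hce.mul (hcv c)) t).const_add f)).congr_deriv ?_
    have := hee t
    simp only [w, Pi.mul_apply]
    linear_combination (v c t) * this
  have hcw : ∀ c, Continuous (w c) := fun c =>
    continuous_iff_continuousAt.mpr fun t => (hdw c t).continuousAt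
  have hddw : ∀ c t, HasDerivAt (fun t => -κ * w c t + v c t) (κ ^ 2 * w c t - h (toI t)) t :=
    fun c t => by
      refine (((hdw c t).const_mul (-κ : ℂ)).add (hdv c t)).congr_deriv ?_
      ring
  have hw0 : ∀ c, w c 0 = f := fun c => by simp [w, e']
  have hw1 : ∀ c, w c 1 = e' 1 * (f + c * (∫ s in (0 : ℝ)..1, e s * e s) +
      ∫ s in (0 : ℝ)..1, e s * v 0 s) := fun c => by
    have h1 : ∫ s in (0 : ℝ)..1, e s * v c s =
        ∫ s in (0 : ℝ)..1, (c * (e s * e s) + e s * v 0 s) := by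
      refine intervalIntegral.integral_congr fun s _ => ?_
      simp only [v]
      ring
    have i1 : IntervalIntegrable (fun s => c * (e s * e s)) volume 0 1 :=
      (continuous_const.mul (hce.mul hce)).intervalIntegrable _ _
    have i2 : IntervalIntegrable (fun s => e s * v 0 s) volume 0 1 :=
      (hce.mul (hcv 0)).intervalIntegrable _ _
    simp only [w]
    rw [h1, intervalIntegral.integral_add i1 i2, intervalIntegral.integral_const_mul, add_assoc]
  have hpos : (∫ s in (0 : ℝ)..1, e s * e s) ≠ 0 := by
    have h1 : (∫ s in (0 : ℝ)..1, e s * e s) =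
        ((∫ s in (0 : ℝ)..1, Real.exp (κ * s) * Real.exp (κ * s) : ℝ) : ℂ) := by
      rw [← intervalIntegral.integral_ofReal]
      refine intervalIntegral.integral_congr fun s _ => ?_
      simp [e]
    rw [h1]
    refine Complex.ofReal_ne_zero.mpr (ne_of_gt ?_)
    exact intervalIntegral.intervalIntegral_pos_of_pos
      (Continuous.intervalIntegrable (by fun_prop) _ _) (fun s => by positivity) one_pos
  obtain ⟨c, hc⟩ : ∃ c, w c 1 = g := by
    -- By `hw1` the value `w c 1` is affine in `c`, with slope a nonzero multiple of `∫ e²`; this is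
    -- the root of `w c 1 = g`.
    refine ⟨(e 1 * g - f - ∫ s in (0 : ℝ)..1, e s * v 0 s) / (∫ s in (0 : ℝ)..1, e s * e s), ?_⟩
    rw [hw1, div_mul_cancel₀ _ hpos]
    linear_combination g * hee 1
  refine ⟨⟨fun t => w c t, (hcw c).comp continuous_subtype_val⟩,
    ⟨fun t => -κ * w c t + v c t, ((continuous_const.mul (hcw c)).add (hcv c)).comp
      continuous_subtype_val⟩,
    ⟨fun t => κ ^ 2 * w c t - h (toI t), ((continuous_const.mul (hcw c)).sub hch).comp
      continuous_subtype_val⟩, ?_, ?_, ?_, hw0 c, hc⟩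
  · exact wd_of_hasDerivAt (hdw c) ((continuous_const.mul (hcw c)).add (hcv c))
      (fun t => rfl) (fun t => rfl)
  · exact wd_of_hasDerivAt (hddw c) ((continuous_const.mul (hcw c)).sub hch)
      (fun t => rfl) (fun t => rfl)
  · ext t
    change κ ^ 2 * w c t - h (toI t) = κ ^ 2 * w c t - h t
    rw [toI_coe]

/-! ### The Dirichlet problem on the strip -/

theorem partialCoeff_apply (a : C(Strip, ℂ)) (k : ℤ) (t : I) :
    partialCoeff a k t = fourierCoeff (⇑(slice a t)) k := rfl

theorem YSpace.summable_jet {σ : ℝ} {n : ℕ} (a : YSpace σ n) {p q : ℕ} (h : p + q ≤ n) :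
    Summable fun k : ℤ => (|(k : ℝ)| ^ q *
      (ew σ k * ‖weakDeriv p (partialCoeff a.toFun k)‖)) ^ 2 := by
  refine (memℓp_yIndex_iff.mp a.2.2 ⟨(p, q), h⟩).congr fun k => ?_
  rw [norm_ySeq]; rfl

/-- For `k ≠ 0` lower powers are dominated by higher ones. The mode `k = 0` needs its own term,
since `0 ^ N` vanishes for `N > 0` while `0 ^ 0 = 1`. -/
theorem summable_lower {f : ℤ → ℝ} {N q : ℕ} (hq : q ≤ N)
    (h : Summable fun k : ℤ => (|(k : ℝ)| ^ N * f k) ^ 2) :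
    Summable fun k : ℤ => (|(k : ℝ)| ^ q * f k) ^ 2 := by
  have h0 : Summable fun k : ℤ => if k = 0 then f 0 ^ 2 else 0 := (hasSum_ite_eq 0 (f 0 ^ 2)).summable
  refine Summable.of_nonneg_of_le (fun k => sq_nonneg _) (fun k => ?_) (h.add h0)
  by_cases hk : k = 0
  · subst hk
    rw [if_pos rfl, mul_pow]
    refine le_add_of_nonneg_of_le (sq_nonneg _) (mul_le_of_le_one_left (sq_nonneg _) ?_)
    refine pow_le_one₀ (by positivity) (pow_le_one₀ (by positivity) ?_)
    simp
  · rw [if_neg hk, add_zero, mul_pow, mul_pow]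
    have h1 : (1 : ℝ) ≤ |(k : ℝ)| := by exact_mod_cast Int.one_le_abs hk
    gcongr

/-- Elliptic regularity. The estimate for a single mode, multiplied by `|k|^{2n} e^{2σ|k|}` and
summed, controls the derivatives of order zero and one in `ψ`; the equation trades every further
pair of `ψ`-derivatives for two `x`-derivatives and a derivative of `h`. -/
theorem dirichlet_smem {σ : ℝ} {n : ℕ} (h : YSpace σ n)
    (f g : XSpace σ (((n + 2 : ℕ) : ℝ) - 1 / 2)) {u u' u'' : ℤ → C(I, ℂ)}
    (h1 : ∀ k, WD (toL2 (u k)) (toL2 (u' k))) (h2 : ∀ k, WD (toL2 (u' k)) (toL2 (u'' k)))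
    (h3 : ∀ k : ℤ, u'' k = (((k : ℝ) : ℂ) ^ 2) • u k - partialCoeff h.toFun k)
    (h4 : ∀ k, u k 0 = fourierCoeff (⇑f.toFun) k) (h5 : ∀ k, u k 1 = fourierCoeff (⇑g.toFun) k) :
    SMem σ (n + 2) fun k => toL2 (u k) := by
  -- Derivatives of the solution generated by the equation: `D^{p+2} u = k² D^p u - D^p h`.
  let J : ℕ → ℤ → L2 := fun p => Nat.twoStepInduction (motive := fun _ => ℤ → L2)
    (fun k => toL2 (u k)) (fun k => toL2 (u' k))
    (fun p A _ k => (((k : ℝ) : ℂ) ^ 2) • A k - weakDeriv p (partialCoeff h.toFun k)) p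
  have hJ : ∀ p k, J (p + 2) k =
      (((k : ℝ) : ℂ) ^ 2) • J p k - weakDeriv p (partialCoeff h.toFun k) := fun p k => rfl
  have hW : ∀ p, p < n + 2 → ∀ k, WD (J p k) (J (p + 1) k) := by
    intro p
    induction p using Nat.twoStepInduction with
    | zero => exact fun _ k => h1 k
    | one =>
      intro _ k
      rw [hJ, weakDeriv_zero]
      have := h2 k
      rwa [h3, map_sub, map_smul] at this
    | more p ih _ =>
      intro hp k
      rw [hJ, hJ]
      exact ((ih (by omega) k).smul _).sub (h.wd (by omega) k)
  -- The estimate requires `|k| ≥ 1`; the mode `k = 0` is added to the majorant as a separate term.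
  have key : Summable fun k : ℤ => (|(k : ℝ)| ^ n * ew σ k) ^ 2 *
      ((|(k : ℝ)| * ‖toL2 (u' k)‖) ^ 2 + (|(k : ℝ)| ^ 2 * ‖toL2 (u k)‖) ^ 2) := by
    have s1 := h.summable_jet (p := 0) (q := n) (by omega)
    have s2 := summable_sq_add f.summable g.summable
    refine (Summable.of_nonneg_of_le (fun k => ?_) (fun k => ?_)
      ((s1.add (s2.mul_left 3)).add (hasSum_ite_eq (0 : ℤ)
        ((|((0 : ℤ) : ℝ)| ^ n * ew σ 0) ^ 2 * ((|((0 : ℤ) : ℝ)| * ‖toL2 (u' 0)‖) ^ 2 +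
          (|((0 : ℤ) : ℝ)| ^ 2 * ‖toL2 (u 0)‖) ^ 2))).summable))
    · positivity
    by_cases hk : k = 0
    · subst hk
      rw [if_pos rfl]
      exact le_add_of_nonneg_left (by positivity)
    rw [if_neg hk, add_zero]
    have hk1 : (1 : ℝ) ≤ |(k : ℝ)| := by exact_mod_cast Int.one_le_abs hk
    have hk0 : (0 : ℝ) < |(k : ℝ)| := by linarith
    have h6 := dirichlet_estimate hk1 (h1 k) (h2 k)
    have e1 : ((|(k : ℝ)| : ℝ) : ℂ) ^ 2 • toL2 (u k) - toL2 (u'' k) =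
        weakDeriv 0 (partialCoeff h.toFun k) := by
      rw [h3, map_sub, map_smul, weakDeriv_zero, ← Complex.ofReal_pow, sq_abs, Complex.ofReal_pow,
        sub_sub_cancel]
    rw [e1, h4, h5] at h6
    refine (mul_le_mul_of_nonneg_left h6 (sq_nonneg _)).trans ?_
    rw [mul_add]
    refine add_le_add (le_of_eq (by ring)) ?_
    -- The total power is `n + 3/2 = (n + 2) - 1/2`, precisely the order of the boundary data.
    have hx : |(k : ℝ)| ^ n * ew σ k * (|(k : ℝ)| * Real.sqrt |(k : ℝ)|) ≤
        xWeight σ (((n + 2 : ℕ) : ℝ) - 1 / 2) k := by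
      have e2 : |(k : ℝ)| ^ n * (|(k : ℝ)| * Real.sqrt |(k : ℝ)|) =
          (|(k : ℝ)| ^ (2 : ℝ)) ^ ((((n + 2 : ℕ) : ℝ) - 1 / 2) / 2) := by
        rw [← Real.rpow_mul hk0.le, Real.sqrt_eq_rpow]
        nth_rewrite 2 [← Real.rpow_one |(k : ℝ)|]
        rw [← Real.rpow_natCast, ← Real.rpow_add hk0, ← Real.rpow_add hk0]
        congr 1
        push_cast
        ring
      rw [mul_right_comm, e2, rpow_weight]
      refine mul_le_mul_of_nonneg_right (Real.rpow_le_rpow (by positivity) ?_ ?_) (ew_pos σ k).le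
      · rw [Real.rpow_ofNat, sq_abs]; linarith
      · push_cast
        have : (0 : ℝ) ≤ n := Nat.cast_nonneg n
        linarith
    have hx0 : 0 ≤ |(k : ℝ)| ^ n * ew σ k * (|(k : ℝ)| * Real.sqrt |(k : ℝ)|) :=
      mul_nonneg (mul_nonneg (by positivity) (ew_pos σ k).le) (by positivity)
    have h7 : (|(k : ℝ)| ^ n * ew σ k * (|(k : ℝ)| * Real.sqrt |(k : ℝ)|) *
        (‖fourierCoeff (⇑f.toFun) k‖ + ‖fourierCoeff (⇑g.toFun) k‖)) ^ 2 ≤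
        (xWeight σ (((n + 2 : ℕ) : ℝ) - 1 / 2) k *
          (‖fourierCoeff (⇑f.toFun) k‖ + ‖fourierCoeff (⇑g.toFun) k‖)) ^ 2 :=
      pow_le_pow_left₀ (mul_nonneg hx0 (by positivity))
        (mul_le_mul_of_nonneg_right hx (by positivity)) 2
    calc _ = 3 * (|(k : ℝ)| ^ n * ew σ k * (|(k : ℝ)| * Real.sqrt |(k : ℝ)|) *
        (‖fourierCoeff (⇑f.toFun) k‖ + ‖fourierCoeff (⇑g.toFun) k‖)) ^ 2 := by ring
      _ ≤ _ := by
        rw [← mul_add]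
        exact mul_le_mul_of_nonneg_left h7 (by norm_num)
  have k0 : Summable fun k : ℤ => (|(k : ℝ)| ^ (n + 2) * (ew σ k * ‖J 0 k‖)) ^ 2 := by
    refine Summable.of_nonneg_of_le (fun k => sq_nonneg _) (fun k => ?_) key
    change (|(k : ℝ)| ^ (n + 2) * (ew σ k * ‖toL2 (u k)‖)) ^ 2 ≤ _
    have : 0 ≤ (|(k : ℝ)| ^ n * ew σ k) ^ 2 * (|(k : ℝ)| * ‖toL2 (u' k)‖) ^ 2 := by positivity
    rw [mul_add]
    exact le_trans (le_of_eq (by ring)) (le_add_of_nonneg_left this)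
  have k1 : Summable fun k : ℤ => (|(k : ℝ)| ^ (n + 1) * (ew σ k * ‖J 1 k‖)) ^ 2 := by
    refine Summable.of_nonneg_of_le (fun k => sq_nonneg _) (fun k => ?_) key
    change (|(k : ℝ)| ^ (n + 1) * (ew σ k * ‖toL2 (u' k)‖)) ^ 2 ≤ _
    have : 0 ≤ (|(k : ℝ)| ^ n * ew σ k) ^ 2 * (|(k : ℝ)| ^ 2 * ‖toL2 (u k)‖) ^ 2 := by positivity
    rw [mul_add]
    exact le_trans (le_of_eq (by ring)) (le_add_of_nonneg_right this)
  refine smem_iff_exists_jet.mpr ⟨J, rfl, hW, fun p => ?_⟩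
  induction p using Nat.twoStepInduction with
  | zero => exact fun q hq => summable_lower (by omega) k0
  | one => exact fun q hq => summable_lower (by omega) k1
  | more p ih _ =>
    intro q hq
    refine summable_sq_of_le (C := 1) (summable_sq_add (ih (q + 2) (by omega))
      (h.summable_jet (p := p) (q := q) (by omega)))
      (fun k => mul_nonneg (by positivity) (mul_nonneg (ew_pos σ k).le (norm_nonneg _))) fun k => ?_
    rw [hJ]
    have e3 : ‖(((k : ℝ) : ℂ) ^ 2) • J p k‖ = |(k : ℝ)| ^ 2 * ‖J p k‖ := by
      rw [norm_smul, norm_pow, Complex.norm_real, Real.norm_eq_abs]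
    have h8 := norm_sub_le ((((k : ℝ) : ℂ) ^ 2) • J p k) (weakDeriv p (partialCoeff h.toFun k))
    rw [e3] at h8
    refine (mul_le_mul_of_nonneg_left (mul_le_mul_of_nonneg_left h8 (ew_pos σ k).le)
      (by positivity)).trans (le_of_eq ?_)
    ring

theorem exists_dirichlet {σ : ℝ} (hσ : 0 < σ) {n : ℕ} (h : YSpace σ n)
    (f g : XSpace σ (((n + 2 : ℕ) : ℝ) - 1 / 2)) : ∃ a : YSpace σ (n + 2),
      (∀ x, a.toFun (x, 0) = f.toFun x) ∧ (∀ x, a.toFun (x, 1) = g.toFun x) ∧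
      ∃ A' : ℤ → L2, (∀ k, WD (a.coeff k) (A' k)) ∧
        ∀ k, WD (A' k) ((((k : ℝ) : ℂ) ^ 2) • a.coeff k - h.coeff k) := by
  choose u u' u'' h1 h2 h3 h4 h5 using fun k : ℤ => dirichlet_exists (k : ℝ)
    (partialCoeff h.toFun k) (fourierCoeff (⇑f.toFun) k) (fourierCoeff (⇑g.toFun) k)
  obtain ⟨a, ha⟩ := (dirichlet_smem h f g h1 h2 h3 h4 h5).exists_partialCoeff hσ (by omega)
  have ha' : ∀ k, partialCoeff a.toFun k = u k := fun k => toL2_injective (ha k)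
  have e0 : slice a.toFun 0 = f.toFun := eq_of_fourierCoeff fun k => by
    rw [← partialCoeff_apply, ha', h4]
  have e1 : slice a.toFun 1 = g.toFun := eq_of_fourierCoeff fun k => by
    rw [← partialCoeff_apply, ha', h5]
  refine ⟨a, fun x => congrArg (fun v : C(Circ, ℂ) => v x) e0,
    fun x => congrArg (fun v : C(Circ, ℂ) => v x) e1, fun k => toL2 (u' k), fun k => ?_,
    fun k => ?_⟩
  · rw [YSpace.coeff, ha]; exact h1 k
  · have := h2 k
    rw [h3, map_sub, map_smul] at this
    rw [YSpace.coeff, ha]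
    exact this

theorem dirichlet_injective {σ : ℝ} {n : ℕ} {a : YSpace σ (n + 1)} {A' : YSpace σ n}
    (h0 : ∀ x, a.toFun (x, 0) = 0) (h1 : ∀ x, a.toFun (x, 1) = 0)
    (hw : ∀ k, WD (a.coeff k) (A'.coeff k))
    (hw' : ∀ k : ℤ, WD (A'.coeff k) ((((k : ℝ) : ℂ) ^ 2) • a.coeff k)) : a = 0 := by
  have hz : ∀ t : I, (∀ x, a.toFun (x, t) = 0) → ∀ k, partialCoeff a.toFun k t = 0 :=
    fun t ht k => by
      have : slice a.toFun t = 0 := ContinuousMap.ext ht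
      rw [partialCoeff_apply, this]
      simp [fourierCoeff]
  exact YSpace.toFun_injective (eq_zero_of_partialCoeff fun k =>
    dirichlet_unique (hw k) (hw' k) (hz 0 h0 k) (hz 1 h1 k))

/-! ### The operators in the equation -/

/-- The open strip is dense, so pointwise identities for the derivatives, available only there,
determine continuous functions on the closed strip. -/
theorem eq_of_onPlane {a b : C(Strip, ℂ)}
    (h : ∀ x : ℝ, ∀ ψ ∈ Ioo (0 : ℝ) 1, onPlane a x ψ = onPlane b x ψ) : a = b := by
  refine ContinuousMap.ext fun z => ?_
  obtain ⟨x, t⟩ := z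
  obtain ⟨x, rfl⟩ := QuotientAddGroup.mk_surjective x
  have hc : ∀ a : C(Strip, ℂ), Continuous fun s : ℝ => onPlane a x s := fun a =>
    a.continuous.comp (continuous_const.prodMk continuous_toI)
  have h4 : EqOn (fun s : ℝ => onPlane a x s) (fun s => onPlane b x s) (closure (Ioo 0 1)) :=
    EqOn.closure (fun s hs => h x s hs) (hc a) (hc b)
  rw [closure_Ioo zero_ne_one] at h4
  have := h4 t.2
  simp only [onPlane, toI_coe] at this
  exact this

/-- The bounded operators from which the boundary value problem is built. -/
structure FlowOperators (σ : ℝ) (n : ℕ) where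
  mul : YSpace σ n →L[ℂ] YSpace σ n →L[ℂ] YSpace σ n
  dX : YSpace σ (n + 2) →L[ℂ] YSpace σ n
  dP : YSpace σ (n + 2) →L[ℂ] YSpace σ n
  dXX : YSpace σ (n + 2) →L[ℂ] YSpace σ n
  dXP : YSpace σ (n + 2) →L[ℂ] YSpace σ n
  dPP : YSpace σ (n + 2) →L[ℂ] YSpace σ n
  lower : YSpace σ (n + 2) →L[ℂ] XSpace σ (((n + 2 : ℕ) : ℝ) - 1 / 2)
  upper : YSpace σ (n + 2) →L[ℂ] XSpace σ (((n + 2 : ℕ) : ℝ) - 1 / 2)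
  lift : HSpace n →L[ℂ] YSpace σ n
  mean : YSpace σ n →L[ℂ] HSpace n
  mul_toFun : ∀ a b, (mul a b).toFun = a.toFun * b.toFun
  dX_eq : ∀ a x ψ, dx (onPlane a.toFun) x ψ = onPlane (dX a).toFun x ψ
  dP_eq : ∀ a x, ∀ ψ ∈ Ioo (0 : ℝ) 1, dpsi (onPlane a.toFun) x ψ = onPlane (dP a).toFun x ψ
  dXX_eq : ∀ a x ψ, dx (dx (onPlane a.toFun)) x ψ = onPlane (dXX a).toFun x ψ
  dXP_eq : ∀ a x, ∀ ψ ∈ Ioo (0 : ℝ) 1,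
    dx (dpsi (onPlane a.toFun)) x ψ = onPlane (dXP a).toFun x ψ
  dPP_eq : ∀ a x, ∀ ψ ∈ Ioo (0 : ℝ) 1,
    dpsi (dpsi (onPlane a.toFun)) x ψ = onPlane (dPP a).toFun x ψ
  lower_toFun : ∀ a x, (lower a).toFun x = a.toFun (x, 0)
  upper_toFun : ∀ a x, (upper a).toFun x = a.toFun (x, 1)
  lift_toFun : ∀ F z, (lift F).toFun z = F.toFun z.2
  mean_lift : ∀ F, mean (lift F) = F
  bijective : Function.Bijective fun a => (lower a, upper a, -dXX a - dPP a)

theorem exists_inclusion {σ : ℝ} (hσ : 0 < σ) {n : ℕ} (hn : 1 ≤ n) :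
    ∃ L : YSpace σ (n + 1) →L[ℂ] YSpace σ n, ∀ a k, (L a).coeff k = a.coeff k := by
  have := completeSpace_YSpace (n := n + 1) hσ (by omega)
  exact exists_clm_YSpace hσ hn (fun (a : YSpace σ (n + 1)) k => a.coeff k)
    (fun x y k => YSpace.coeff_add x y k) (fun c x k => YSpace.coeff_smul c x k)
    (fun k => YSpace.continuous_coeff hσ k) fun a => a.smem.of_succ

theorem YSpace.coeff_neg {σ : ℝ} {n : ℕ} (a : YSpace σ n) (k : ℤ) :
    (-a).coeff k = -a.coeff k := by
  rw [← neg_one_smul ℂ a, YSpace.coeff_smul, neg_one_smul]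

theorem YSpace.coeff_sub {σ : ℝ} {n : ℕ} (a b : YSpace σ n) (k : ℤ) :
    (a - b).coeff k = a.coeff k - b.coeff k := by
  rw [sub_eq_add_neg, YSpace.coeff_add, YSpace.coeff_neg, sub_eq_add_neg]

theorem nonempty_flowOperators {σ : ℝ} (hσ : 0 < σ) {n : ℕ} (hn : 2 ≤ n) :
    Nonempty (FlowOperators σ n) := by
  have hn0 : 1 ≤ n := by omega
  have hn1 : 1 ≤ n + 1 := by omega
  have hn2 : 1 ≤ n + 2 := by omega
  obtain ⟨mul, hmul⟩ := exists_mul hσ hn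
  -- First derivatives land in order `n + 1`; the inclusion lowers them to order `n`, so that all
  -- factors lie in the same algebra as the second derivatives.
  obtain ⟨i, hi⟩ := exists_inclusion hσ hn0
  obtain ⟨x2, hx2⟩ := exists_dx hσ hn1
  obtain ⟨x1, hx1⟩ := exists_dx hσ hn0
  obtain ⟨p2, hp2⟩ := exists_dpsi hσ hn1
  obtain ⟨p1, hp1⟩ := exists_dpsi hσ hn0
  obtain ⟨l, hl⟩ := exists_trace hσ hn2 (0 : I)
  obtain ⟨u, hu⟩ := exists_trace hσ hn2 (1 : I)
  obtain ⟨lift, hlift⟩ := exists_lift hσ hn0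
  obtain ⟨mean, hmean⟩ := exists_mean hσ hn0
  have hi' : ∀ a, (i a).toFun = a.toFun := fun a => YSpace.ext_coeff (hi a)
  have ex : ∀ a, dx (onPlane a.toFun) = onPlane (x2 a).toFun := fun a => by
    funext x ψ
    exact (hasDerivAt_onPlane_x hσ hn2 hn1 (hx2 a) x ψ).deriv
  have ep : ∀ a x, ∀ ψ ∈ Ioo (0 : ℝ) 1,
      dpsi (onPlane a.toFun) x ψ = onPlane (p2 a).toFun x ψ := fun a x ψ hψ =>
    (hasDerivAt_onPlane_psi hσ hn2 hn1 (hp2 a) x hψ).deriv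
  refine ⟨⟨mul, i.comp x2, i.comp p2, x1.comp x2, x1.comp p2, p1.comp p2, l, u, lift, mean,
    hmul, fun a x ψ => ?_, fun a x ψ hψ => ?_, fun a x ψ => ?_, fun a x ψ hψ => ?_,
    fun a x ψ hψ => ?_, hl, hu, fun F z => toFun_of_coeff_zero (hlift F) z, fun F => ?_, ?_, ?_⟩⟩
  · rw [ex, ContinuousLinearMap.comp_apply, hi']
  · rw [ep a x ψ hψ, ContinuousLinearMap.comp_apply, hi']
  · rw [ex]
    exact (hasDerivAt_onPlane_x hσ hn1 hn0 (hx1 (x2 a)) x ψ).deriv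
  · have : (fun s => dpsi (onPlane a.toFun) s ψ) = fun s => onPlane (p2 a).toFun s ψ :=
      funext fun s => ep a s ψ hψ
    rw [dx, this]
    exact (hasDerivAt_onPlane_x hσ hn1 hn0 (hx1 (p2 a)) x ψ).deriv
  · refine ((hasDerivAt_onPlane_psi hσ hn1 hn0 (hp1 (p2 a)) x hψ).congr_of_eventuallyEq ?_).deriv
    filter_upwards [isOpen_Ioo.mem_nhds hψ] with s hs
    exact ep a x s hs
  · refine Subtype.ext (toL2_injective ?_)
    change toL2 (mean (lift F)).toFun = toL2 F.toFun
    rw [hmean]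
    exact (hlift F 0).trans (if_pos rfl)
  · have hxx : ∀ a k, (x1 (x2 a)).coeff k = -((((k : ℝ) : ℂ) ^ 2) • a.coeff k) := fun a k => by
      rw [hx1, hx2, smul_smul, ← neg_smul]
      congr 1
      push_cast
      linear_combination (k : ℂ) ^ 2 * Complex.I_mul_I
    let L : YSpace σ (n + 2) →ₗ[ℂ] XSpace σ (((n + 2 : ℕ) : ℝ) - 1 / 2) ×
        XSpace σ (((n + 2 : ℕ) : ℝ) - 1 / 2) × YSpace σ n :=
      (l.prod (u.prod (-(x1.comp x2) - p1.comp p2))).toLinearMap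
    have : Function.Injective L := by
      refine (injective_iff_map_eq_zero _).mpr fun a ha => ?_
      have e1 : l a = 0 := congrArg Prod.fst ha
      have e2 : u a = 0 := congrArg (fun q => q.2.1) ha
      have e3 : -x1 (x2 a) - p1 (p2 a) = 0 := congrArg (fun q => q.2.2) ha
      refine dirichlet_injective (A' := p2 a) (fun x => ?_) (fun x => ?_) (hp2 a) fun k => ?_
      · rw [← hl, e1]; rfl
      · rw [← hu, e2]; rfl
      · have e4 : p1 (p2 a) = -x1 (x2 a) := (sub_eq_zero.mp e3).symm
        have := hp1 (p2 a) k
        rwa [e4, YSpace.coeff_neg, hxx, neg_neg] at this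
    exact this
  · rintro ⟨f, g, h⟩
    obtain ⟨a, h0, h1, A', hA, hA'⟩ := exists_dirichlet hσ h f g
    refine ⟨a, Prod.ext ?_ (Prod.ext ?_ ?_)⟩
    · exact XSpace.toFun_injective (ContinuousMap.ext fun x => (hl a x).trans (h0 x))
    · exact XSpace.toFun_injective (ContinuousMap.ext fun x => (hu a x).trans (h1 x))
    · refine YSpace.coeff_injective (funext fun k => ?_)
      change (-x1 (x2 a) - p1 (p2 a)).coeff k = h.coeff k
      have e1 : A' k = (p2 a).coeff k := (hA k).unique (hp2 a k)
      have e2 := (hp1 (p2 a) k).unique (e1 ▸ hA' k)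
      rw [YSpace.coeff_sub, YSpace.coeff_neg, e2, hx1, hx2, smul_smul]
      have e3 : ((k : ℂ) * Complex.I * (k * Complex.I)) = -(((k : ℝ) : ℂ) ^ 2) := by
        push_cast
        linear_combination (k : ℂ) ^ 2 * Complex.I_mul_I
      rw [e3, neg_smul, neg_neg, sub_sub_cancel]

/-! ### The nonlinear map and its inverse -/

theorem _root_.AnalyticAt.clm_apply_of_complex {E F G : Type*} [NormedAddCommGroup E]
    [NormedSpace ℂ E] [NormedAddCommGroup F] [NormedSpace ℂ F] [NormedAddCommGroup G]
    [NormedSpace ℂ G] {c : E → F →L[ℂ] G} {u : E → F} {x : E} (hc : AnalyticAt ℂ c x)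
    (hu : AnalyticAt ℂ u x) : AnalyticAt ℂ (fun y => c y (u y)) x :=
  ((ContinuousLinearMap.id ℂ (F →L[ℂ] G)).analyticAt_bilinear (c x, u x)).comp₂ hc hu

namespace FlowOperators

variable {σ : ℝ} {n : ℕ} (O : FlowOperators σ n)

/-- The polynomial operator `a_ψ³ Φ(a)`. -/
def poly (a : YSpace σ (n + 2)) : YSpace σ n :=
  -O.mul (O.dP a) (O.mul (O.dP a) (O.dXX a)) +
    (2 : ℂ) • O.mul (O.dX a) (O.mul (O.dP a) (O.dXP a)) -
      (O.dPP a + O.mul (O.dX a) (O.mul (O.dX a) (O.dPP a)))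

/-- The operator `Φ`. -/
def vorticity (a : YSpace σ (n + 2)) : YSpace σ n :=
  -- Division by `a_ψ³` is expressed in the Banach algebra of bounded operators on `Y_σ^n`.
  -- `Ring.inverse` is zero at non-units, so this represents `Φ(a)` only where multiplication by
  -- `a_ψ` is invertible.
  (Ring.inverse (O.mul (O.dP a)) ^ 3) (O.poly a)

/-- The map that takes a flow to its boundary values and its vorticity. -/
def flowMap (a : YSpace σ (n + 2)) : XSpace σ (((n + 2 : ℕ) : ℝ) - 1 / 2) ×
    XSpace σ (((n + 2 : ℕ) : ℝ) - 1 / 2) × YSpace σ n :=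
  (O.lower a, O.upper a, O.vorticity a)

/-- The inclusion of the data with vorticity depending on `ψ` only. -/
def data : (XSpace σ (((n + 2 : ℕ) : ℝ) - 1 / 2) × XSpace σ (((n + 2 : ℕ) : ℝ) - 1 / 2) ×
    HSpace n) →L[ℂ] XSpace σ (((n + 2 : ℕ) : ℝ) - 1 / 2) ×
      XSpace σ (((n + 2 : ℕ) : ℝ) - 1 / 2) × YSpace σ n :=
  (ContinuousLinearMap.id ℂ _).prodMap ((ContinuousLinearMap.id ℂ _).prodMap O.lift)

/-- A left inverse of `data`. -/
def dataInv : (XSpace σ (((n + 2 : ℕ) : ℝ) - 1 / 2) × XSpace σ (((n + 2 : ℕ) : ℝ) - 1 / 2) ×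
    YSpace σ n) →L[ℂ] XSpace σ (((n + 2 : ℕ) : ℝ) - 1 / 2) ×
      XSpace σ (((n + 2 : ℕ) : ℝ) - 1 / 2) × HSpace n :=
  (ContinuousLinearMap.id ℂ _).prodMap ((ContinuousLinearMap.id ℂ _).prodMap O.mean)

theorem dataInv_data : Function.LeftInverse O.dataInv O.data := fun d => by
  change (d.1, d.2.1, O.mean (O.lift d.2.2)) = d
  rw [O.mean_lift]

/-- The linearization of the boundary value problem at the parallel flow. -/
def linearization (hσ : 0 < σ) (hn : 2 ≤ n) : YSpace σ (n + 2) ≃L[ℂ]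
    XSpace σ (((n + 2 : ℕ) : ℝ) - 1 / 2) × XSpace σ (((n + 2 : ℕ) : ℝ) - 1 / 2) × YSpace σ n :=
  haveI := completeSpace_YSpace (n := n + 2) hσ (by omega)
  haveI := completeSpace_YSpace (n := n) hσ (by omega)
  haveI : CompleteSpace (XSpace σ (((n + 2 : ℕ) : ℝ) - 1 / 2)) := completeSpace_XSpace hσ (by
    push_cast
    have : (0 : ℝ) ≤ n := Nat.cast_nonneg n
    linarith)
  ContinuousLinearEquiv.ofBijective (O.lower.prod (O.upper.prod (-O.dXX - O.dPP)))
    (LinearMap.ker_eq_bot.mpr O.bijective.1) (LinearMap.range_eq_top.mpr O.bijective.2)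

theorem linearization_coe (hσ : 0 < σ) (hn : 2 ≤ n) :
    (O.linearization hσ hn : YSpace σ (n + 2) →L[ℂ] _) =
      O.lower.prod (O.upper.prod (-O.dXX - O.dPP)) :=
  ContinuousLinearMap.ext fun _ => rfl

theorem analyticAt_poly (a : YSpace σ (n + 2)) : AnalyticAt ℂ O.poly a := by
  have h1 : AnalyticAt ℂ (fun a => O.mul (O.dP a)) a := (O.mul.comp O.dP).analyticAt a
  have h2 : AnalyticAt ℂ (fun a => O.mul (O.dX a)) a := (O.mul.comp O.dX).analyticAt a
  have h3 : AnalyticAt ℂ (fun a => O.mul (O.dP a) (O.dXX a)) a :=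
    h1.clm_apply_of_complex (O.dXX.analyticAt a)
  have h4 : AnalyticAt ℂ (fun a => O.mul (O.dP a) (O.dXP a)) a :=
    h1.clm_apply_of_complex (O.dXP.analyticAt a)
  have h5 : AnalyticAt ℂ (fun a => O.mul (O.dX a) (O.dPP a)) a :=
    h2.clm_apply_of_complex (O.dPP.analyticAt a)
  have h6 : AnalyticAt ℂ (fun a => O.mul (O.dP a) (O.mul (O.dP a) (O.dXX a))) a :=
    h1.clm_apply_of_complex h3
  have h7 : AnalyticAt ℂ (fun a => O.mul (O.dX a) (O.mul (O.dP a) (O.dXP a))) a :=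
    h2.clm_apply_of_complex h4
  have h8 : AnalyticAt ℂ (fun a => O.mul (O.dX a) (O.mul (O.dX a) (O.dPP a))) a :=
    h2.clm_apply_of_complex h5
  exact (h6.neg.add (h7.const_smul (c := (2 : ℂ)))).sub ((O.dPP.analyticAt a).add h8)

theorem analyticAt_inverse_mul (hσ : 0 < σ) (hn : 1 ≤ n) {a : YSpace σ (n + 2)}
    (ha : IsUnit (O.mul (O.dP a))) :
    AnalyticAt ℂ (fun a => Ring.inverse (O.mul (O.dP a)) ^ 3) a := by
  have := completeSpace_YSpace hσ hn
  obtain ⟨u, hu⟩ := ha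
  have h1 : AnalyticAt ℂ (fun a => O.mul (O.dP a)) a := (O.mul.comp O.dP).analyticAt a
  have h2 : AnalyticAt ℂ Ring.inverse (O.mul (O.dP a)) := by
    rw [← hu]
    exact analyticAt_inverse u
  have h3 : AnalyticAt ℂ (fun a => Ring.inverse (O.mul (O.dP a))) a :=
    AnalyticAt.comp (g := Ring.inverse) (f := fun a => O.mul (O.dP a)) h2 h1
  exact h3.pow 3

theorem analyticAt_flowMap (hσ : 0 < σ) (hn : 1 ≤ n) {a : YSpace σ (n + 2)}
    (ha : IsUnit (O.mul (O.dP a))) : AnalyticAt ℂ O.flowMap a :=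
  (O.lower.analyticAt a).prod ((O.upper.analyticAt a).prod
    ((O.analyticAt_inverse_mul hσ hn ha).clm_apply_of_complex (O.analyticAt_poly a)))

/-! #### The parallel flow -/

theorem onPlane_parallelFlow (x : ℝ) {ψ : ℝ} (hψ : ψ ∈ Icc (0 : ℝ) 1) :
    onPlane (parallelFlow σ (n + 2)).toFun x ψ = ψ := by
  change coordFun (toI ψ) = ψ
  rw [coe_toI hψ]; rfl

theorem dx_parallelFlow : dx (onPlane (parallelFlow σ (n + 2)).toFun) = fun _ _ => 0 := by
  funext x ψ
  have : (fun s => onPlane (parallelFlow σ (n + 2)).toFun s ψ) = fun _ => coordFun (toI ψ) := rfl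
  rw [dx, this, deriv_const]

theorem dpsi_parallelFlow (x : ℝ) {ψ : ℝ} (hψ : ψ ∈ Ioo (0 : ℝ) 1) :
    dpsi (onPlane (parallelFlow σ (n + 2)).toFun) x ψ = 1 := by
  refine ((Complex.ofRealCLM.hasDerivAt (x := ψ)).congr_of_eventuallyEq ?_).deriv
  filter_upwards [isOpen_Ioo.mem_nhds hψ] with s hs
  exact onPlane_parallelFlow x (Ioo_subset_Icc_self hs)

theorem dP_parallelFlow : (O.dP (parallelFlow σ (n + 2))).toFun = 1 :=
  eq_of_onPlane fun x ψ hψ => by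
    rw [← O.dP_eq _ x ψ hψ, dpsi_parallelFlow x hψ]; rfl

theorem dX_parallelFlow : O.dX (parallelFlow σ (n + 2)) = 0 :=
  YSpace.toFun_injective (eq_of_onPlane fun x ψ _ => by
    rw [← O.dX_eq, dx_parallelFlow]; rfl)

theorem dXX_parallelFlow : O.dXX (parallelFlow σ (n + 2)) = 0 :=
  YSpace.toFun_injective (eq_of_onPlane fun x ψ _ => by
    rw [← O.dXX_eq, dx_parallelFlow, dx, deriv_const]; rfl)

theorem dXP_parallelFlow : O.dXP (parallelFlow σ (n + 2)) = 0 :=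
  YSpace.toFun_injective (eq_of_onPlane fun x ψ hψ => by
    have : (fun s => dpsi (onPlane (parallelFlow σ (n + 2)).toFun) s ψ) = fun _ => 1 :=
      funext fun s => dpsi_parallelFlow s hψ
    rw [← O.dXP_eq _ x ψ hψ, dx, this, deriv_const]; rfl)

theorem dPP_parallelFlow : O.dPP (parallelFlow σ (n + 2)) = 0 :=
  YSpace.toFun_injective (eq_of_onPlane fun x ψ hψ => by
    rw [← O.dPP_eq _ x ψ hψ]
    refine ((hasDerivAt_const ψ (1 : ℂ)).congr_of_eventuallyEq ?_).deriv
    filter_upwards [isOpen_Ioo.mem_nhds hψ] with s hs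
    exact dpsi_parallelFlow x hs)

theorem mul_dP_parallelFlow : O.mul (O.dP (parallelFlow σ (n + 2))) = 1 :=
  ContinuousLinearMap.ext fun b => YSpace.toFun_injective (by
    rw [O.mul_toFun, dP_parallelFlow, one_mul]; rfl)

theorem poly_parallelFlow : O.poly (parallelFlow σ (n + 2)) = 0 := by
  simp [poly, dXX_parallelFlow, dXP_parallelFlow, dPP_parallelFlow]

theorem vorticity_parallelFlow : O.vorticity (parallelFlow σ (n + 2)) = 0 := by
  rw [vorticity, poly_parallelFlow, map_zero]

theorem flowMap_parallelFlow : O.flowMap (parallelFlow σ (n + 2)) =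
    O.data (0, upperWall σ (((n + 2 : ℕ) : ℝ) - 1 / 2), 0) := by
  refine Prod.ext ?_ (Prod.ext ?_ ?_)
  · refine XSpace.toFun_injective (ContinuousMap.ext fun x => ?_)
    change (O.lower _).toFun x = 0
    rw [O.lower_toFun]
    change ((0 : ℝ) : ℂ) = 0
    simp
  · refine XSpace.toFun_injective (ContinuousMap.ext fun x => ?_)
    change (O.upper _).toFun x = 1
    rw [O.upper_toFun]
    change ((1 : ℝ) : ℂ) = 1
    simp
  · change O.vorticity _ = O.lift 0
    rw [vorticity_parallelFlow, map_zero]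

/-- At the parallel flow `a_ψ = 1`, while `a_x` and all second derivatives vanish. Only the terms
that differentiate `a_xx` and the bare `a_ψψ` survive. -/
theorem hasFDerivAt_poly :
    HasFDerivAt O.poly (-O.dXX - O.dPP) (parallelFlow σ (n + 2)) := by
  set a₀ := parallelFlow σ (n + 2)
  have h1 : HasFDerivAt (fun a => O.mul (O.dP a)) (O.mul.comp O.dP) a₀ :=
    (O.mul.comp O.dP).hasFDerivAt
  have h2 : HasFDerivAt (fun a => O.mul (O.dX a)) (O.mul.comp O.dX) a₀ :=
    (O.mul.comp O.dX).hasFDerivAt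
  have h := (((h1.clm_apply (h1.clm_apply (O.dXX.hasFDerivAt (x := a₀)))).neg.add
    ((h2.clm_apply (h1.clm_apply (O.dXP.hasFDerivAt (x := a₀)))).const_smul (2 : ℂ))).sub
    ((O.dPP.hasFDerivAt (x := a₀)).add
      (h2.clm_apply (h2.clm_apply (O.dPP.hasFDerivAt (x := a₀))))))
  refine h.congr_fderiv ?_
  refine ContinuousLinearMap.ext fun b => ?_
  simp [a₀, dX_parallelFlow, dXX_parallelFlow, dXP_parallelFlow, dPP_parallelFlow,
    mul_dP_parallelFlow]

theorem isUnit_parallelFlow : IsUnit (O.mul (O.dP (parallelFlow σ (n + 2)))) := by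
  rw [mul_dP_parallelFlow]; exact isUnit_one

/-- Since `poly` vanishes at the parallel flow, the derivative of the inverse factor contributes
nothing, and the factor itself is the identity there. -/
theorem hasFDerivAt_flowMap (hσ : 0 < σ) (hn : 2 ≤ n) :
    HasFDerivAt O.flowMap (O.linearization hσ hn : YSpace σ (n + 2) →L[ℂ] _)
      (parallelFlow σ (n + 2)) := by
  rw [linearization_coe]
  refine O.lower.hasFDerivAt.prodMk (O.upper.hasFDerivAt.prodMk ?_)
  have h1 := (O.analyticAt_inverse_mul hσ (by omega) O.isUnit_parallelFlow).differentiableAt.hasFDerivAt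
  refine (h1.clm_apply O.hasFDerivAt_poly).congr_fderiv ?_
  refine ContinuousLinearMap.ext fun b => ?_
  simp [poly_parallelFlow, mul_dP_parallelFlow]

/-! #### Solutions of the boundary value problem -/

theorem onPlane_mul (a b : C(Strip, ℂ)) (x ψ : ℝ) :
    onPlane (a * b) x ψ = onPlane a x ψ * onPlane b x ψ := rfl

theorem onPlane_poly (a : YSpace σ (n + 2)) (x ψ : ℝ) :
    onPlane (O.poly a).toFun x ψ =
      -(onPlane (O.dP a).toFun x ψ * (onPlane (O.dP a).toFun x ψ * onPlane (O.dXX a).toFun x ψ)) +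
        2 * (onPlane (O.dX a).toFun x ψ *
          (onPlane (O.dP a).toFun x ψ * onPlane (O.dXP a).toFun x ψ)) -
        (onPlane (O.dPP a).toFun x ψ + onPlane (O.dX a).toFun x ψ *
          (onPlane (O.dX a).toFun x ψ * onPlane (O.dPP a).toFun x ψ)) := by
  have h : (O.poly a).toFun =
      -((O.dP a).toFun * ((O.dP a).toFun * (O.dXX a).toFun)) +
        (2 : ℂ) • ((O.dX a).toFun * ((O.dP a).toFun * (O.dXP a).toFun)) -
        ((O.dPP a).toFun + (O.dX a).toFun * ((O.dX a).toFun * (O.dPP a).toFun)) := by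
    simp only [← O.mul_toFun]
    rfl
  rw [h]
  rfl

/-- An invertible multiplication operator reaches the constant `1`, which is the `ψ`-derivative of
the parallel flow; hence `a_ψ b = 1` for some `b`. -/
theorem dP_ne_zero {a : YSpace σ (n + 2)} (ha : IsUnit (O.mul (O.dP a))) (x ψ : ℝ) :
    onPlane (O.dP a).toFun x ψ ≠ 0 := by
  obtain ⟨u, hu⟩ := ha
  have h : O.mul (O.dP a) ((↑u⁻¹ : YSpace σ n →L[ℂ] YSpace σ n) (O.dP (parallelFlow σ (n + 2)))) =
      O.dP (parallelFlow σ (n + 2)) := by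
    rw [← hu, ← mul_apply_eq_comp, Units.mul_inv]; rfl
  have h1 := congrArg (fun b : YSpace σ n => onPlane b.toFun x ψ) h
  simp only [O.mul_toFun, dP_parallelFlow, onPlane_mul] at h1
  exact left_ne_zero_of_mul_eq_one h1

theorem vorticity_eq_iff {a : YSpace σ (n + 2)} (ha : IsUnit (O.mul (O.dP a))) (w : YSpace σ n) :
    O.vorticity a = w ↔ O.poly a = (O.mul (O.dP a) ^ 3) w := by
  have h1 : O.mul (O.dP a) ^ 3 * Ring.inverse (O.mul (O.dP a)) ^ 3 = 1 := by
    obtain ⟨u, hu⟩ := ha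
    rw [← hu, Ring.inverse_unit, ← Units.val_pow_eq_pow_val, ← Units.val_pow_eq_pow_val,
      ← Units.val_mul, inv_pow, mul_inv_cancel, Units.val_one]
  have h2 : Ring.inverse (O.mul (O.dP a)) ^ 3 * O.mul (O.dP a) ^ 3 = 1 := by
    obtain ⟨u, hu⟩ := ha
    rw [← hu, Ring.inverse_unit, ← Units.val_pow_eq_pow_val, ← Units.val_pow_eq_pow_val,
      ← Units.val_mul, inv_pow, inv_mul_cancel, Units.val_one]
  rw [vorticity]
  constructor
  · rintro rfl
    rw [← mul_apply_eq_comp, h1]; rfl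
  · intro h
    rw [h, ← mul_apply_eq_comp, h2]; rfl

/-- Multiplying by `a_ψ³` turns the classical equation into a polynomial identity on the open strip,
which extends by continuity to an identity in `Y_σ^n`. The nonvanishing of `a_ψ` comes for free. -/
theorem solvesEquation_iff {a : YSpace σ (n + 2)} (ha : IsUnit (O.mul (O.dP a))) (F : HSpace n) :
    SolvesEquation F a ↔ O.vorticity a = O.lift F := by
  rw [O.vorticity_eq_iff ha]
  have key : ∀ x : ℝ, ∀ ψ ∈ Ioo (0 : ℝ) 1, Phi (onPlane a.toFun) x ψ = F.toFun (toI ψ) ↔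
      onPlane (O.poly a).toFun x ψ = onPlane ((O.mul (O.dP a) ^ 3) (O.lift F)).toFun x ψ :=
    fun x ψ hψ => by
      have hne := O.dP_ne_zero ha x ψ
      have e1 : onPlane ((O.mul (O.dP a) ^ 3) (O.lift F)).toFun x ψ =
          onPlane (O.dP a).toFun x ψ ^ 3 * F.toFun (toI ψ) := by
        have : ((O.mul (O.dP a) ^ 3) (O.lift F)).toFun =
            (O.dP a).toFun * ((O.dP a).toFun * ((O.dP a).toFun * (O.lift F).toFun)) := by
          rw [← O.mul_toFun, ← O.mul_toFun, ← O.mul_toFun]; rfl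
        rw [this, onPlane_mul, onPlane_mul, onPlane_mul]
        have e2 : onPlane (O.lift F).toFun x ψ = F.toFun (toI ψ) := O.lift_toFun F _
        rw [e2]; ring
      rw [e1, onPlane_poly, Phi, O.dP_eq a x ψ hψ, O.dX_eq, O.dXX_eq, O.dXP_eq a x ψ hψ,
        O.dPP_eq a x ψ hψ]
      generalize onPlane (O.dP a).toFun x ψ = p at hne ⊢
      have h3 : p ^ 3 ≠ 0 := pow_ne_zero 3 hne
      rw [← mul_right_inj' h3]
      refine Eq.congr_left ?_
      field_simp
  constructor
  · exact fun h => YSpace.toFun_injective (eq_of_onPlane fun x ψ hψ =>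
      (key x ψ hψ).mp (h x ψ hψ).2)
  · intro h x ψ hψ
    refine ⟨?_, (key x ψ hψ).mpr (by rw [h])⟩
    rw [O.dP_eq a x ψ hψ]
    exact O.dP_ne_zero ha x ψ

theorem solvesBVP_iff {a : YSpace σ (n + 2)} (ha : IsUnit (O.mul (O.dP a)))
    (d : XSpace σ (((n + 2 : ℕ) : ℝ) - 1 / 2) × XSpace σ (((n + 2 : ℕ) : ℝ) - 1 / 2) × HSpace n) :
    SolvesBVP d a ↔ O.flowMap a = O.data d := by
  rw [SolvesBVP, O.solvesEquation_iff ha]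
  constructor
  · rintro ⟨h1, h2, h3⟩
    refine Prod.ext ?_ (Prod.ext ?_ h1)
    · exact XSpace.toFun_injective (ContinuousMap.ext fun x => (O.lower_toFun a x).trans (h2 x))
    · exact XSpace.toFun_injective (ContinuousMap.ext fun x => (O.upper_toFun a x).trans (h3 x))
  · intro h
    have e1 : O.lower a = d.1 := congrArg Prod.fst h
    have e2 : O.upper a = d.2.1 := congrArg (fun q => q.2.1) h
    exact ⟨congrArg (fun q => q.2.2) h, fun x => by rw [← e1, O.lower_toFun],
      fun x => by rw [← e2, O.upper_toFun]⟩

/-! ### Inversion of the flow map and the manifold of stationary flows. -/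

/-- The nonlinear map is a biholomorphism near the parallel flow. -/
theorem exists_openPartialHomeomorph (hσ : 0 < σ) (hn : 2 ≤ n) :
    ∃ e : OpenPartialHomeomorph (YSpace σ (n + 2)) (XSpace σ (((n + 2 : ℕ) : ℝ) - 1 / 2) ×
      XSpace σ (((n + 2 : ℕ) : ℝ) - 1 / 2) × YSpace σ n),
      parallelFlow σ (n + 2) ∈ e.source ∧ (∀ a, e a = O.flowMap a) ∧
      (∀ a ∈ e.source, IsUnit (O.mul (O.dP a))) ∧
      AnalyticOnNhd ℂ e e.source ∧ AnalyticOnNhd ℂ e.symm e.target := by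
  have := completeSpace_YSpace (n := n + 2) hσ (by omega)
  have := completeSpace_YSpace (n := n) hσ (by omega)
  have hA := O.analyticAt_flowMap hσ (by omega) O.isUnit_parallelFlow
  have hS : HasStrictFDerivAt O.flowMap (O.linearization hσ hn : YSpace σ (n + 2) →L[ℂ] _)
      (parallelFlow σ (n + 2)) := by
    have := hA.hasStrictFDerivAt
    rwa [(O.hasFDerivAt_flowMap hσ hn).fderiv] at this
  set e₀ := hS.toOpenPartialHomeomorph O.flowMap with he₀
  have hmem : parallelFlow σ (n + 2) ∈ e₀.source := hS.mem_toOpenPartialHomeomorph_source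
  have hcoe : ∀ a, e₀ a = O.flowMap a := fun a => by
    rw [he₀, hS.toOpenPartialHomeomorph_coe]
  have hcoe' : (e₀ : YSpace σ (n + 2) → _) = O.flowMap := funext hcoe
  have hsymm : AnalyticAt ℂ e₀.symm (e₀ (parallelFlow σ (n + 2))) :=
    e₀.analyticAt_symm' (i := O.linearization hσ hn) hmem (by rwa [hcoe'])
      (by rw [hcoe']; exact (O.hasFDerivAt_flowMap hσ hn).fderiv)
  have hU : IsOpen {a : YSpace σ (n + 2) | IsUnit (O.mul (O.dP a))} :=
    Units.isOpen.preimage (O.mul.comp O.dP).continuous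
  -- Analyticity of the inverse is known at the base point only. It is an open condition, so the
  -- source is cut down to the points whose images satisfy it and at which multiplication by `a_ψ`
  -- is invertible.
  have hW : IsOpen (e₀.source ∩ e₀ ⁻¹' {y | AnalyticAt ℂ e₀.symm y}) :=
    e₀.isOpen_inter_preimage (isOpen_analyticAt ℂ e₀.symm)
  refine ⟨e₀.restrOpen _ (hU.inter hW), ⟨hmem, O.isUnit_parallelFlow, hmem, hsymm⟩, hcoe,
    fun a ha => ha.2.1, fun a ha => ?_, fun y hy => ?_⟩
  · exact (hcoe' ▸ O.analyticAt_flowMap hσ (by omega) ha.2.1 : AnalyticAt ℂ e₀ a)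
  · have h1 : y ∈ e₀.target := hy.1
    have h2 : e₀ (e₀.symm y) ∈ {y | AnalyticAt ℂ e₀.symm y} := hy.2.2.2
    rw [e₀.right_inv h1] at h2
    exact h2

end FlowOperators

/-- On the source `V` of the biholomorphism `e`, solving with data `d` means `e a = O.data d`. So
`G` is `e⁻¹` restricted to the data subspace, injectivity of `e` on `V` gives uniqueness, and the
stationary flows in `V` are the preimage of that subspace. -/
theorem exists_solution_map {σ : ℝ} (hσ : 0 < σ) {n : ℕ} (hn : 2 ≤ n) :
    ∃ (U : Set (XSpace σ (((n + 2 : ℕ) : ℝ) - 1 / 2) × XSpace σ (((n + 2 : ℕ) : ℝ) - 1 / 2) ×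
        HSpace n)) (V : Set (YSpace σ (n + 2)))
      (G : XSpace σ (((n + 2 : ℕ) : ℝ) - 1 / 2) × XSpace σ (((n + 2 : ℕ) : ℝ) - 1 / 2) ×
        HSpace n → YSpace σ (n + 2)),
      IsOpen U ∧ (0, upperWall σ (((n + 2 : ℕ) : ℝ) - 1 / 2), 0) ∈ U ∧
      IsOpen V ∧ parallelFlow σ (n + 2) ∈ V ∧
      (∀ d ∈ U, G d ∈ V ∧ SolvesBVP d (G d) ∧ ∀ a ∈ V, SolvesBVP d a → a = G d) ∧
      G (0, upperWall σ (((n + 2 : ℕ) : ℝ) - 1 / 2), 0) = parallelFlow σ (n + 2) ∧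
      AnalyticOnNhd ℂ G U ∧
      {a | ∃ F : HSpace n, SolvesEquation F a} ∩ V = G '' U ∧
      IsAnalyticBanachSubmanifold (XSpace σ (((n + 2 : ℕ) : ℝ) - 1 / 2) ×
        XSpace σ (((n + 2 : ℕ) : ℝ) - 1 / 2) × HSpace n)
        ({a | ∃ F : HSpace n, SolvesEquation F a} ∩ V) := by
  obtain ⟨O⟩ := nonempty_flowOperators hσ hn
  obtain ⟨e, h0, he, hu, ha, ha'⟩ := O.exists_openPartialHomeomorph hσ hn
  have hsol : ∀ a ∈ e.source, ∀ d, SolvesBVP d a ↔ e a = O.data d := fun a h d => by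
    rw [O.solvesBVP_iff (hu a h), he]
  have hS : ∀ a ∈ e.source, (∃ F : HSpace n, SolvesEquation F a) ↔ ∃ d, e a = O.data d :=
    fun a h => by
      constructor
      · rintro ⟨F, hF⟩
        rw [O.solvesEquation_iff (hu a h)] at hF
        exact ⟨(O.lower a, O.upper a, F), (he a).trans (Prod.ext rfl (Prod.ext rfl hF))⟩
      · rintro ⟨d, hd⟩
        exact ⟨d.2.2, ((hsol a h d).mpr hd).1⟩
  have hbase : e (parallelFlow σ (n + 2)) = O.data (0, upperWall σ _, 0) := by
    rw [he, O.flowMap_parallelFlow]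
  refine ⟨O.data ⁻¹' e.target, e.source, fun d => e.symm (O.data d),
    e.open_target.preimage O.data.continuous, ?_, e.open_source, h0, fun d hd => ?_, ?_,
    fun d hd => ?_, ?_, ?_⟩
  · rw [mem_preimage, ← hbase]
    exact e.map_source h0
  · refine ⟨e.map_target hd, (hsol _ (e.map_target hd) d).mpr (e.right_inv hd), fun a hav hs => ?_⟩
    change a = e.symm (O.data d)
    rw [← (hsol a hav d).mp hs, e.left_inv hav]
  · change e.symm (O.data _) = _
    rw [← hbase, e.left_inv h0]
  · exact (ha' _ hd).comp (O.data.analyticAt d)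
  · ext a
    constructor
    · rintro ⟨h1, h2⟩
      obtain ⟨d, hd⟩ := (hS a h2).mp h1
      refine ⟨d, ?_, ?_⟩
      · rw [mem_preimage, ← hd]; exact e.map_source h2
      · change e.symm (O.data d) = a
        rw [← hd, e.left_inv h2]
    · rintro ⟨d, hd, rfl⟩
      have h2 := e.map_target hd
      exact ⟨(hS _ h2).mpr ⟨d, e.right_inv hd⟩, h2⟩
  · have cY := completeSpace_YSpace (n := n + 2) hσ (by omega)
    have cH := completeSpace_HSpace (n := n) (by omega)
    have cX : CompleteSpace (XSpace σ (((n + 2 : ℕ) : ℝ) - 1 / 2)) := completeSpace_XSpace hσ (by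
      push_cast
      have : (0 : ℝ) ≤ n := Nat.cast_nonneg n
      linarith)
    refine ⟨inferInstance, cY, fun a has => ?_⟩
    let L := O.linearization hσ hn
    -- Charts must take values in `Y_σ^m`, so `e` is followed by the inverse `L⁻¹` of the
    -- linearization. The model subspace is then the range of `j`, complemented because `r` is a
    -- left inverse of `j`. One chart serves for all points.
    let j := (L.symm : _ →L[ℂ] YSpace σ (n + 2)).comp O.data
    let r := O.dataInv.comp (L : YSpace σ (n + 2) →L[ℂ] _)
    have hrj : Function.LeftInverse r j := fun d => by
      change O.dataInv (L (L.symm (O.data d))) = d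
      rw [L.apply_symm_apply, O.dataInv_data]
    refine ⟨j.range, e.transHomeomorph L.symm.toHomeomorph,
      j.closedComplemented_range_of_leftInverse r hrj, ⟨?_⟩, has.2, ?_, ?_, ?_⟩
    · refine (ContinuousLinearEquiv.equivOfInverse (j.codRestrict j.range fun d => ⟨d, rfl⟩)
        (r.comp j.range.subtypeL) hrj ?_).symm
      rintro ⟨_, d, rfl⟩
      exact Subtype.ext (congrArg j (hrj d))
    · exact fun b hb => (L.symm.toContinuousLinearMap.analyticAt _).comp (ha b hb)
    · intro y hy
      exact (ha' (L y) hy).comp (L.toContinuousLinearMap.analyticAt y)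
    · ext y
      constructor
      · rintro ⟨b, ⟨⟨hb1, hb2⟩, -⟩, rfl⟩
        obtain ⟨d, hd⟩ := (hS b hb2).mp hb1
        refine ⟨⟨d, ?_⟩, ?_⟩
        · change L.symm (O.data d) = L.symm (e b)
          rw [hd]
        · exact (e.transHomeomorph L.symm.toHomeomorph).map_source hb2
      · rintro ⟨⟨d, hd⟩, hy⟩
        have hy' : L y ∈ e.target := hy
        have hd' : O.data d = L y := by
          have : L.symm (O.data d) = y := hd
          rw [← this, L.apply_symm_apply]
        have h2 := e.map_target hy'
        refine ⟨e.symm (L y), ⟨⟨(hS _ h2).mpr ⟨d, ?_⟩, h2⟩, h2⟩, ?_⟩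
        · rw [e.right_inv hy', hd']
        · change L.symm (e (e.symm (L y))) = y
          rw [e.right_inv hy', L.symm_apply_apply]

end StationaryFlow

end

theorem mainTheorem1 (σ : ℝ) (hσ : 0 < σ) (m : ℕ) (hm : 3 < m) :
    ∃ (U : Set (StationaryFlow.XSpace σ ((m : ℝ) - 1 / 2) ×
          StationaryFlow.XSpace σ ((m : ℝ) - 1 / 2) × StationaryFlow.HSpace (m - 2)))
      (V : Set (StationaryFlow.YSpace σ m))
      (G : StationaryFlow.XSpace σ ((m : ℝ) - 1 / 2) ×
          StationaryFlow.XSpace σ ((m : ℝ) - 1 / 2) × StationaryFlow.HSpace (m - 2) →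
        StationaryFlow.YSpace σ m),
      IsOpen U ∧ (0, StationaryFlow.upperWall σ ((m : ℝ) - 1 / 2), 0) ∈ U ∧
      IsOpen V ∧ StationaryFlow.parallelFlow σ m ∈ V ∧
      -- the problem has exactly one solution in `V` for all data in `U`
      (∀ d ∈ U, G d ∈ V ∧ StationaryFlow.SolvesBVP d (G d) ∧
        ∀ a ∈ V, StationaryFlow.SolvesBVP d a → a = G d) ∧
      -- at the base point it is the parallel flow
      G (0, StationaryFlow.upperWall σ ((m : ℝ) - 1 / 2), 0) = StationaryFlow.parallelFlow σ m ∧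
      -- it depends complex-analytically on the data
      AnalyticOnNhd ℂ G U ∧
      -- the stationary flows in `V` are these solutions, and form an analytic Banach manifold
      StationaryFlow.stationaryFlows σ m ∩ V = G '' U ∧
      StationaryFlow.IsAnalyticBanachSubmanifold
        (StationaryFlow.XSpace σ ((m : ℝ) - 1 / 2) ×
          StationaryFlow.XSpace σ ((m : ℝ) - 1 / 2) × StationaryFlow.HSpace (m - 2))
        (StationaryFlow.stationaryFlows σ m ∩ V) := by
  -- The vorticity has order `n = m - 2`, and `m > 3` means `n ≥ 2`, the order needed for products.
  obtain ⟨n, rfl⟩ : ∃ n, m = n + 2 := ⟨m - 2, by omega⟩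
  exact StationaryFlow.exists_solution_map hσ (by omega)
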